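/- Let $k\ge 1$. For $j=1,\dots,k$ let $n_j/d_j=\tau_j$ be a rational number ($n_j\in\mathbb Z$, $d_j\ge 1$), written $\tau_j=N_j/D_j$ in lowest terms with $D_j\ge 1$, and let $M_j,\mu_j,P_j$ be natural numbers; put $S_j=\mu_jP_j$. Fix a standard unknotted, untwisted solid torus $V=\{|z|\le 1\}\times S^1$ in three-space. For $q\ge 0$ the $(p,q)$-torus link is the link on $\partial V$ that winds $q$ times in total in the longitudinal direction and $p$ times in the meridional direction, oriented in the longitudinal direction and right-handed for $p>0$ (it is empty for $q=0$). The tst link $[\Phi^{\mu_j}(n_j,d_j,M_j)]\subset V$ is the $(-S_jN_j,S_jD_j)$-torus link, together with the core of $V$ (a trivial knot) if $M_j$ is odd; here $P_j$ is the multiplicity with which the cut produces torus knots. Assume that $M_1,\dots,M_{k-1}$ are odd. The stst link $[\Phi_{j=1}^k(n_j,d_j,M_j,\mu_j)]$ is obtained from the first tst link by drilling out a tubular neighbourhood of its core component (a smaller solid torus concentric with $V$), leaving the rest untouched, filling in, without twisting, a new solid torus that contains the second tst link, then doing the same with the core component of the second tst link and the third tst link, and so on up to the $k$-th. Put $a_l=\sum_{j=l+1}^k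 S_jD_j$ and $b_l=\sum_{j=l}^k S_jD_j$, so that $a_k=0$ and $b_1=\sum_{j=1}^kS_jD_j$. Let $\sigma_i$ be the Artin generators, with $\sigma_i$ a positive (right-handed) crossing. An empty product is the trivial braid, and so is a zeroth power. Then, for every choice of these data and up to ambient isotopy of oriented links: (1) if $M_k$ is even, the stst link is the closure of the braid given by the word $$\prod_{l=1}^k\Bigl(\sigma_{a_l}^{-1}\sigma_{a_l-1}^{-1}\cdots\sigma_1^{-1}\cdot\sigma_1^{-1}\sigma_2^{-1}\cdots\sigma_{b_l-1}^{-1}\Bigr)^{S_lN_l}\in B_{b_1};$$ (2) if $M_k$ is odd, the stst link is the closure of the braid given by the word $$\prod_{l=1}^k\Bigl(\sigma_{a_l+1}^{-1}\sigma_{a_l}^{-1}\cdots\sigma_1^{-1}\cdot\sigma_1^{-1}\sigma_2^{-1}\cdots\sigma_{b_l}^{-1}\Bigr)^{S_lN_l}\in B_{b_1+1}.$$ The products are taken from left to right in increasing $l$. In particular, every generator that occurs in these words has its index in the range allowed by the stated braid group. -/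

import Mathlib

/-! ## Oriented links in three-space and ambient isotopy -/

namespace Stst

noncomputable section

/-- Euclidean three-space. -/
abbrev Space : Type := EuclideanSpace ℝ (Fin 3)

/-- An oriented link, recorded as a set of curves `ℝ → Space`. Each curve runs periodically
through one component in the direction of its orientation, and every component is traversed by at
least one curve. A component may be listed several times, with different starting points. -/
abbrev OrientedLink : Type := Set (ℝ → Space)

/-- Two curves that become the same oriented curve after an increasing reparametrization. -/
def SameOrientedCurve (γ δ : ℝ → Space) : Prop :=
  ∃ φ : ℝ ≃o ℝ, ∀ t, γ t = δ (φ t)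

/-- Oriented ambient isotopy: a continuous family of homeomorphisms of three-space that starts at
the identity and ends at one that carries the components of `L` onto the components of `L'`,
respecting their orientations. -/
def AmbientIsotopic (L L' : OrientedLink) : Prop :=
  ∃ H : unitInterval → (Space ≃ₜ Space),
    Continuous (fun p : unitInterval × Space => H p.1 p.2) ∧
    (∀ x, H 0 x = x) ∧
    (∀ γ ∈ L, ∃ δ ∈ L', SameOrientedCurve (fun t => H 1 (γ t)) δ) ∧
    (∀ δ ∈ L', ∃ γ ∈ L, SameOrientedCurve (fun t => H 1 (γ t)) δ)

/-! ## The standard solid torus -/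

/-- Coordinates `(z, θ)` on a solid torus: `z` is a point of the closed unit disk in `ℂ`, and `θ`
is the longitudinal angle measured in full turns (so `θ` and `θ + 1` are the same point). -/
abbrev TorusCoord : Type := ℂ × ℝ

/-- The standard unknotted, untwisted solid torus in three-space. Counterclockwise rotation of the
disk coordinate is right-handed about the direction of increasing `θ`; this is why the last
coordinate is `-z.im`. -/
def stdTorus (x : TorusCoord) : Space :=
  !₂[(2 + x.1.re) * Real.cos (2 * Real.pi * x.2),
     (2 + x.1.re) * Real.sin (2 * Real.pi * x.2),
     -x.1.im]

/-- An oriented link in the solid torus, as a set of curves in the coordinates above. -/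
abbrev SolidTorusLink : Type := Set (ℝ → TorusCoord)

/-- The oriented link in three-space given by a link in the standard solid torus. -/
def SolidTorusLink.toLink (L : SolidTorusLink) : OrientedLink :=
  (fun (γ : ℝ → TorusCoord) (t : ℝ) => stdTorus (γ t)) '' L

/-- The `(p, q)`-torus link on the boundary `|z| = 1`: the solutions of `q · arg z = p · θ`. It
meets each meridian disk in `q` points, it has `gcd(p, q)` components, and it is right-handed for
`p > 0`. The curve with index `m` is the one through the point `exp (2πi m / q)` of the disk
`θ = 0`. -/
def torusLink (p : ℤ) (q : ℕ) : SolidTorusLink :=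
  Set.range fun (m : Fin q) (t : ℝ) =>
    (Complex.exp (2 * Real.pi * Complex.I * ((p * t + m) / q)), t)

/-- The core circle of the solid torus. -/
def coreCurve : ℝ → TorusCoord := fun t => (0, t)

/-! ## Twisted solid torus links and their surgerized versions -/

/-- The data of one cut of a twisted solid torus with `τ = n / d` turns (`n` over the chosen
denominator `d`): the number `M` of pieces, the multiplicity `μ` of the operation, and the
multiplicity `P` of the resulting torus knot for `μ = 1`. Here `P` is an arbitrary natural
number. -/
structure Cut where
  n : ℤ
  d : ℕ
  d_pos : 0 < d
  M : ℕ
  μ : ℕ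
  P : ℕ

namespace Cut

/-- The number of turns. -/
def τ (c : Cut) : ℚ := (c.n : ℚ) / (c.d : ℚ)

/-- The numerator of `τ` in lowest terms. -/
def N (c : Cut) : ℤ := c.τ.num

/-- The denominator of `τ` in lowest terms. -/
def D (c : Cut) : ℕ := c.τ.den

/-- The number of torus knots that the cut produces. -/
def S (c : Cut) : ℕ := c.μ * c.P

/-- The tst link: the torus link of type `(-μPN, μPD)`, together with the core circle (a trivial
knot) when the number of pieces is odd. -/
def tstLink (c : Cut) : SolidTorusLink :=
  torusLink (-(c.S * c.N)) (c.S * c.D) ∪ {γ | Odd c.M ∧ γ = coreCurve}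

end Cut

/-- The inclusion of the concentric solid torus of half the radius (a tubular neighbourhood of the
core). -/
def shrink (x : TorusCoord) : TorusCoord := (x.1 / 2, x.2)

/-- Surgery on the core: the core component of `L` is drilled out, the rest of `L` is left
untouched, and the tube is filled with a solid torus that contains the link `K`. -/
def surger (L K : SolidTorusLink) : SolidTorusLink :=
  (L \ {coreCurve}) ∪ (fun (γ : ℝ → TorusCoord) (t : ℝ) => shrink (γ t)) '' K

/-- The link of the iterated operation with the cuts `c 0, …, c k` in the solid torus: cut, drill
out the core component, fill in a new twisted solid torus, cut that one, and so on. -/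
def ststSolid : (k : ℕ) → (Fin (k + 1) → Cut) → SolidTorusLink
  | 0, c => (c 0).tstLink
  | k + 1, c => surger (c 0).tstLink (ststSolid k (fun j => c j.succ))

/-- The surgerized tst link in three-space. -/
def ststLink (k : ℕ) (c : Fin (k + 1) → Cut) : OrientedLink :=
  (ststSolid k c).toLink

/-! ## Braid words and their closures -/

/-- A braid word: the letter `(i, true)` is the Artin generator `σ_i`, and `(i, false)` is
`σ_i⁻¹`. A word is read from left to right along the strands. -/
abbrev BraidWord : Type := List (ℕ × Bool)

namespace BraidWord

/-- The word is a word in the generators `σ_1, …, σ_{n-1}` of the braid group `B_n` and their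
inverses. -/
def InBraidGroup (n : ℕ) (w : BraidWord) : Prop := ∀ g ∈ w, 1 ≤ g.1 ∧ g.1 < n

/-- The inverse word. -/
def inverse (w : BraidWord) : BraidWord := w.reverse.map fun g => (g.1, !g.2)

/-- Integer powers of a word. -/
def power (w : BraidWord) : ℤ → BraidWord
  | Int.ofNat m => (List.replicate m w).flatten
  | Int.negSucc m => (List.replicate (m + 1) w.inverse).flatten

/-- The word `σ_1⁻¹ σ_2⁻¹ ⋯ σ_b⁻¹` (empty for `b = 0`). -/
def ascending (b : ℕ) : BraidWord := (List.range b).map fun i => (i + 1, false)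

/-- The word `σ_b⁻¹ ⋯ σ_2⁻¹ σ_1⁻¹` (empty for `b = 0`). -/
def descending (b : ℕ) : BraidWord := (ascending b).reverse

/-- The base points of the `n` strands, at positions `i = 1, …, n` on the real axis, equally spaced
in the open unit disk. -/
def basePoint (n i : ℕ) : ℂ := ((-1 + 2 * i / (n + 1) : ℝ) : ℂ)

/-- The point at time `t ∈ [0, 1]` of the strand that starts at position `i`, in the elementary
braid of a letter: for `σ_j` the points at positions `j` and `j + 1` are exchanged by a
counterclockwise half turn about their midpoint, for `σ_j⁻¹` by a clockwise one, and all other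
points stay fixed. -/
def letterStrand (n : ℕ) (g : ℕ × Bool) (i : ℕ) (t : ℝ) : ℂ :=
  if i = g.1 ∨ i = g.1 + 1 then
    (basePoint n g.1 + basePoint n (g.1 + 1)) / 2 +
      (basePoint n i - (basePoint n g.1 + basePoint n (g.1 + 1)) / 2) *
        Complex.exp ((if g.2 then 1 else -1) * Real.pi * Complex.I * t)
  else basePoint n i

/-- The point at time `t ≥ 0` of the strand that starts at position `i`, in the geometric braid
of a word. Each letter takes one unit of time; after the last letter the strands stay put. -/
def strand (n : ℕ) : BraidWord → ℕ → ℝ → ℂ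
  | [], i, _ => basePoint n i
  | g :: w, i, t =>
      if t ≤ 1 then letterStrand n g i t
      else strand n w (Equiv.swap g.1 (g.1 + 1) i) (t - 1)

/-- The permutation of the positions: the strand that starts at position `i` ends at position
`w.perm i`. -/
def perm : BraidWord → Equiv.Perm ℕ
  | [] => 1
  | g :: w => perm w * Equiv.swap g.1 (g.1 + 1)

/-- The closure of the braid on `n` strands given by a word, in the solid torus. The geometric
braid is run through once in each full turn (during which the time in the braid goes from `0` to
`length + 1`). The curve with index `i` starts at position `i + 1` and follows the strands, passing
from the end of one strand to the start of the next one at the end of each turn. -/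
def closureSolid (n : ℕ) (w : BraidWord) : SolidTorusLink :=
  Set.range fun (i : Fin n) (t : ℝ) =>
    (strand n w ((w.perm ^ ⌊t⌋) (i + 1)) ((w.length + 1) * Int.fract t), t)

/-- The closure of the braid on `n` strands given by a word, as an oriented link in three-space. -/
def closure (n : ℕ) (w : BraidWord) : OrientedLink := (closureSolid n w).toLink

end BraidWord

/-! ## The words of surgerized tst links -/

/-- The sum of `S_j D_j` over all `j ≥ l`. -/
def strandsFrom {k : ℕ} (c : Fin (k + 1) → Cut) (l : Fin (k + 1)) : ℕ :=
  ∑ j ∈ Finset.univ.filter (fun j => l ≤ j), (c j).S * (c j).D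

/-- The sum of `S_j D_j` over all `j > l`. -/
def strandsAfter {k : ℕ} (c : Fin (k + 1) → Cut) (l : Fin (k + 1)) : ℕ :=
  ∑ j ∈ Finset.univ.filter (fun j => l < j), (c j).S * (c j).D

/-- The sum of all `S_j D_j`. -/
def totalStrands {k : ℕ} (c : Fin (k + 1) → Cut) : ℕ := ∑ j, (c j).S * (c j).D

/-- The word for an even last number of pieces: the product over `l`, in increasing order, of the
`S_l N_l`-th powers of
`(σ_a⁻¹ ⋯ σ_1⁻¹) (σ_1⁻¹ ⋯ σ_{b-1}⁻¹)`, with `a = ∑_{j > l} S_j D_j` and `b = ∑_{j ≥ l} S_j D_j`. -/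
def ststWordEven {k : ℕ} (c : Fin (k + 1) → Cut) : BraidWord :=
  (List.ofFn fun l : Fin (k + 1) =>
    BraidWord.power
      (BraidWord.descending (strandsAfter c l) ++ BraidWord.ascending (strandsFrom c l - 1))
      ((c l).S * (c l).N)).flatten

/-- The word for an odd last number of pieces: the product over `l`, in increasing order, of the
`S_l N_l`-th powers of
`(σ_{a+1}⁻¹ ⋯ σ_1⁻¹) (σ_1⁻¹ ⋯ σ_b⁻¹)`, with `a = ∑_{j > l} S_j D_j` and `b = ∑_{j ≥ l} S_j D_j`. -/
def ststWordOdd {k : ℕ} (c : Fin (k + 1) → Cut) : BraidWord :=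
  (List.ofFn fun l : Fin (k + 1) =>
    BraidWord.power
      (BraidWord.descending (strandsAfter c l + 1) ++ BraidWord.ascending (strandsFrom c l))
      ((c l).S * (c l).N)).flatten

end

end Stst

/-! Both links are closed braids in the solid torus, so it suffices to join them by a path of closed
braids: finitely many points moving in the meridian disk, pairwise distinct at every moment, and
matched by a fixed permutation after one full turn. `closeUp_ambientIsotopic` turns such a path into
an ambient isotopy. By compactness the path can be cut into short steps, and a short step is
realised by adding to each meridian disk a small displacement with Lipschitz constant 1/2
(`PushField`). The identity plus such a displacement is bijective by the contraction principle.

Unwinding the surgery (`mem_ststSolid_iff`) shows that the stst link is a system of concentric rigid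
rotations. With indices starting at 0, the `l`-th torus link lies on the torus of radius `(1/2)^l`,
and its `S D` equally spaced points turn clockwise by `S N` slots per longitude (counterclockwise
for negative `N`). A core component is one further layer, with one point and radius 0. Since
different layers live on different circles, their angles can be deformed independently. Hence the
layers may turn one after the other, and each in single moves by one slot; this is where the product
and the exponents `S_l N_l` come from. `rotationLink_ambientIsotopic` carries out this deformation.

It remains to read a braid word off a move by one slot. Let the layer occupy the positions `a + 1,
…, b`. Its points are placed on the lower half of the circle of radius `b` with real parts equal to
their positions. The leading point, at `a + 1`, slides left below all inner layers, turns around the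
left end of the circle, and returns on the upper half above everything to the position `b`.
Meanwhile its mates each shift one position to the left. Projected to the real axis, the way out
crosses as `σ_a⁻¹ ⋯ σ_1⁻¹` and the way back as `σ_1⁻¹ ⋯ σ_{b-1}⁻¹`. An idle letter in the middle,
which acts beyond the last strand, gives the leading point time to turn and is removed at the end.
Inverse blocks are the same motion run backwards.

The comparison with the geometric braid of the word rests on `NonAntipodal`. For each pair of
strands, the difference vectors in the two braids never point in opposite directions, so the
straight-line homotopy creates no collision. This is checked letter by letter in
`IsBlockConfig.nonAntipodal`: pairs that are not crossing are compared by real parts, crossing pairs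
essentially by imaginary parts. -/

namespace Stst

noncomputable section

open Filter Topology Set

/-! ### Cylindrical coordinates -/

/-- The horizontal part of a point of space, as a complex number. -/
def planar (x : Space) : ℂ := ⟨x 0, x 1⟩

/-- The meridian disk coordinate of a point of space. -/
def diskCoord (x : Space) : ℂ := ⟨‖planar x‖ - 2, -x 2⟩

/-- The longitudinal angle of a point of space, in full turns. -/
def angleCoord (x : Space) : ℝ := (planar x).arg / (2 * Real.pi)

/-- The vector of space that corresponds to the vector `d` of the meridian disk at angle `θ`. -/
def torusDir (θ : ℝ) (d : ℂ) : Space :=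
  !₂[d.re * Real.cos (2 * Real.pi * θ), d.re * Real.sin (2 * Real.pi * θ), -d.im]

lemma stdTorus_add (z d : ℂ) (θ : ℝ) :
    stdTorus (z + d, θ) = stdTorus (z, θ) + torusDir θ d := by
  ext i
  fin_cases i <;> simp [stdTorus, torusDir] <;> ring

lemma torusDir_smul (s θ : ℝ) (d : ℂ) : torusDir θ (s • d) = s • torusDir θ d := by
  ext i
  fin_cases i <;> simp [torusDir] <;> ring

lemma torusDir_zero (θ : ℝ) : torusDir θ 0 = 0 := by
  ext i
  fin_cases i <;> simp [torusDir]

lemma norm_torusDir (θ : ℝ) (d : ℂ) : ‖torusDir θ d‖ = ‖d‖ := by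
  rw [EuclideanSpace.norm_eq, Complex.norm_eq_sqrt_sq_add_sq]
  congr 1
  simp only [torusDir, Fin.sum_univ_three, Real.norm_eq_abs, sq_abs]
  simp
  have := Real.sin_sq_add_cos_sq (2 * Real.pi * θ)
  linear_combination d.re ^ 2 * this

lemma torusDir_add_intCast (θ : ℝ) (k : ℤ) (d : ℂ) : torusDir (θ + k) d = torusDir θ d := by
  have h : 2 * Real.pi * (θ + k) = 2 * Real.pi * θ + k * (2 * Real.pi) := by ring
  simp only [torusDir, h, Real.cos_add_int_mul_two_pi, Real.sin_add_int_mul_two_pi]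

lemma continuous_torusDir : Continuous fun p : ℝ × ℂ => torusDir p.1 p.2 := by
  unfold torusDir
  apply (PiLp.continuous_toLp 2 _).comp
  refine continuous_pi fun i => ?_
  fin_cases i <;> simp <;> fun_prop

lemma two_pi_mul_angleCoord (x : Space) : 2 * Real.pi * angleCoord x = (planar x).arg := by
  unfold angleCoord
  field_simp

lemma stdTorus_coords (x : Space) : stdTorus (diskCoord x, angleCoord x) = x := by
  ext i
  fin_cases i
  · simp [stdTorus, two_pi_mul_angleCoord, diskCoord, planar]
  · simp [stdTorus, two_pi_mul_angleCoord, diskCoord, planar]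
  · simp [stdTorus, diskCoord]

lemma planar_stdTorus (z : ℂ) (t : ℝ) :
    planar (stdTorus (z, t)) =
      ((2 + z.re : ℝ) : ℂ) * Complex.exp ((2 * Real.pi * t : ℝ) * Complex.I) := by
  apply Complex.ext
  · rw [Complex.re_ofReal_mul, Complex.exp_ofReal_mul_I_re]
    simp [planar, stdTorus]
  · rw [Complex.im_ofReal_mul, Complex.exp_ofReal_mul_I_im]
    simp [planar, stdTorus]

lemma diskCoord_stdTorus {z : ℂ} (hz : -2 ≤ z.re) (t : ℝ) : diskCoord (stdTorus (z, t)) = z := by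
  have h : ‖planar (stdTorus (z, t))‖ = 2 + z.re := by
    rw [planar_stdTorus, norm_mul, Complex.norm_exp_ofReal_mul_I, Complex.norm_real, mul_one,
      Real.norm_of_nonneg (by linarith)]
  apply Complex.ext
  · simp [diskCoord, h]
  · simp [diskCoord, stdTorus]

lemma arg_planar_stdTorus {z : ℂ} (hz : -2 < z.re) (t : ℝ) :
    (planar (stdTorus (z, t))).arg = toIocMod Real.two_pi_pos (-Real.pi) (2 * Real.pi * t) := by
  rw [planar_stdTorus, Complex.arg_real_mul _ (by linarith), Complex.arg_exp_mul_I]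

lemma angleCoord_stdTorus {z : ℂ} (hz : -2 < z.re) (t : ℝ) :
    ∃ k : ℤ, angleCoord (stdTorus (z, t)) = t + k := by
  refine ⟨-toIocDiv Real.two_pi_pos (-Real.pi) (2 * Real.pi * t), ?_⟩
  rw [angleCoord, arg_planar_stdTorus hz, toIocMod]
  have := Real.pi_pos
  push_cast
  simp only [zsmul_eq_mul]
  field_simp
  ring

/-- The angle of a point already lies in the principal interval, so here no integer ambiguity is
left. -/
lemma angleCoord_stdTorus_angleCoord {z : ℂ} (hz : -2 < z.re) (x : Space) :
    angleCoord (stdTorus (z, angleCoord x)) = angleCoord x := by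
  rw [angleCoord, arg_planar_stdTorus hz, two_pi_mul_angleCoord, angleCoord]
  congr 1
  rw [toIocMod_eq_self]
  have := Complex.arg_mem_Ioc (planar x)
  exact ⟨this.1, by linarith [this.2]⟩

lemma continuous_planar : Continuous planar := by
  have : planar = fun x : Space => (x 0 : ℂ) + (x 1 : ℂ) * Complex.I := by
    funext x
    apply Complex.ext <;> simp [planar]
  rw [this]
  fun_prop

lemma continuous_diskCoord : Continuous diskCoord := by
  have : diskCoord = fun x : Space => ((‖planar x‖ - 2 : ℝ) : ℂ) + ((-x 2 : ℝ) : ℂ) * Complex.I := by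
    funext x
    apply Complex.ext <;> simp [diskCoord]
  rw [this]
  have := continuous_planar
  fun_prop

/-- A periodic continuous function on the solid torus that vanishes near the boundary extends by
zero to a continuous function on space. -/
lemma continuous_coords {Y : Type*} [TopologicalSpace Y] [Zero Y] {G : ℝ → ℂ → Y}
    (hG : Continuous fun p : ℝ × ℂ => G p.1 p.2) (hper : ∀ (k : ℤ) θ z, G (θ + k) z = G θ z)
    {η : ℝ} (hη : 0 < η) (hsupp : ∀ θ z, 2 - η ≤ ‖z‖ → G θ z = 0) :
    Continuous fun x : Space => G (angleCoord x) (diskCoord x) := by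
  rw [continuous_iff_continuousAt]
  intro x
  have hpi := Real.pi_pos
  -- On the axis the angle is undefined, but there the disk coordinate has real part -2, so its norm
  -- is at least 2 and the function vanishes nearby.
  by_cases h0 : planar x = 0
  · have h2 : 2 - η < ‖diskCoord x‖ := by
      have : (diskCoord x).re = -2 := by simp [diskCoord, h0]
      have h3 := Complex.abs_re_le_norm (diskCoord x)
      rw [this] at h3
      norm_num at h3
      linarith
    have : ∀ᶠ y in 𝓝 x, 2 - η < ‖diskCoord y‖ :=
      (continuous_diskCoord.norm.continuousAt).eventually_const_lt h2
    apply ContinuousAt.congr (f := fun _ => (0 : Y)) continuousAt_const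
    filter_upwards [this] with y hy
    rw [hsupp _ _ hy.le]
  by_cases hs : planar x ∈ Complex.slitPlane
  · have h1 : ContinuousAt angleCoord x :=
      ((Complex.continuousAt_arg hs).comp continuous_planar.continuousAt).div_const _
    exact ContinuousAt.comp (g := fun p : ℝ × ℂ => G p.1 p.2) (f := fun y => (angleCoord y, diskCoord y))
      hG.continuousAt (h1.prodMk continuous_diskCoord.continuousAt)
  -- On the negative real axis the principal argument jumps. The argument of the opposite point is
  -- continuous there and differs by half a turn plus an integer number of turns, which periodicity
  -- absorbs.
  · have hs' : -planar x ∈ Complex.slitPlane := by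
      rw [Complex.mem_slitPlane_iff] at hs ⊢
      push Not at hs
      left
      rcases hs.1.lt_or_eq with h | h
      · simpa using h
      · exact absurd (Complex.ext h hs.2) h0
    have h1 : ContinuousAt (fun y => (-planar y).arg / (2 * Real.pi) + 1 / 2) x :=
      (((Complex.continuousAt_arg hs').comp
        (f := fun y => -planar y) continuous_planar.neg.continuousAt).div_const _).add_const _
    have h2 : ContinuousAt (fun y =>
        G ((-planar y).arg / (2 * Real.pi) + 1 / 2) (diskCoord y)) x :=
      ContinuousAt.comp (g := fun p : ℝ × ℂ => G p.1 p.2) (f := fun y => (_, diskCoord y))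
        hG.continuousAt (h1.prodMk continuous_diskCoord.continuousAt)
    refine h2.congr ?_
    have : ∀ᶠ y in 𝓝 x, planar y ≠ 0 := continuous_planar.continuousAt.eventually_ne h0
    filter_upwards [this] with y hy
    have h3 := Complex.arg_neg_coe_angle hy
    rw [← Real.Angle.coe_add, Real.Angle.angle_eq_iff_two_pi_dvd_sub] at h3
    obtain ⟨k, hk⟩ := h3
    have h4 : (-planar y).arg / (2 * Real.pi) + 1 / 2 = angleCoord y + ((k + 1 : ℤ) : ℝ) := by
      have : (-planar y).arg = (planar y).arg + Real.pi + 2 * Real.pi * k := by linarith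
      rw [this, angleCoord]
      push_cast
      field_simp
      ring
    rw [h4, hper]

/-! ### Ambient isotopies from fibrewise displacements -/

/-- A field of small displacements of the meridian disks: periodic in the longitudinal angle,
supported away from the boundary of the disk of radius `2`, and contracting in the disk. -/
structure PushField where
  /-- The displacement at the angle `θ` and the point `z` of the disk. -/
  toFun : ℝ → ℂ → ℂ
  cont : Continuous fun p : ℝ × ℂ => toFun p.1 p.2
  periodic : ∀ (k : ℤ) θ z, toFun (θ + k) z = toFun θ z
  /-- The distance of the support from the circle of radius `2`. -/
  margin : ℝ
  margin_pos : 0 < margin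
  supp : ∀ θ z, 2 - margin ≤ ‖z‖ → toFun θ z = 0
  lip : ∀ θ z w, ‖toFun θ z - toFun θ w‖ ≤ 1 / 2 * ‖z - w‖
  small : ∀ θ z, ‖toFun θ z‖ < margin

namespace PushField

/-- The field scaled by a number of the unit interval. -/
def scale (F : PushField) (s : unitInterval) : PushField where
  toFun θ z := (s : ℝ) • F.toFun θ z
  cont := F.cont.fun_const_smul (s : ℝ)
  periodic k θ z := by simp only [F.periodic]
  margin := F.margin
  margin_pos := F.margin_pos
  supp θ z h := by simp [F.supp θ z h]
  lip θ z w := by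
    rw [← smul_sub, norm_smul, Real.norm_of_nonneg s.2.1]
    exact (mul_le_of_le_one_left (norm_nonneg _) s.2.2).trans (F.lip θ z w)
  small θ z := by
    rw [norm_smul, Real.norm_of_nonneg s.2.1]
    exact (mul_le_of_le_one_left (norm_nonneg _) s.2.2).trans_lt (F.small θ z)

/-- The map of space that moves each meridian disk by the field. -/
def push (F : PushField) (x : Space) : Space :=
  x + torusDir (angleCoord x) (F.toFun (angleCoord x) (diskCoord x))

variable (F : PushField)

lemma continuous_dir :
    Continuous fun x => torusDir (angleCoord x) (F.toFun (angleCoord x) (diskCoord x)) := by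
  refine continuous_coords (G := fun θ z => torusDir θ (F.toFun θ z)) ?_ ?_ F.margin_pos ?_
  · exact continuous_torusDir.comp (continuous_fst.prodMk F.cont)
  · intro k θ z
    rw [torusDir_add_intCast, F.periodic]
  · intro θ z h
    rw [F.supp θ z h, torusDir_zero]

lemma continuous_push : Continuous F.push := continuous_id.add F.continuous_dir

lemma push_stdTorus {z : ℂ} (hz : -2 < z.re) (t : ℝ) :
    F.push (stdTorus (z, t)) = stdTorus (z + F.toFun t z, t) := by
  obtain ⟨k, hk⟩ := angleCoord_stdTorus hz t
  rw [push, diskCoord_stdTorus hz.le, hk, F.periodic, torusDir_add_intCast, stdTorus_add]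

/-- The displacement is shorter than the margin of its support, so a point that moves starts and
ends away from the axis, where the coordinates are faithful. -/
lemma eq_zero_or_re_gt (θ : ℝ) (z : ℂ) :
    F.toFun θ z = 0 ∨ (-2 < z.re ∧ -2 < (z + F.toFun θ z).re) := by
  by_cases h : 2 - F.margin ≤ ‖z‖
  · exact Or.inl (F.supp θ z h)
  · right
    push Not at h
    have h1 := Complex.abs_re_le_norm z
    have h2 := Complex.abs_re_le_norm (F.toFun θ z)
    have h3 := F.small θ z
    rw [abs_le] at h1 h2
    rw [Complex.add_re]
    have := F.margin_pos
    constructor <;> linarith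

lemma push_coords (x : Space) :
    F.push x = stdTorus (diskCoord x + F.toFun (angleCoord x) (diskCoord x), angleCoord x) := by
  rw [stdTorus_add, stdTorus_coords, push]

lemma coords_push (x : Space) : angleCoord (F.push x) = angleCoord x ∧
    diskCoord (F.push x) = diskCoord x + F.toFun (angleCoord x) (diskCoord x) := by
  rcases F.eq_zero_or_re_gt (angleCoord x) (diskCoord x) with h | ⟨_, h⟩
  · rw [push, h, torusDir_zero, add_zero, add_zero]
    exact ⟨rfl, rfl⟩
  · rw [push_coords]
    exact ⟨angleCoord_stdTorus_angleCoord h x, diskCoord_stdTorus h.le _⟩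

/-- Two points with the same image differ by exactly the difference of their displacements, which is
at most half as long. -/
lemma eq_of_add_eq {θ : ℝ} {z w : ℂ} (h : z + F.toFun θ z = w + F.toFun θ w) : z = w := by
  have h1 := F.lip θ z w
  have h2 : F.toFun θ z - F.toFun θ w = -(z - w) := by linear_combination h
  rw [h2, norm_neg] at h1
  have h3 : ‖z - w‖ = 0 := by linarith [norm_nonneg (z - w)]
  exact sub_eq_zero.1 (norm_eq_zero.1 h3)

/-- A preimage of `y` is a fixed point of the contraction sending `z` to `y` minus the displacement
at `z`. -/
lemma exists_add_eq (θ : ℝ) (y : ℂ) : ∃ z, z + F.toFun θ z = y := by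
  have h : ContractingWith (1 / 2) fun z => y - F.toFun θ z := by
    refine ⟨by norm_num, LipschitzWith.of_dist_le_mul fun z w => ?_⟩
    rw [dist_eq_norm, dist_eq_norm]
    have := F.lip θ w z
    rw [norm_sub_rev w z] at this
    simpa using this
  refine ⟨ContractingWith.fixedPoint _ h, ?_⟩
  have := h.fixedPoint_isFixedPt
  unfold Function.IsFixedPt at this
  linear_combination -this

lemma bijective_push : Function.Bijective F.push := by
  constructor
  · intro x y h
    have hx := F.coords_push x
    have hy := F.coords_push y
    rw [h] at hx
    have ha : angleCoord x = angleCoord y := hx.1.symm.trans hy.1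
    have hd : diskCoord x = diskCoord y := by
      apply F.eq_of_add_eq (θ := angleCoord y)
      rw [← ha, ← hx.2, ha, ← hy.2]
    rw [← stdTorus_coords x, ← stdTorus_coords y, ha, hd]
  · intro y
    obtain ⟨z, hz⟩ := F.exists_add_eq (angleCoord y) (diskCoord y)
    rcases F.eq_zero_or_re_gt (angleCoord y) z with h | ⟨h, _⟩
    · refine ⟨y, ?_⟩
      rw [h, add_zero] at hz
      rw [push, ← hz, h, torusDir_zero, add_zero]
    · refine ⟨stdTorus (z, angleCoord y), ?_⟩
      rw [F.push_stdTorus h, hz, stdTorus_coords]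

/-- The displacement is bounded, so the map is proper and hence closed; a continuous closed
bijection is a homeomorphism. -/
lemma isHomeomorph_push : IsHomeomorph F.push := by
  rw [isHomeomorph_iff_continuous_isClosedMap_bijective]
  refine ⟨F.continuous_push, ?_, F.bijective_push⟩
  apply IsProperMap.isClosedMap
  rw [isProperMap_iff_tendsto_cocompact]
  refine ⟨F.continuous_push, ?_⟩
  rw [← Metric.cobounded_eq_cocompact, ← tendsto_norm_atTop_iff_cobounded]
  have h1 : Tendsto (fun x : Space => ‖x‖ + -F.margin) (Bornology.cobounded Space) atTop :=
    tendsto_atTop_add_const_right _ _ tendsto_norm_cobounded_atTop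
  refine tendsto_atTop_mono (fun x => ?_) h1
  have h2 := norm_sub_le (F.push x) (torusDir (angleCoord x) (F.toFun (angleCoord x) (diskCoord x)))
  rw [norm_torusDir] at h2
  have h3 : F.push x - torusDir (angleCoord x) (F.toFun (angleCoord x) (diskCoord x)) = x := by
    simp [push]
  rw [h3] at h2
  linarith [F.small (angleCoord x) (diskCoord x)]

/-- The homeomorphism of space that moves each meridian disk by the field. -/
def homeo : Space ≃ₜ Space := F.isHomeomorph_push.homeomorph _

lemma homeo_apply (x : Space) : F.homeo x = F.push x := rfl

/-- A push field carries a link in the solid torus to the displaced link. -/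
lemma ambientIsotopic {ι : Type*} (f : ι → ℝ → ℂ) (hf : ∀ i t, ‖f i t‖ < 2) :
    AmbientIsotopic
      (SolidTorusLink.toLink (Set.range fun i t => (f i t, t)))
      (SolidTorusLink.toLink (Set.range fun i t => (f i t + F.toFun t (f i t), t))) := by
  have key : ∀ i t, (F.scale 1).homeo (stdTorus (f i t, t)) =
      stdTorus (f i t + F.toFun t (f i t), t) := by
    intro i t
    have h : -2 < (f i t).re := by
      have h1 := Complex.abs_re_le_norm (f i t)
      rw [abs_le] at h1
      linarith [hf i t]
    rw [homeo_apply, (F.scale 1).push_stdTorus h]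
    simp [scale]
  -- Scaling by a number in the unit interval preserves all the bounds of a push field, so every
  -- stage of the straight-line motion is a homeomorphism.
  refine ⟨fun s => (F.scale s).homeo, ?_, ?_, ?_, ?_⟩
  · have : (fun p : unitInterval × Space => (F.scale p.1).homeo p.2) = fun p =>
        p.2 + (p.1 : ℝ) • torusDir (angleCoord p.2) (F.toFun (angleCoord p.2) (diskCoord p.2)) := by
      funext p
      rw [homeo_apply, push, ← torusDir_smul]
      rfl
    rw [this]
    have h := F.continuous_dir
    exact continuous_snd.add
      ((continuous_subtype_val.comp continuous_fst).smul (h.comp continuous_snd))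
  · intro x
    rw [homeo_apply, push]
    simp [scale, torusDir_zero]
  · rintro _ ⟨_, ⟨i, rfl⟩, rfl⟩
    refine ⟨_, ⟨_, ⟨i, rfl⟩, rfl⟩, OrderIso.refl ℝ, fun t => ?_⟩
    exact key i t
  · rintro _ ⟨_, ⟨i, rfl⟩, rfl⟩
    refine ⟨_, ⟨_, ⟨i, rfl⟩, rfl⟩, OrderIso.refl ℝ, fun t => ?_⟩
    exact key i t

end PushField

/-! ### Ambient isotopies can be composed -/

lemma AmbientIsotopic.refl (L : OrientedLink) : AmbientIsotopic L L :=
  ⟨fun _ => Homeomorph.refl _, continuous_snd, fun _ => rfl,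
    fun γ h => ⟨γ, h, OrderIso.refl ℝ, fun _ => rfl⟩,
    fun γ h => ⟨γ, h, OrderIso.refl ℝ, fun _ => rfl⟩⟩

lemma AmbientIsotopic.trans {L L' L'' : OrientedLink} (h : AmbientIsotopic L L')
    (h' : AmbientIsotopic L' L'') : AmbientIsotopic L L'' := by
  obtain ⟨H, Hc, H0, H1, H2⟩ := h
  obtain ⟨J, Jc, J0, J1, J2⟩ := h'
  refine ⟨fun s => (H s).trans (J s), ?_, ?_, ?_, ?_⟩
  · exact Jc.comp (continuous_fst.prodMk Hc)
  · intro x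
    simp [H0, J0]
  · intro γ hγ
    obtain ⟨δ, hδ, φ, hφ⟩ := H1 γ hγ
    obtain ⟨ε, hε, ψ, hψ⟩ := J1 δ hδ
    exact ⟨ε, hε, φ.trans ψ, fun t => by simp [hφ t, hψ (φ t)]⟩
  · intro ε hε
    obtain ⟨δ, hδ, ψ, hψ⟩ := J2 ε hε
    obtain ⟨γ, hγ, φ, hφ⟩ := H2 δ hδ
    exact ⟨γ, hγ, φ.trans ψ, fun t => by simp [hφ t, hψ (φ t)]⟩

end

end Stst

namespace Stst

noncomputable section

open Filter Topology Set

/-! ### Closed braids and their isotopies -/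

/-- The link in the solid torus that follows the paths `f i : [0, 1] → ℂ`, where the end of the
path `f i` is the start of the path `f (π i)`. -/
def closeUp {ι : Type*} (π : Equiv.Perm ι) (f : ι → ℝ → ℂ) : SolidTorusLink :=
  Set.range fun (i : ι) (t : ℝ) => (f ((π ^ ⌊t⌋) i) (Int.fract t), t)

lemma exists_pos_forall_le {ι : Type*} [Finite ι] (r : ι → ℝ) (hr : ∀ i, 0 < r i) :
    ∃ ρ, 0 < ρ ∧ ∀ i, ρ ≤ r i := by
  have h : ∀ᶠ ρ in 𝓝[>] (0 : ℝ), ∀ i, ρ ≤ r i := by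
    rw [eventually_all]
    intro i
    exact mem_nhdsWithin_of_mem_nhds (Iic_mem_nhds (hr i))
  obtain ⟨ρ, h1, h2⟩ := (h.and self_mem_nhdsWithin).exists
  exact ⟨ρ, h2, h1⟩

lemma abs_max_sub_max_le (a b : ℝ) : |max 0 a - max 0 b| ≤ |a - b| := by
  rw [max_comm 0 a, max_comm 0 b]
  exact abs_max_sub_max_le_abs a b 0

/-- The displacement field that moves the points `f i` to `g i`. -/
def nearField {ι : Type*} [Fintype ι] (f g : ι → ℝ → ℂ) (ρ : ℝ) (z : ℂ) (x : ℝ) : ℂ :=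
  ∑ i, (max 0 (1 - ‖z - f i x‖ / ρ)) • (g i x - f i x)

/-- Each summand is a cone of slope `1 / ρ` times a vector of length at most `ε`; the bound on the
number of points times `ε` makes the slopes add up to at most 1/2. -/
lemma nearField_lipschitz {ι : Type*} [Fintype ι] {f g : ι → ℝ → ℂ} {ρ ε : ℝ} (hρ : 0 < ρ)
    (x : ℝ) (near : ∀ i, ‖g i x - f i x‖ ≤ ε) (hε : Fintype.card ι * ε ≤ ρ / 2) (z w : ℂ) :
    ‖nearField f g ρ z x - nearField f g ρ w x‖ ≤ 1 / 2 * ‖z - w‖ := by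
  unfold nearField
  rw [← Finset.sum_sub_distrib]
  have h1 : ∀ i ∈ Finset.univ, ‖(max 0 (1 - ‖z - f i x‖ / ρ)) • (g i x - f i x) -
      (max 0 (1 - ‖w - f i x‖ / ρ)) • (g i x - f i x)‖ ≤ ‖z - w‖ / ρ * ε := by
    intro i _
    rw [← sub_smul, norm_smul]
    refine mul_le_mul ?_ (near i) (norm_nonneg _) (by positivity)
    refine (abs_max_sub_max_le _ _).trans ?_
    have h2 := abs_norm_sub_norm_le (w - f i x) (z - f i x)
    rw [show w - f i x - (z - f i x) = -(z - w) by ring, norm_neg] at h2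
    rw [show 1 - ‖z - f i x‖ / ρ - (1 - ‖w - f i x‖ / ρ) =
      (‖w - f i x‖ - ‖z - f i x‖) / ρ by ring, abs_div, abs_of_pos hρ]
    gcongr
  refine (norm_sum_le_of_le _ h1).trans ?_
  rw [Finset.sum_const, nsmul_eq_mul, Finset.card_univ]
  calc (Fintype.card ι : ℝ) * (‖z - w‖ / ρ * ε) = (Fintype.card ι * ε) / ρ * ‖z - w‖ := by ring
    _ ≤ (ρ / 2) / ρ * ‖z - w‖ := by gcongr
    _ = 1 / 2 * ‖z - w‖ := by field_simp

lemma norm_nearField_lt {ι : Type*} [Fintype ι] {f g : ι → ℝ → ℂ} {ρ ε : ℝ} (hρ : 0 < ρ)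
    (x : ℝ) (near : ∀ i, ‖g i x - f i x‖ ≤ ε) (hε : Fintype.card ι * ε ≤ ρ / 2) (z : ℂ) :
    ‖nearField f g ρ z x‖ < ρ := by
  unfold nearField
  have h1 : ∀ i ∈ Finset.univ, ‖(max 0 (1 - ‖z - f i x‖ / ρ)) • (g i x - f i x)‖ ≤ ε := by
    intro i _
    rw [norm_smul, Real.norm_of_nonneg (le_max_left _ _)]
    have h2 : max 0 (1 - ‖z - f i x‖ / ρ) ≤ 1 :=
      max_le zero_le_one (sub_le_self _ (by positivity))
    exact (mul_le_of_le_one_left (norm_nonneg _) h2).trans (near i)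
  refine (norm_sum_le_of_le _ h1).trans_lt ?_
  rw [Finset.sum_const, nsmul_eq_mul, Finset.card_univ]
  linarith

/-- The cones have radius `ρ`, which is at most the distance between the points, so at `f j` every
cone but its own vanishes. -/
lemma nearField_self {ι : Type*} [Fintype ι] {f g : ι → ℝ → ℂ} {ρ : ℝ} (hρ : 0 < ρ) (x : ℝ)
    (sep : ∀ i j, i ≠ j → ρ ≤ ‖f i x - f j x‖) (j : ι) :
    f j x + nearField f g ρ (f j x) x = g j x := by
  unfold nearField
  rw [Finset.sum_eq_single j]
  · simp
  · intro i _ hij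
    have h1 : 1 ≤ ‖f j x - f i x‖ / ρ := by
      rw [one_le_div hρ]
      exact sep j i (Ne.symm hij)
    rw [max_eq_left (by linarith), zero_smul]
  · simp

/-- One short step: the cone field carries `f` to `g` in every meridian disk. Points of norm at most
`2 - 2 * ρ` with cones of radius `ρ` keep its support inside radius `2 - ρ`, so `ρ` also serves as
the margin. -/
lemma closeUp_ambientIsotopic_of_near {ι : Type*} [Fintype ι] (π : Equiv.Perm ι) {f g : ι → ℝ → ℂ}
    (hf : ∀ i, ContinuousOn (f i) (Icc 0 1)) (hg : ∀ i, ContinuousOn (g i) (Icc 0 1))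
    (hf1 : ∀ i, f i 1 = f (π i) 0) (hg1 : ∀ i, g i 1 = g (π i) 0) {ρ ε : ℝ} (hρ : 0 < ρ)
    (sep : ∀ x ∈ Icc (0 : ℝ) 1, ∀ i j, i ≠ j → ρ ≤ ‖f i x - f j x‖)
    (bd : ∀ x ∈ Icc (0 : ℝ) 1, ∀ i, ‖f i x‖ ≤ 2 - 2 * ρ)
    (near : ∀ x ∈ Icc (0 : ℝ) 1, ∀ i, ‖g i x - f i x‖ ≤ ε)
    (hε : Fintype.card ι * ε ≤ ρ / 2) :
    AmbientIsotopic (closeUp π f).toLink (closeUp π g).toLink := by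
  have fr : ∀ θ : ℝ, Int.fract θ ∈ Icc (0 : ℝ) 1 := fun θ =>
    ⟨Int.fract_nonneg θ, (Int.fract_lt_one θ).le⟩
  let F : PushField :=
    { toFun := fun θ z => nearField f g ρ z (Int.fract θ)
      cont := by
        have h := ContinuousOn.comp_fract (s := fun p : ℝ × ℂ => p.1)
          (f := fun (p : ℝ × ℂ) (x : ℝ) => nearField f g ρ p.2 x) ?_ continuous_fst ?_
        · exact h
        · unfold nearField Function.uncurry
          refine continuousOn_finsetSum _ fun i _ => ?_
          have h1 : ContinuousOn (fun p : (ℝ × ℂ) × ℝ => f i p.2) (univ ×ˢ Icc 0 1) :=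
            (hf i).comp continuousOn_snd fun p hp => hp.2
          have h2 : ContinuousOn (fun p : (ℝ × ℂ) × ℝ => g i p.2) (univ ×ˢ Icc 0 1) :=
            (hg i).comp continuousOn_snd fun p hp => hp.2
          have h3 : ContinuousOn (fun p : (ℝ × ℂ) × ℝ => p.1.2) (univ ×ˢ Icc 0 1) := by fun_prop
          exact (ContinuousOn.sup continuousOn_const
            (continuousOn_const.sub ((h3.sub h1).norm.div_const ρ))).smul
            (h2.sub h1)
        -- The fields at the two ends of a turn have the same summands, permuted by `π`, so the
        -- field is continuous across integer angles.
        · intro p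
          simp only [nearField, hf1, hg1]
          exact (Equiv.sum_comp π fun i =>
            (max 0 (1 - ‖p.2 - f i 0‖ / ρ)) • (g i 0 - f i 0)).symm
      periodic := fun k θ z => by simp
      margin := ρ
      margin_pos := hρ
      supp := fun θ z hz => by
        refine Finset.sum_eq_zero fun i _ => ?_
        have h1 : 1 ≤ ‖z - f i (Int.fract θ)‖ / ρ := by
          rw [one_le_div hρ]
          have h2 := norm_sub_norm_le z (f i (Int.fract θ))
          linarith [bd _ (fr θ) i]
        rw [max_eq_left (by linarith), zero_smul]
      lip := fun θ z w => nearField_lipschitz hρ _ (near _ (fr θ)) hε z w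
      small := fun θ z => norm_nearField_lt hρ _ (near _ (fr θ)) hε z }
  have h := F.ambientIsotopic (fun i t => f ((π ^ ⌊t⌋) i) (Int.fract t)) fun i t => by
    linarith [bd _ (fr t) ((π ^ ⌊t⌋) i)]
  have e : closeUp π g = Set.range fun i t => (f ((π ^ ⌊t⌋) i) (Int.fract t) +
      F.toFun t (f ((π ^ ⌊t⌋) i) (Int.fract t)), t) := congrArg Set.range (funext fun i => funext fun t => Prod.ext (nearField_self hρ _ (sep _ (fr t)) _).symm rfl)
  rw [e]
  exact h

/-- Homotopic closed braids are ambient isotopic. -/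
theorem closeUp_ambientIsotopic {ι : Type*} [Fintype ι] (π : Equiv.Perm ι) (F : ι → ℝ × ℝ → ℂ)
    (hF : ∀ i, ContinuousOn (F i) (Icc 0 1 ×ˢ Icc 0 1))
    (inj : ∀ s ∈ Icc (0 : ℝ) 1, ∀ x ∈ Icc (0 : ℝ) 1, ∀ i j, i ≠ j → F i (s, x) ≠ F j (s, x))
    (bd : ∀ s ∈ Icc (0 : ℝ) 1, ∀ x ∈ Icc (0 : ℝ) 1, ∀ i, ‖F i (s, x)‖ < 2)
    (close : ∀ s ∈ Icc (0 : ℝ) 1, ∀ i, F i (s, 1) = F (π i) (s, 0)) :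
    AmbientIsotopic (closeUp π fun i x => F i (0, x)).toLink
      (closeUp π fun i x => F i (1, x)).toLink := by
  have hQ : IsCompact (Icc (0 : ℝ) 1 ×ˢ Icc (0 : ℝ) 1) := isCompact_Icc.prod isCompact_Icc
  have h1 : ∀ p : ι × ι, ∃ r, 0 < r ∧ (p.1 ≠ p.2 →
      ∀ y ∈ Icc (0 : ℝ) 1 ×ˢ Icc (0 : ℝ) 1, r ≤ ‖F p.1 y - F p.2 y‖) := by
    intro p
    by_cases hp : p.1 = p.2
    · exact ⟨1, one_pos, fun h => absurd hp h⟩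
    · obtain ⟨r, hr, h⟩ := hQ.exists_forall_le' ((hF p.1).sub (hF p.2)).norm (a := 0)
        (fun y hy => norm_pos_iff.2 (sub_ne_zero.2 (inj _ hy.1 _ hy.2 _ _ hp)))
      exact ⟨r, hr, fun _ => h⟩
  have h2 : ∀ i, ∃ r, 0 < r ∧ ∀ y ∈ Icc (0 : ℝ) 1 ×ˢ Icc (0 : ℝ) 1, ‖F i y‖ ≤ 2 - r := by
    intro i
    obtain ⟨r, hr, h⟩ := hQ.exists_forall_le' (f := fun y => 2 - ‖F i y‖)
      (continuousOn_const.sub (hF i).norm) (a := 0)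
      (fun y hy => sub_pos.2 (bd _ hy.1 _ hy.2 _))
    exact ⟨r, hr, fun y hy => by linarith [h y hy]⟩
  choose r1 hr1 h1 using h1
  choose r2 hr2 h2 using h2
  obtain ⟨ρ1, hρ1, hρ1'⟩ := exists_pos_forall_le r1 hr1
  obtain ⟨ρ2, hρ2, hρ2'⟩ := exists_pos_forall_le r2 hr2
  obtain ⟨ρ, hρ, hρa, hρb⟩ : ∃ ρ, 0 < ρ ∧ ρ ≤ ρ1 ∧ 2 * ρ ≤ ρ2 :=
    ⟨min ρ1 (ρ2 / 2), by positivity, min_le_left _ _, by linarith [min_le_right ρ1 (ρ2 / 2)]⟩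
  -- The extra 1 in the denominator also covers an empty index type.
  obtain ⟨ε, hε, hερ⟩ : ∃ ε, 0 < ε ∧ Fintype.card ι * ε ≤ ρ / 2 := by
    refine ⟨ρ / 2 / (Fintype.card ι + 1), by positivity, ?_⟩
    rw [mul_div_assoc', div_le_iff₀ (by positivity)]
    nlinarith
  have h3 : ∀ i, ∃ δ, 0 < δ ∧ ∀ y ∈ Icc (0 : ℝ) 1 ×ˢ Icc (0 : ℝ) 1,
      ∀ y' ∈ Icc (0 : ℝ) 1 ×ˢ Icc (0 : ℝ) 1, dist y y' < δ → dist (F i y) (F i y') < ε := by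
    intro i
    obtain ⟨δ, hδ, h⟩ := Metric.uniformContinuousOn_iff.1
      (hQ.uniformContinuousOn_of_continuous (hF i)) ε hε
    exact ⟨δ, hδ, h⟩
  choose d hd h3 using h3
  obtain ⟨δ, hδ, hδ'⟩ := exists_pos_forall_le d hd
  -- Uniform continuity makes `N + 1` equal steps short enough, while `ρ` serves for all of them.
  obtain ⟨N, hN⟩ := exists_nat_one_div_lt hδ
  have hN0 : (0 : ℝ) < N + 1 := by positivity
  have step : ∀ k : ℕ, k ≤ N + 1 → AmbientIsotopic (closeUp π fun i x => F i (0, x)).toLink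
      (closeUp π fun i x => F i (k / (N + 1), x)).toLink := by
    intro k
    induction k with
    | zero =>
      intro _
      simpa using AmbientIsotopic.refl _
    | succ k ih =>
      intro hk
      have hk' : (k : ℝ) + 1 ≤ N + 1 := by exact_mod_cast hk
      have m1 : (k : ℝ) / (N + 1) ∈ Icc (0 : ℝ) 1 :=
        ⟨by positivity, by rw [div_le_one hN0]; linarith⟩
      have m2 : ((k + 1 : ℕ) : ℝ) / (N + 1) ∈ Icc (0 : ℝ) 1 :=
        ⟨by positivity, by rw [div_le_one hN0]; push_cast; linarith⟩
      have c : ∀ s ∈ Icc (0 : ℝ) 1, ∀ i, ContinuousOn (fun x => F i (s, x)) (Icc 0 1) :=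
        fun s hs i => (hF i).comp (by fun_prop) fun x hx => ⟨hs, hx⟩
      refine (ih (by omega)).trans ?_
      refine closeUp_ambientIsotopic_of_near π (c _ m1) (c _ m2) (close _ m1) (close _ m2) hρ
        (ε := ε) ?_ ?_ ?_ hερ
      · intro x hx i j hij
        exact hρa.trans ((hρ1' (i, j)).trans (h1 (i, j) hij _ ⟨m1, hx⟩))
      · intro x hx i
        have := h2 i (_, x) ⟨m1, hx⟩
        linarith [hρ2' i]
      · intro x hx i
        rw [← dist_eq_norm]
        refine (h3 i _ ⟨m2, hx⟩ _ ⟨m1, hx⟩ ?_).le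
        refine lt_of_lt_of_le ?_ (hδ' i)
        rw [Prod.dist_eq, dist_self, max_eq_left dist_nonneg, Real.dist_eq, ← sub_div]
        push_cast
        rw [add_sub_cancel_left, abs_of_pos (by positivity)]
        exact hN
  have h := step (N + 1) le_rfl
  rwa [Nat.cast_add, Nat.cast_one, div_self hN0.ne'] at h

end

end Stst

namespace Stst

noncomputable section

open Filter Topology Set

namespace BraidWord

/-! ### Strands of braid words -/

/-- The point of the rotating unit vector of a letter at time `t`. -/
def letterPhase (g : ℕ × Bool) (t : ℝ) : ℂ :=
  Complex.exp ((if g.2 then 1 else -1) * Real.pi * Complex.I * t)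

/-- The strand of a letter in the coordinate in which position `i` is the number `i`. -/
def letterPos (g : ℕ × Bool) (i : ℕ) (t : ℝ) : ℂ :=
  if i = g.1 then g.1 + 1 / 2 - letterPhase g t / 2
  else if i = g.1 + 1 then g.1 + 1 / 2 + letterPhase g t / 2 else i

lemma letterPhase_eq (g : ℕ × Bool) (t : ℝ) : letterPhase g t =
    Complex.exp (((if g.2 then 1 else -1) * (Real.pi * t) : ℝ) * Complex.I) := by
  unfold letterPhase
  congr 1
  split_ifs <;> push_cast <;> ring

lemma letterPhase_re (g : ℕ × Bool) (t : ℝ) : (letterPhase g t).re = Real.cos (Real.pi * t) := by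
  rw [letterPhase_eq, Complex.exp_ofReal_mul_I_re]
  split_ifs <;> simp

lemma letterPhase_im (g : ℕ × Bool) (t : ℝ) :
    (letterPhase g t).im = (if g.2 then 1 else -1) * Real.sin (Real.pi * t) := by
  rw [letterPhase_eq, Complex.exp_ofReal_mul_I_im]
  split_ifs <;> simp

lemma norm_letterPhase (g : ℕ × Bool) (t : ℝ) : ‖letterPhase g t‖ = 1 := by
  rw [letterPhase_eq, Complex.norm_exp_ofReal_mul_I]

lemma letterPhase_zero (g : ℕ × Bool) : letterPhase g 0 = 1 := by
  simp [letterPhase]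

lemma letterPhase_one (g : ℕ × Bool) : letterPhase g 1 = -1 := by
  apply Complex.ext
  · simp [letterPhase_re]
  · simp [letterPhase_im]

lemma continuous_letterPhase (g : ℕ × Bool) : Continuous (letterPhase g) := by
  unfold letterPhase
  fun_prop

lemma basePoint_eq (n i : ℕ) : basePoint n i = -1 + ((2 / (n + 1) : ℝ) : ℂ) * i := by
  unfold basePoint
  push_cast
  ring

lemma letterStrand_eq (n : ℕ) (g : ℕ × Bool) (i : ℕ) (t : ℝ) :
    letterStrand n g i t = -1 + ((2 / (n + 1) : ℝ) : ℂ) * letterPos g i t := by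
  unfold letterStrand letterPos
  rw [← letterPhase]
  by_cases h1 : i = g.1
  · rw [if_pos (Or.inl h1), if_pos h1, h1]
    simp only [basePoint_eq]
    push_cast
    ring
  · by_cases h2 : i = g.1 + 1
    · rw [if_pos (Or.inr h2), if_neg h1, if_pos h2, h2]
      simp only [basePoint_eq]
      push_cast
      ring
    · rw [if_neg (by tauto), if_neg h1, if_neg h2, basePoint_eq]

lemma letterPos_zero (g : ℕ × Bool) (i : ℕ) : letterPos g i 0 = i := by
  unfold letterPos
  rw [letterPhase_zero]
  split_ifs with h1 h2
  · rw [h1]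
    ring
  · rw [h2]
    push_cast
    ring
  · rfl

lemma letterPos_one (g : ℕ × Bool) (i : ℕ) :
    letterPos g i 1 = (Equiv.swap g.1 (g.1 + 1) i : ℕ) := by
  unfold letterPos
  rw [letterPhase_one, Equiv.swap_apply_def]
  split_ifs <;> push_cast <;> ring

lemma letterStrand_zero (n : ℕ) (g : ℕ × Bool) (i : ℕ) :
    letterStrand n g i 0 = basePoint n i := by
  rw [letterStrand_eq, letterPos_zero, basePoint_eq]

lemma letterStrand_one (n : ℕ) (g : ℕ × Bool) (i : ℕ) :
    letterStrand n g i 1 = basePoint n (Equiv.swap g.1 (g.1 + 1) i) := by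
  rw [letterStrand_eq, letterPos_one, basePoint_eq]

lemma continuous_letterStrand (n : ℕ) (g : ℕ × Bool) (i : ℕ) :
    Continuous (letterStrand n g i) := by
  have h : letterStrand n g i = fun t => -1 + ((2 / (n + 1) : ℝ) : ℂ) * letterPos g i t :=
    funext (letterStrand_eq n g i)
  rw [h]
  have := continuous_letterPhase g
  unfold letterPos
  split_ifs <;> fun_prop

/-- The letter run backwards. -/
lemma letterStrand_inverse (n : ℕ) (g : ℕ × Bool) (i : ℕ) (t : ℝ) :
    letterStrand n (g.1, !g.2) (Equiv.swap g.1 (g.1 + 1) i) t = letterStrand n g i (1 - t) := by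
  have h : letterPhase (g.1, !g.2) t = -letterPhase g (1 - t) := by
    apply Complex.ext
    · rw [Complex.neg_re, letterPhase_re, letterPhase_re, mul_sub, mul_one, Real.cos_pi_sub, neg_neg]
    · rw [Complex.neg_im, letterPhase_im, letterPhase_im, mul_sub, mul_one, Real.sin_pi_sub]
      cases g.2 <;> simp
  rw [letterStrand_eq, letterStrand_eq]
  unfold letterPos
  rw [h, Equiv.swap_apply_def]
  congr 2
  split_ifs <;> first | omega | (subst_vars; push_cast; ring)

lemma letterPos_re_mem {g : ℕ × Bool} {i : ℕ} (h : i = g.1 ∨ i = g.1 + 1) (t : ℝ) :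
    (g.1 : ℝ) ≤ (letterPos g i t).re ∧ (letterPos g i t).re ≤ g.1 + 1 := by
  have h1 := Real.neg_one_le_cos (Real.pi * t)
  have h2 := Real.cos_le_one (Real.pi * t)
  have h3 := letterPhase_re g t
  unfold letterPos
  split_ifs with h4 h5
  · simp [h3]
    constructor <;> linarith
  · simp [h3]
    constructor <;> linarith
  · tauto

/-- Positions that are not exchanged by a letter keep their order on the real axis. -/
lemma letterPos_re_lt {g : ℕ × Bool} {i j : ℕ} (hij : i < j) (h : ¬(i = g.1 ∧ j = g.1 + 1))
    (t : ℝ) : (letterPos g i t).re < (letterPos g j t).re := by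
  have still : ∀ k, ¬(k = g.1 ∨ k = g.1 + 1) → (letterPos g k t).re = k := by
    intro k hk
    unfold letterPos
    rw [if_neg (by tauto), if_neg (by tauto), Complex.natCast_re]
  by_cases hi : i = g.1 ∨ i = g.1 + 1
  · have hj : ¬(j = g.1 ∨ j = g.1 + 1) := by omega
    rw [still j hj]
    have h1 := (letterPos_re_mem hi t).2
    have h2 : g.1 + 1 < j := by omega
    have h3 : (g.1 : ℝ) + 1 < j := by exact_mod_cast h2
    linarith
  · rw [still i hi]
    by_cases hj : j = g.1 ∨ j = g.1 + 1
    · have h1 := (letterPos_re_mem hj t).1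
      have h2 : i < g.1 := by omega
      have h3 : (i : ℝ) < g.1 := by exact_mod_cast h2
      linarith
    · rw [still j hj]
      exact_mod_cast hij

lemma letterPos_sub (g : ℕ × Bool) (t : ℝ) :
    letterPos g g.1 t - letterPos g (g.1 + 1) t = -letterPhase g t := by
  unfold letterPos
  rw [if_pos rfl, if_neg (by omega), if_pos rfl]
  ring

lemma letterPhase_ne_zero (g : ℕ × Bool) (t : ℝ) : letterPhase g t ≠ 0 := by
  intro h
  have := norm_letterPhase g t
  rw [h, norm_zero] at this
  exact zero_ne_one this

lemma letterPos_ne_of_lt (g : ℕ × Bool) {i j : ℕ} (hij : i < j) (t : ℝ) :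
    letterPos g i t ≠ letterPos g j t := by
  by_cases h : i = g.1 ∧ j = g.1 + 1
  · obtain ⟨rfl, rfl⟩ := h
    rw [← sub_ne_zero, letterPos_sub, neg_ne_zero]
    exact letterPhase_ne_zero g t
  · intro h1
    have := letterPos_re_lt hij h t
    rw [h1] at this
    exact lt_irrefl _ this

lemma scale_pos (n : ℕ) : (0 : ℝ) < 2 / (n + 1) := by positivity

lemma letterStrand_ne (n : ℕ) (g : ℕ × Bool) {i j : ℕ} (hij : i ≠ j) (t : ℝ) :
    letterStrand n g i t ≠ letterStrand n g j t := by
  have h : letterPos g i t ≠ letterPos g j t := by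
    rcases lt_or_gt_of_ne hij with h | h
    · exact letterPos_ne_of_lt g h t
    · exact (letterPos_ne_of_lt g h t).symm
  rw [letterStrand_eq, letterStrand_eq]
  intro h1
  exact h (mul_left_cancel₀ (Complex.ofReal_ne_zero.2 (scale_pos n).ne') (add_left_cancel h1))

lemma basePoint_ne (n : ℕ) {i j : ℕ} (hij : i ≠ j) : basePoint n i ≠ basePoint n j := by
  rw [← letterStrand_zero n (0, true), ← letterStrand_zero n (0, true)]
  exact letterStrand_ne n _ hij 0

/-- The word consists of generators of the braid group `B_n` and idle letters, which exchange the
positions `n + 1` and `n + 2`. -/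
def Admissible (n : ℕ) (w : BraidWord) : Prop :=
  ∀ g ∈ w, (1 ≤ g.1 ∧ g.1 < n) ∨ g.1 = n + 1

lemma norm_basePoint_lt {n i : ℕ} (h1 : 1 ≤ i) (h2 : i ≤ n) : ‖basePoint n i‖ < 1 := by
  unfold basePoint
  rw [Complex.norm_real, Real.norm_eq_abs, abs_lt]
  have hn : (0 : ℝ) < n + 1 := by positivity
  have h1' : (1 : ℝ) ≤ i := by exact_mod_cast h1
  have h2' : (i : ℝ) ≤ n := by exact_mod_cast h2
  constructor
  · have : 0 < 2 * (i : ℝ) / (n + 1) := by positivity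
    linarith
  · have : 2 * (i : ℝ) / (n + 1) < 2 := by
      rw [div_lt_iff₀ hn]
      linarith
    linarith

/-- The midpoint of the exchanged points and their distance from it are both less than 1. The
resulting bound 2 is what `closeUp_ambientIsotopic` requires. -/
lemma norm_letterStrand_lt {n : ℕ} {g : ℕ × Bool} (hg : (1 ≤ g.1 ∧ g.1 < n) ∨ g.1 = n + 1) {i : ℕ}
    (h1 : 1 ≤ i) (h2 : i ≤ n) (t : ℝ) : ‖letterStrand n g i t‖ < 2 := by
  unfold letterStrand
  rw [← letterPhase]
  split_ifs with h
  · have hg' : 1 ≤ g.1 ∧ g.1 + 1 ≤ n := by omega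
    have b1 := norm_basePoint_lt hg'.1 (by omega : g.1 ≤ n)
    have b2 := norm_basePoint_lt (by omega : 1 ≤ g.1 + 1) hg'.2
    set p := basePoint n g.1
    set q := basePoint n (g.1 + 1)
    have b3 : ‖(p + q) / 2‖ < 1 := by
      rw [norm_div, RCLike.norm_ofNat]
      linarith [norm_add_le p q]
    have b4 : ‖(p - q) / 2‖ < 1 := by
      rw [norm_div, RCLike.norm_ofNat]
      linarith [norm_sub_le p q]
    have b5 : ‖basePoint n i - (p + q) / 2‖ < 1 := by
      rcases h with h | h
      · rw [h, show basePoint n g.1 - (p + q) / 2 = (p - q) / 2 by ring]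
        exact b4
      · rw [h, show basePoint n (g.1 + 1) - (p + q) / 2 = -((p - q) / 2) by ring, norm_neg]
        exact b4
    refine (norm_add_le _ _).trans_lt ?_
    rw [norm_mul, norm_letterPhase, mul_one]
    linarith
  · linarith [norm_basePoint_lt h1 h2]

lemma swap_mem {n : ℕ} {g : ℕ × Bool} (hg : (1 ≤ g.1 ∧ g.1 < n) ∨ g.1 = n + 1) {i : ℕ}
    (h1 : 1 ≤ i) (h2 : i ≤ n) :
    1 ≤ Equiv.swap g.1 (g.1 + 1) i ∧ Equiv.swap g.1 (g.1 + 1) i ≤ n := by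
  rw [Equiv.swap_apply_def]
  split_ifs <;> omega

lemma strand_nil (n i : ℕ) (t : ℝ) : strand n [] i t = basePoint n i := rfl

lemma strand_cons (n : ℕ) (g : ℕ × Bool) (w : BraidWord) (i : ℕ) (t : ℝ) :
    strand n (g :: w) i t = if t ≤ 1 then letterStrand n g i t
      else strand n w (Equiv.swap g.1 (g.1 + 1) i) (t - 1) := rfl

lemma strand_zero (n : ℕ) (w : BraidWord) (i : ℕ) : strand n w i 0 = basePoint n i := by
  cases w with
  | nil => rfl
  | cons g w => rw [strand_cons, if_pos zero_le_one, letterStrand_zero]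

lemma strand_cons_of_le (n : ℕ) (g : ℕ × Bool) (w : BraidWord) (i : ℕ) {t : ℝ} (h : t ≤ 1) :
    strand n (g :: w) i t = letterStrand n g i t := by
  rw [strand_cons, if_pos h]

lemma strand_cons_of_ge (n : ℕ) (g : ℕ × Bool) (w : BraidWord) (i : ℕ) {t : ℝ} (h : 1 ≤ t) :
    strand n (g :: w) i t = strand n w (Equiv.swap g.1 (g.1 + 1) i) (t - 1) := by
  rcases h.eq_or_lt with rfl | h
  · rw [strand_cons, if_pos le_rfl, letterStrand_one, sub_self, strand_zero]
  · rw [strand_cons, if_neg (by linarith)]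

lemma continuous_strand (n : ℕ) (w : BraidWord) (i : ℕ) : Continuous (strand n w i) := by
  induction w generalizing i with
  | nil => exact continuous_const
  | cons g w ih =>
    refine Continuous.if_le (continuous_letterStrand n g i) ((ih _).comp (by fun_prop))
      continuous_id continuous_const ?_
    rintro t ht
    rw [show t = 1 from ht, letterStrand_one, sub_self, strand_zero]

lemma perm_cons (g : ℕ × Bool) (w : BraidWord) (i : ℕ) :
    perm (g :: w) i = perm w (Equiv.swap g.1 (g.1 + 1) i) := rfl

lemma perm_append (v w : BraidWord) (i : ℕ) : perm (v ++ w) i = perm w (perm v i) := by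
  induction v generalizing i with
  | nil => rfl
  | cons g v ih => rw [List.cons_append, perm_cons, perm_cons, ih]

lemma strand_of_length_le (n : ℕ) (w : BraidWord) (i : ℕ) {t : ℝ} (h : (w.length : ℝ) ≤ t) :
    strand n w i t = basePoint n (perm w i) := by
  induction w generalizing i t with
  | nil => rfl
  | cons g w ih =>
    rw [List.length_cons, Nat.cast_add, Nat.cast_one] at h
    have : (0 : ℝ) ≤ w.length := by positivity
    rw [strand_cons_of_ge _ _ _ _ (by linarith), ih _ (by linarith), perm_cons]

lemma strand_append_of_le (n : ℕ) (v w : BraidWord) (i : ℕ) {t : ℝ} (h0 : 0 ≤ t)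
    (h : t ≤ v.length) : strand n (v ++ w) i t = strand n v i t := by
  induction v generalizing i t with
  | nil =>
    rw [List.length_nil, Nat.cast_zero] at h
    rw [List.nil_append, le_antisymm h h0, strand_zero, strand_zero]
  | cons g v ih =>
    rw [List.length_cons, Nat.cast_add, Nat.cast_one] at h
    rw [List.cons_append]
    rcases le_total t 1 with h1 | h1
    · rw [strand_cons_of_le _ _ _ _ h1, strand_cons_of_le _ _ _ _ h1]
    · rw [strand_cons_of_ge _ _ _ _ h1, strand_cons_of_ge _ _ _ _ h1,
        ih _ (by linarith) (by linarith)]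

lemma strand_append_of_ge (n : ℕ) (v w : BraidWord) (i : ℕ) {t : ℝ} (h : (v.length : ℝ) ≤ t) :
    strand n (v ++ w) i t = strand n w (perm v i) (t - v.length) := by
  induction v generalizing i t with
  | nil => simp [perm]
  | cons g v ih =>
    rw [List.length_cons, Nat.cast_add, Nat.cast_one] at h ⊢
    have : (0 : ℝ) ≤ v.length := by positivity
    rw [List.cons_append, strand_cons_of_ge _ _ _ _ (by linarith), ih _ (by linarith), perm_cons]
    congr 1
    ring

lemma inverse_cons (g : ℕ × Bool) (w : BraidWord) :
    inverse (g :: w) = inverse w ++ [(g.1, !g.2)] := by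
  simp [inverse]

lemma length_inverse (w : BraidWord) : w.inverse.length = w.length := by
  simp [inverse]

lemma perm_inverse_perm (w : BraidWord) (i : ℕ) : perm w.inverse (perm w i) = i := by
  induction w generalizing i with
  | nil => rfl
  | cons g w ih =>
    rw [inverse_cons, perm_append, perm_cons g, ih, perm_cons]
    exact Equiv.swap_apply_self _ _ i

/-- The inverse word is the word run backwards. -/
lemma strand_inverse (n : ℕ) (w : BraidWord) (i : ℕ) {t : ℝ} (h0 : 0 ≤ t) (h1 : t ≤ w.length) :
    strand n w.inverse (perm w i) t = strand n w i (w.length - t) := by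
  induction w generalizing i t with
  | nil => rfl
  | cons g w ih =>
    rw [List.length_cons, Nat.cast_add, Nat.cast_one] at h1 ⊢
    rw [inverse_cons, perm_cons]
    rcases le_total t w.length with h | h
    · rw [strand_append_of_le _ _ _ _ h0 (by rwa [length_inverse]), ih _ h0 h,
        strand_cons_of_ge _ _ _ _ (by linarith)]
      congr 1
      ring
    · rw [strand_append_of_ge _ _ _ _ (by rwa [length_inverse]), perm_inverse_perm, length_inverse,
        strand_cons_of_le _ _ _ _ (by linarith), letterStrand_inverse,
        strand_cons_of_le _ _ _ _ (by linarith)]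
      congr 1
      ring

lemma strand_ne (n : ℕ) (w : BraidWord) {i j : ℕ} (hij : i ≠ j) (t : ℝ) :
    strand n w i t ≠ strand n w j t := by
  induction w generalizing i j t with
  | nil => exact basePoint_ne n hij
  | cons g w ih =>
    rw [strand_cons, strand_cons]
    split_ifs
    · exact letterStrand_ne n g hij t
    · exact ih ((Equiv.injective _).ne hij) _

lemma Admissible.tail {n : ℕ} {g : ℕ × Bool} {w : BraidWord} (h : Admissible n (g :: w)) :
    Admissible n w := fun x hx => h x (List.mem_cons_of_mem _ hx)

lemma Admissible.norm_strand_lt {n : ℕ} {w : BraidWord} (hw : w.Admissible n) {i : ℕ}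
    (h1 : 1 ≤ i) (h2 : i ≤ n) (t : ℝ) : ‖strand n w i t‖ < 2 := by
  induction w generalizing i t with
  | nil =>
    rw [strand_nil]
    linarith [norm_basePoint_lt h1 h2]
  | cons g w ih =>
    have hg := hw g List.mem_cons_self
    rw [strand_cons]
    split_ifs
    · exact norm_letterStrand_lt hg h1 h2 t
    · have := swap_mem hg h1 h2
      exact ih hw.tail this.1 this.2 _

lemma Admissible.perm_mem {n : ℕ} {w : BraidWord} (hw : w.Admissible n) {i : ℕ}
    (h1 : 1 ≤ i) (h2 : i ≤ n) : 1 ≤ perm w i ∧ perm w i ≤ n := by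
  induction w generalizing i with
  | nil => exact ⟨h1, h2⟩
  | cons g w ih =>
    have := swap_mem (hw g List.mem_cons_self) h1 h2
    exact ih hw.tail this.1 this.2

/-- The word without its idle letters. -/
def active (n : ℕ) (w : BraidWord) : BraidWord := w.filter fun g => g.1 ≠ n + 1

/-- Idle letters only change the parametrization of the strands. -/
lemma Admissible.exists_reparam {n : ℕ} {w : BraidWord} (hw : w.Admissible n) :
    ∃ θ : ℝ → ℝ, Continuous θ ∧ θ 0 = 0 ∧ (∀ t, 0 ≤ t → 0 ≤ θ t) ∧
      (∀ t, (w.length : ℝ) ≤ t → θ t = (w.active n).length) ∧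
      ∀ i, 1 ≤ i → i ≤ n → ∀ t, strand n w i t = strand n (w.active n) i (θ t) := by
  induction w with
  | nil => exact ⟨fun _ => 0, continuous_const, rfl, by simp, by simp [active], by simp [active, strand_nil]⟩
  | cons g w ih =>
    obtain ⟨θ, hc, h0, hp, hl, hs⟩ := ih hw.tail
    have hg := hw g List.mem_cons_self
    have hlen : (0 : ℝ) ≤ w.length := by positivity
    by_cases hi : g.1 = n + 1
    · have ha : active n (g :: w) = active n w := by simp [active, hi]
      -- During an idle letter the clock of the shortened word stands still at 0.
      refine ⟨fun t => θ (max (t - 1) 0), hc.comp (by fun_prop), ?_, ?_, ?_, ?_⟩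
      · simp [h0]
      · exact fun t _ => hp _ (le_max_right _ _)
      · intro t ht
        rw [List.length_cons, Nat.cast_add, Nat.cast_one] at ht
        rw [ha]
        exact hl _ (le_max_of_le_left (by linarith))
      · intro i h1 h2 t
        rw [ha]
        beta_reduce
        have hsw : Equiv.swap g.1 (g.1 + 1) i = i :=
          Equiv.swap_apply_of_ne_of_ne (by omega) (by omega)
        rcases le_total t 1 with ht | ht
        · rw [strand_cons_of_le _ _ _ _ ht, max_eq_right (by linarith), h0, strand_zero,
            letterStrand, if_neg (by omega)]
        · rw [strand_cons_of_ge _ _ _ _ ht, max_eq_left (by linarith), hsw, hs i h1 h2]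
    · have ha : active n (g :: w) = g :: active n w := by simp [active, hi]
      -- The clock runs at unit speed through the first letter and then continues with the clock of
      -- the tail.
      refine ⟨fun t => min t 1 + θ (max (t - 1) 0), ?_, ?_, ?_, ?_, ?_⟩
      · exact (by fun_prop : Continuous fun t : ℝ => min t 1).add (hc.comp (by fun_prop))
      · simp [h0]
      · exact fun t ht => add_nonneg (le_min ht zero_le_one) (hp _ (le_max_right _ _))
      · intro t ht
        rw [List.length_cons, Nat.cast_add, Nat.cast_one] at ht
        beta_reduce
        rw [ha, hl _ (le_max_of_le_left (by linarith)), min_eq_right (by linarith)]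
        push_cast [List.length_cons]
        ring
      · intro i h1 h2 t
        rw [ha]
        beta_reduce
        have hsw := swap_mem hg h1 h2
        rcases le_total t 1 with ht | ht
        · rw [strand_cons_of_le _ _ _ _ ht, max_eq_right (by linarith), h0, min_eq_left ht, add_zero,
            strand_cons_of_le _ _ _ _ ht]
        · rw [strand_cons_of_ge _ _ _ _ ht, max_eq_left (by linarith), min_eq_right ht,
            strand_cons_of_ge _ _ _ _ (by linarith [hp (t - 1) (by linarith)]),
            hs _ hsw.1 hsw.2, add_sub_cancel_left]

end BraidWord

end

end Stst

namespace Stst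

noncomputable section

open Filter Topology Set

/-! ### Rotating a layer by one slot -/

/-- The projection of the real line onto the unit interval. -/
def clamp (x : ℝ) : ℝ := max 0 (min 1 x)

lemma clamp_nonneg (x : ℝ) : 0 ≤ clamp x := le_max_left _ _

lemma clamp_le_one (x : ℝ) : clamp x ≤ 1 := max_le zero_le_one (min_le_left _ _)

lemma clamp_mono {x y : ℝ} (h : x ≤ y) : clamp x ≤ clamp y :=
  max_le_max le_rfl (min_le_min le_rfl h)

lemma clamp_of_nonpos {x : ℝ} (h : x ≤ 0) : clamp x = 0 :=
  max_eq_left ((min_le_right _ _).trans h)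

lemma clamp_of_one_le {x : ℝ} (h : 1 ≤ x) : clamp x = 1 := by
  rw [clamp, min_eq_left h, max_eq_right zero_le_one]

lemma clamp_of_mem {x : ℝ} (h0 : 0 ≤ x) (h1 : x ≤ 1) : clamp x = x := by
  rw [clamp, min_eq_right h1, max_eq_right h0]

lemma continuous_clamp : Continuous clamp := by
  unfold clamp
  fun_prop

/-- The point of the circle of radius `b` at angle `v`. -/
def circlePoint (b v : ℝ) : ℂ := b * Complex.exp (v * Complex.I)

lemma circlePoint_re (b v : ℝ) : (circlePoint b v).re = b * Real.cos v := by
  rw [circlePoint, Complex.re_ofReal_mul, Complex.exp_ofReal_mul_I_re]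

lemma circlePoint_im (b v : ℝ) : (circlePoint b v).im = b * Real.sin v := by
  rw [circlePoint, Complex.im_ofReal_mul, Complex.exp_ofReal_mul_I_im]

lemma norm_circlePoint {b : ℝ} (hb : 0 ≤ b) (v : ℝ) : ‖circlePoint b v‖ = b := by
  rw [circlePoint, norm_mul, Complex.norm_exp_ofReal_mul_I, mul_one, Complex.norm_real,
    Real.norm_of_nonneg hb]

lemma circlePoint_add_two_pi (b v : ℝ) (e : ℤ) :
    circlePoint b (v + 2 * Real.pi * e) = circlePoint b v := by
  apply Complex.ext
  · rw [circlePoint_re, circlePoint_re, mul_comm (2 * Real.pi), Real.cos_add_int_mul_two_pi]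
  · rw [circlePoint_im, circlePoint_im, mul_comm (2 * Real.pi), Real.sin_add_int_mul_two_pi]

lemma continuous_circlePoint : Continuous fun p : ℝ × ℝ => circlePoint p.1 p.2 := by
  unfold circlePoint
  fun_prop

/-- The angle of the point on the lower half of the circle of radius `b` with real part `x`. -/
def lowerAngle (b x : ℝ) : ℝ := -Real.arccos (x / b)

lemma continuous_lowerAngle (b : ℝ) : Continuous (lowerAngle b) :=
  (Real.continuous_arccos.comp (continuous_id.div_const b)).neg

lemma lowerAngle_nonpos (b x : ℝ) : lowerAngle b x ≤ 0 := neg_nonpos.2 (Real.arccos_nonneg _)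

lemma neg_pi_le_lowerAngle (b x : ℝ) : -Real.pi ≤ lowerAngle b x :=
  neg_le_neg (Real.arccos_le_pi _)

lemma lowerAngle_self {b : ℝ} (hb : 0 < b) : lowerAngle b b = 0 := by
  rw [lowerAngle, div_self hb.ne', Real.arccos_one, neg_zero]

lemma lowerAngle_lt {b x y : ℝ} (hb : 0 < b) (h0 : 0 ≤ x) (hxy : x < y) (hy : y ≤ b) :
    lowerAngle b x < lowerAngle b y := by
  apply neg_lt_neg
  apply Real.arccos_lt_arccos
  · have : 0 ≤ x / b := by positivity
    linarith
  · gcongr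
  · rwa [div_le_one hb]

lemma circlePoint_lowerAngle {b x : ℝ} (hb : 0 < b) (h0 : 0 ≤ x) (h1 : x ≤ b) :
    (circlePoint b (lowerAngle b x)).re = x ∧ (circlePoint b (lowerAngle b x)).im ≤ 0 ∧
      (circlePoint b (lowerAngle b x)).im ^ 2 = b ^ 2 - x ^ 2 := by
  have hx : 0 ≤ x / b := by positivity
  have hre : (circlePoint b (lowerAngle b x)).re = x := by
    rw [circlePoint_re, lowerAngle, Real.cos_neg,
      Real.cos_arccos (by linarith) ((div_le_one hb).2 h1)]
    field_simp
  refine ⟨hre, ?_, ?_⟩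
  · rw [circlePoint_im, lowerAngle, Real.sin_neg, Real.sin_arccos]
    have := mul_nonneg hb.le (Real.sqrt_nonneg (1 - (x / b) ^ 2))
    linarith
  · have h2 := norm_circlePoint hb.le (lowerAngle b x)
    have h3 := Complex.sq_norm (circlePoint b (lowerAngle b x))
    rw [h2, Complex.normSq_apply, hre] at h3
    nlinarith

lemma circlePoint_neg (b v : ℝ) : (circlePoint b (-v)).re = (circlePoint b v).re ∧
    (circlePoint b (-v)).im = -(circlePoint b v).im := by
  simp [circlePoint_re, circlePoint_im]

/-- The angle at time `t` of the strand of slot `0`, which runs once around the circle: it goes to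
the left on the lower half while `t ≤ a`, around the left end while `a ≤ t ≤ a + 1`, and back to
the right on the upper half until `t = a + b`. -/
def leadAngle (a b : ℕ) (t : ℝ) : ℝ :=
  lowerAngle b (a + 1 - min t a) - (2 * Real.pi + 2 * lowerAngle b 1) * clamp (t - a) +
    (lowerAngle b 1 - lowerAngle b (max t (a + 1) - a))

/-- The angle at time `t` of the strand of slot `r ≥ 1`, which moves on to the slot `r - 1` during
the time from `2 a + r` to `2 a + r + 1`. -/
def mateAngle (a b r : ℕ) (t : ℝ) : ℝ :=
  lowerAngle b (a + 1 + r - clamp (t - (2 * a + r)))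

/-- The angle of the slot with number `m ∈ ℤ` of a layer that has `q` slots. -/
def slotAngle (a q : ℕ) (m : ℤ) : ℝ :=
  2 * Real.pi * (m / q : ℤ) + lowerAngle (a + q) (a + 1 + (m % q : ℤ))

/-- The angle at time `t` of the strand that moves from slot `m` to slot `m - 1`. -/
def blockAngle (a q : ℕ) (m : ℤ) (t : ℝ) : ℝ :=
  2 * Real.pi * (m / q : ℤ) +
    if m % q = 0 then leadAngle a (a + q) t else mateAngle a (a + q) (m % q).toNat t

section

variable {a b q : ℕ} {t : ℝ}

lemma leadAngle_of_le (h : t ≤ a) : leadAngle a b t = lowerAngle b (a + 1 - t) := by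
  rw [leadAngle, min_eq_left h, clamp_of_nonpos (by linarith), max_eq_right (by linarith),
    add_sub_cancel_left]
  ring

lemma leadAngle_of_mem (h0 : (a : ℝ) ≤ t) (h1 : t ≤ a + 1) : leadAngle a b t =
    lowerAngle b 1 - (2 * Real.pi + 2 * lowerAngle b 1) * (t - a) := by
  rw [leadAngle, min_eq_right h0, clamp_of_mem (by linarith) (by linarith), max_eq_right h1,
    add_sub_cancel_left]
  ring

lemma leadAngle_of_ge (h : (a : ℝ) + 1 ≤ t) :
    leadAngle a b t = -lowerAngle b (t - a) - 2 * Real.pi := by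
  rw [leadAngle, min_eq_right (by linarith), clamp_of_one_le (by linarith), max_eq_left h,
    add_sub_cancel_left]
  ring

lemma continuous_leadAngle (a b : ℕ) : Continuous (leadAngle a b) := by
  unfold leadAngle
  have := continuous_clamp
  have := continuous_lowerAngle b
  fun_prop

lemma continuous_mateAngle (a b r : ℕ) : Continuous (mateAngle a b r) := by
  unfold mateAngle
  have := continuous_clamp
  have := continuous_lowerAngle b
  fun_prop

lemma continuous_blockAngle (a q : ℕ) (m : ℤ) : Continuous (blockAngle a q m) := by
  unfold blockAngle
  have := continuous_leadAngle a (a + q)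
  have := continuous_mateAngle a (a + q) (m % q).toNat
  split_ifs <;> fun_prop

lemma ediv_slot {r : ℕ} (hr : r < q) (e : ℤ) : (e * q + r : ℤ) / q = e := by
  have hq : (q : ℤ) ≠ 0 := by omega
  rw [add_comm, Int.add_mul_ediv_right _ _ hq, Int.ediv_eq_zero_of_lt (by omega) (by omega),
    zero_add]

lemma emod_slot {r : ℕ} (hr : r < q) (e : ℤ) : (e * q + r : ℤ) % q = r := by
  rw [add_comm, Int.add_mul_emod_self_right, Int.emod_eq_of_lt (by omega) (by omega)]

lemma exists_slot (hq : 0 < q) (m : ℤ) : ∃ (e : ℤ) (r : ℕ), r < q ∧ m = e * q + r := by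
  have hq' : (q : ℤ) ≠ 0 := by omega
  have h1 := Int.emod_nonneg m hq'
  have h2 := Int.emod_lt_of_pos m (by omega : (0 : ℤ) < q)
  refine ⟨m / q, (m % q).toNat, by omega, ?_⟩
  rw [Int.toNat_of_nonneg h1, mul_comm]
  exact (Int.mul_ediv_add_emod m q).symm

lemma slotAngle_slot {r : ℕ} (hr : r < q) (e : ℤ) : slotAngle a q (e * q + r) =
    2 * Real.pi * e + lowerAngle (a + q) (a + 1 + r) := by
  rw [slotAngle, ediv_slot hr, emod_slot hr, Int.cast_natCast]

lemma blockAngle_lead (hq : 0 < q) (e : ℤ) : blockAngle a q (e * q) t =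
    2 * Real.pi * e + leadAngle a (a + q) t := by
  have h1 := ediv_slot (r := 0) hq e
  have h2 := emod_slot (r := 0) hq e
  rw [Nat.cast_zero, add_zero] at h1 h2
  rw [blockAngle, h1, h2, if_pos rfl]

lemma blockAngle_mate {r : ℕ} (hr0 : r ≠ 0) (hr : r < q) (e : ℤ) : blockAngle a q (e * q + r) t =
    2 * Real.pi * e + mateAngle a (a + q) r t := by
  rw [blockAngle, ediv_slot hr, emod_slot hr, if_neg (by exact_mod_cast hr0), Int.toNat_natCast]

lemma blockAngle_zero (hq : 0 < q) (m : ℤ) : blockAngle a q m 0 = slotAngle a q m := by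
  obtain ⟨e, r, hr, rfl⟩ := exists_slot hq m
  rw [slotAngle_slot hr]
  rcases Nat.eq_zero_or_pos r with rfl | h
  · rw [Nat.cast_zero, add_zero, blockAngle_lead hq, leadAngle_of_le (by positivity)]
    push_cast
    congr 2
    ring
  · rw [blockAngle_mate h.ne' hr, mateAngle, clamp_of_nonpos (by linarith [(Nat.cast_nonneg a : (0:ℝ) ≤ a), (Nat.cast_nonneg r : (0:ℝ) ≤ r)])]
    push_cast
    congr 2
    ring

/-- Every mate drops by one slot. The leading strand ends at the rightmost point of the circle with
angle lowered by a full turn, and that is the last slot of the previous turn. -/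
lemma blockAngle_end (hq : 0 < q) (m : ℤ) :
    blockAngle a q m (2 * a + q) = slotAngle a q (m - 1) := by
  obtain ⟨e, r, hr, rfl⟩ := exists_slot hq m
  have hq' : (1 : ℝ) ≤ q := by exact_mod_cast hq
  have ha : (0 : ℝ) ≤ a := by positivity
  rcases Nat.eq_zero_or_pos r with rfl | h
  · have h1 : (e * q + (0 : ℕ) - 1 : ℤ) = (e - 1) * q + (q - 1 : ℕ) := by
      rw [Nat.cast_sub hq]
      push_cast
      ring
    rw [h1, slotAngle_slot (by omega), Nat.cast_zero, add_zero, blockAngle_lead hq,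
      leadAngle_of_ge (by linarith), Nat.cast_sub hq]
    push_cast
    rw [show 2 * (a : ℝ) + q - a = a + q by ring, show (a : ℝ) + 1 + (q - 1) = a + q by ring,
      lowerAngle_self (by linarith)]
    ring
  · obtain ⟨r, rfl⟩ : ∃ k, r = k + 1 := ⟨r - 1, by omega⟩
    have h1 : (e * q + (r + 1 : ℕ) - 1 : ℤ) = e * q + r := by
      push_cast
      ring
    have h2 : (r : ℝ) + 1 + 1 ≤ q := by exact_mod_cast hr
    rw [h1, slotAngle_slot (by omega), blockAngle_mate (by omega) hr, mateAngle,
      clamp_of_one_le (by push_cast; linarith)]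
    push_cast
    congr 2
    ring

lemma slotAngle_add (hq : 0 < q) (m k : ℤ) :
    slotAngle a q (m + k * q) = slotAngle a q m + 2 * Real.pi * k := by
  obtain ⟨e, r, hr, rfl⟩ := exists_slot hq m
  rw [show e * q + r + k * q = (e + k) * q + (r : ℤ) by ring, slotAngle_slot hr, slotAngle_slot hr]
  push_cast
  ring

lemma blockAngle_add (hq : 0 < q) (m k : ℤ) :
    blockAngle a q (m + k * q) t = blockAngle a q m t + 2 * Real.pi * k := by
  obtain ⟨e, r, hr, rfl⟩ := exists_slot hq m
  rw [show e * q + r + k * q = (e + k) * q + (r : ℤ) by ring]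
  rcases Nat.eq_zero_or_pos r with rfl | h
  · rw [Nat.cast_zero, add_zero, add_zero, blockAngle_lead hq, blockAngle_lead hq]
    push_cast
    ring
  · rw [blockAngle_mate h.ne' hr, blockAngle_mate h.ne' hr]
    push_cast
    ring

lemma neg_pi_div_two_le_lowerAngle (b : ℕ) {x : ℝ} (hx : 0 ≤ x) :
    -(Real.pi / 2) ≤ lowerAngle b x :=
  neg_le_neg (Real.arccos_le_pi_div_two.2 (by positivity))

/-- The first mate stays ahead of the leading strand. -/
lemma leadAngle_lt_mateAngle (hq : 1 < q) (h0 : 0 ≤ t) :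
    leadAngle a (a + q) t < mateAngle a (a + q) 1 t := by
  have hq' : (1 : ℝ) + 1 ≤ q := by exact_mod_cast hq
  have ha : (0 : ℝ) ≤ a := by positivity
  have hpi := Real.pi_pos
  have hb : (0 : ℝ) < (a + q : ℕ) := by push_cast; linarith
  have l1 := neg_pi_le_lowerAngle (a + q : ℕ)
  have l2 := @neg_pi_div_two_le_lowerAngle (a + q)
  rw [mateAngle]
  push_cast at *
  rcases le_total t a with h | h
  · rw [leadAngle_of_le h, clamp_of_nonpos (by linarith)]
    push_cast
    exact lowerAngle_lt hb (by linarith) (by linarith) (by linarith)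
  rcases le_total t (a + 1) with h' | h'
  · rw [leadAngle_of_mem h h', clamp_of_nonpos (by linarith)]
    push_cast
    have h2 : lowerAngle (a + q) 1 < lowerAngle (a + q) (a + 1 + 1 - 0) :=
      lowerAngle_lt hb (by linarith) (by linarith) (by linarith)
    have h3 : 0 ≤ (2 * Real.pi + 2 * lowerAngle (a + q) 1) * (t - a) :=
      mul_nonneg (by linarith [l1 1]) (by linarith)
    linarith
  -- From here on the leading angle is at most `-3π/2`, whereas a mate never goes below `-π`.
  · rw [leadAngle_of_ge h']
    push_cast
    linarith [l1 (a + 1 + 1 - clamp (t - (2 * a + 1))), @l2 (t - a) (by linarith)]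

/-- The leading strand stays ahead of the last mate, one turn behind. -/
lemma mateAngle_lt_leadAngle {r : ℕ} (hr : 1 ≤ r) (hq : r + 1 = q) (h1 : t ≤ 2 * a + q) :
    mateAngle a (a + q) r t < leadAngle a (a + q) t + 2 * Real.pi := by
  have hq' : (r : ℝ) + 1 = q := by exact_mod_cast hq
  have hr' : (1 : ℝ) ≤ r := by exact_mod_cast hr
  have ha : (0 : ℝ) ≤ a := by positivity
  have hpi := Real.pi_pos
  have hb : (0 : ℝ) < (a + q : ℕ) := by push_cast; linarith
  have l1 := neg_pi_le_lowerAngle (a + q : ℕ)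
  have l0 := lowerAngle_nonpos (a + q : ℕ)
  have ls := lowerAngle_self hb
  rw [mateAngle]
  push_cast at *
  have hm := l0 (a + 1 + r - clamp (t - (2 * a + r)))
  rcases le_total t a with h | h
  · rw [leadAngle_of_le h]
    push_cast
    linarith [l1 (a + 1 - t)]
  rcases le_total t (a + 1) with h' | h'
  · rw [leadAngle_of_mem h h']
    push_cast
    have h2 : lowerAngle (a + q) 1 < lowerAngle (a + q) (a + q) :=
      lowerAngle_lt hb (by linarith) (by linarith) (by linarith)
    have h3 : (2 * Real.pi + 2 * lowerAngle (a + q) 1) * (t - a) ≤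
        (2 * Real.pi + 2 * lowerAngle (a + q) 1) * 1 :=
      mul_le_mul_of_nonneg_left (by linarith) (by linarith [l1 1])
    linarith
  · rw [leadAngle_of_ge h']
    push_cast
    -- Until the final moment the leading angle, raised by a full turn, is positive. At the final
    -- moment it is 0, and by then the last mate has left the rightmost point.
    rcases h1.lt_or_eq with h1 | h1
    · have h2 : lowerAngle (a + q) (t - a) < lowerAngle (a + q) (a + q) :=
        lowerAngle_lt hb (by linarith) (by linarith) (by linarith)
      linarith
    · have h2 : lowerAngle (a + q) (a + 1 + r - clamp (t - (2 * a + r))) <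
          lowerAngle (a + q) (a + q) := by
        rw [clamp_of_one_le (by linarith)]
        exact lowerAngle_lt hb (by linarith) (by linarith) (by linarith)
      linarith [l0 (t - a)]

/-- The lifted angles keep their cyclic order throughout the move, so no two points of a layer meet.
Only neighbouring slots need comparison: leader and first mate, consecutive mates, and last mate and
the leader of the next turn. -/
lemma strictMono_blockAngle (hq : 0 < q) (h0 : 0 ≤ t) (h1 : t ≤ 2 * a + q) :
    StrictMono fun m => blockAngle a q m t := by
  apply strictMono_int_of_lt_succ
  intro m
  obtain ⟨e, r, hr, rfl⟩ := exists_slot hq m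
  rcases Nat.eq_zero_or_pos r with rfl | hr0
  · rw [Nat.cast_zero, add_zero, blockAngle_lead hq]
    rcases Nat.lt_or_ge 1 q with h | h
    · rw [show (e * q + 1 : ℤ) = e * q + (1 : ℕ) by simp, blockAngle_mate one_ne_zero h]
      linarith [@leadAngle_lt_mateAngle a q t h h0]
    · obtain rfl : q = 1 := by omega
      rw [show (e * (1 : ℕ) + 1 : ℤ) = (e + 1) * (1 : ℕ) by simp, blockAngle_lead one_pos]
      push_cast
      linarith [Real.pi_pos]
  · rw [blockAngle_mate hr0.ne' hr]
    rcases Nat.lt_or_ge (r + 1) q with h | h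
    · rw [show (e * q + r + 1 : ℤ) = e * q + (r + 1 : ℕ) by push_cast; ring,
        blockAngle_mate (by omega) h]
      have hb : (0 : ℝ) < (a + q : ℕ) := by positivity
      have h2 : mateAngle a (a + q) r t < mateAngle a (a + q) (r + 1) t := by
        have h3 := clamp_mono (show t - (2 * a + (r + 1)) ≤ t - (2 * a + r) by linarith)
        have h4 := clamp_le_one (t - (2 * a + r))
        have h5 := clamp_nonneg (t - (2 * a + (r + 1)))
        have h6 : (r : ℝ) + 1 + 1 ≤ q := by exact_mod_cast h
        have ha : (0 : ℝ) ≤ a := by positivity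
        have hr' : (0 : ℝ) ≤ r := by positivity
        apply lowerAngle_lt hb <;> push_cast <;> linarith
      linarith
    · have h2 : r + 1 = q := by omega
      have h3 : (e * q + r + 1 : ℤ) = (e + 1) * q := by
        rw [← h2]
        push_cast
        ring
      rw [h3, blockAngle_lead hq]
      have := mateAngle_lt_leadAngle (a := a) (t := t) hr0 h2 h1
      push_cast
      linarith

lemma strictMono_slotAngle (hq : 0 < q) : StrictMono (slotAngle a q) := by
  have h := strictMono_blockAngle (a := a) (t := 0) hq le_rfl (by positivity)
  simpa only [blockAngle_zero hq] using h

end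

/-! ### Vectors that are never antipodal -/

/-- No nontrivial nonnegative combination of the two vectors vanishes. -/
def NonAntipodal (u v : ℂ) : Prop :=
  ∀ α β : ℝ, 0 ≤ α → 0 ≤ β → 0 < α + β → α * u + β * v ≠ 0

/-- Two vectors in a closed half plane, one of them in its interior and the other nonzero, cannot
cancel. The weak inequality for `v` matters: compared points may be momentarily aligned vertically.
-/
lemma NonAntipodal.of_re_neg {u v : ℂ} (hu : u.re < 0) (hv : v.re ≤ 0) (hv0 : v ≠ 0) :
    NonAntipodal u v := by
  intro α β hα hβ hαβ h
  rcases hα.eq_or_lt with rfl | hα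
  · rw [Complex.ofReal_zero, zero_mul, zero_add, mul_eq_zero, Complex.ofReal_eq_zero] at h
    rcases h with h | h
    · linarith
    · exact hv0 h
  · have h1 := congrArg Complex.re h
    simp only [Complex.add_re, Complex.re_ofReal_mul, Complex.zero_re] at h1
    nlinarith [mul_pos_of_neg_of_neg (neg_neg_of_pos hα) hu, mul_nonneg hβ (neg_nonneg.2 hv)]

lemma NonAntipodal.neg {u v : ℂ} (h : NonAntipodal u v) : NonAntipodal (-u) (-v) := by
  intro α β hα hβ hαβ h1
  exact h α β hα hβ hαβ (by linear_combination -h1)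

lemma NonAntipodal.of_re_pos {u v : ℂ} (hu : 0 < u.re) (hv : 0 ≤ v.re) (hv0 : v ≠ 0) :
    NonAntipodal u v := by
  have := (NonAntipodal.of_re_neg (u := -u) (v := -v) (by simpa) (by simpa) (by simpa)).neg
  simpa using this

lemma NonAntipodal.of_im_pos {u v : ℂ} (hu : 0 ≤ u.im) (hu0 : u ≠ 0) (hv : 0 < v.im) :
    NonAntipodal u v := by
  intro α β hα hβ hαβ h
  rcases hβ.eq_or_lt with rfl | hβ
  · rw [Complex.ofReal_zero, zero_mul, add_zero, mul_eq_zero, Complex.ofReal_eq_zero] at h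
    rcases h with h | h
    · linarith
    · exact hu0 h
  · have h1 := congrArg Complex.im h
    simp only [Complex.add_im, Complex.im_ofReal_mul, Complex.zero_im] at h1
    nlinarith [mul_pos hβ hv, mul_nonneg hα hu]

lemma NonAntipodal.scale {u v : ℂ} (h : NonAntipodal u v) {c d : ℝ} (hc : 0 < c) (hd : 0 < d) :
    NonAntipodal (c * u) (d * v) := by
  intro α β hα hβ hαβ h1
  refine h (α * c) (β * d) (by positivity) (by positivity) ?_ ?_
  · rcases hα.eq_or_lt with rfl | hα
    · have : 0 < β := by linarith
      positivity
    · positivity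
  · push_cast
    linear_combination h1

end

end Stst

namespace Stst

noncomputable section

open Filter Topology Set

namespace BraidWord

/-! ### The word of a block -/

/-- The word that moves position `a + 1` around the positions `1, …, a` and on to position `b`,
with an idle letter in the middle. -/
def blockWord (n a b : ℕ) : BraidWord := descending a ++ (n + 1, false) :: ascending (b - 1)

lemma length_ascending (b : ℕ) : (ascending b).length = b := by simp [ascending]

lemma length_descending (b : ℕ) : (descending b).length = b := by simp [descending, ascending]

lemma length_blockWord {a b : ℕ} (n : ℕ) (h : a < b) : (blockWord n a b).length = a + b := by
  simp only [blockWord, List.length_append, List.length_cons, length_ascending, length_descending]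
  omega

lemma getElem_ascending {b s : ℕ} (h : s < (ascending b).length) :
    (ascending b)[s] = (s + 1, false) := by
  simp [ascending]

lemma getElem_descending {b s : ℕ} (h : s < (descending b).length) :
    (descending b)[s] = (b - s, false) := by
  have h' : s < b := by rwa [length_descending] at h
  simp only [descending, List.getElem_reverse, getElem_ascending, length_ascending]
  congr 1
  omega

lemma strand_eq_letterStrand (n : ℕ) (w : BraidWord) (i : ℕ) {s : ℕ} (hs : s < w.length) {t : ℝ}
    (h0 : (s : ℝ) ≤ t) (h1 : t ≤ s + 1) :
    strand n w i t = letterStrand n w[s] (perm (w.take s) i) (t - s) := by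
  induction s generalizing w i t with
  | zero =>
    cases w with
    | nil => simp at hs
    | cons g w =>
      rw [strand_cons_of_le _ _ _ _ (by simpa using h1)]
      simp [perm]
  | succ s ih =>
    cases w with
    | nil => simp at hs
    | cons g w =>
      push_cast at h0 h1
      have hs0 : (0 : ℝ) ≤ s := by positivity
      rw [strand_cons_of_ge _ _ _ _ (by linarith), ih w _ (by simpa using hs) (by linarith) (by linarith)]
      simp only [List.getElem_cons_succ, List.take_succ_cons, perm_cons]
      congr 1
      push_cast
      ring

/-- The position that `i` has reached after `s` letters of `descending a`. -/
def descPos (a s i : ℕ) : ℕ :=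
  if i = a + 1 then a + 1 - s else if a - s < i ∧ i ≤ a then i + 1 else i

lemma perm_take_descending {a s : ℕ} (hs : s ≤ a) (i : ℕ) :
    perm ((descending a).take s) i = descPos a s i := by
  induction s with
  | zero =>
    simp only [List.take_zero, perm, Equiv.Perm.one_apply, descPos]
    split_ifs <;> omega
  | succ s ih =>
    rw [List.take_succ_eq_append_getElem (by rw [length_descending]; omega), perm_append,
      ih (by omega), getElem_descending]
    simp only [perm, Equiv.Perm.coe_mul, Function.comp_apply, Equiv.Perm.one_apply,
      Equiv.swap_apply_def, descPos]
    split_ifs <;> omega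

lemma perm_descending (a i : ℕ) : perm (descending a) i = descPos a a i := by
  rw [← perm_take_descending le_rfl, List.take_of_length_le (length_descending a).le]

/-- The position that `i` has reached after `s` letters of `ascending b`. -/
def ascPos (s i : ℕ) : ℕ := if i = 1 then s + 1 else if 2 ≤ i ∧ i ≤ s + 1 then i - 1 else i

lemma perm_take_ascending {b s : ℕ} (hs : s ≤ b) (i : ℕ) :
    perm ((ascending b).take s) i = ascPos s i := by
  induction s with
  | zero =>
    simp only [List.take_zero, perm, Equiv.Perm.one_apply, ascPos]
    split_ifs <;> omega
  | succ s ih =>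
    rw [List.take_succ_eq_append_getElem (by rw [length_ascending]; omega), perm_append,
      ih (by omega), getElem_ascending]
    simp only [perm, Equiv.Perm.coe_mul, Function.comp_apply, Equiv.Perm.one_apply,
      Equiv.swap_apply_def, ascPos]
    split_ifs <;> omega

lemma perm_ascending (b i : ℕ) : perm (ascending b) i = ascPos b i := by
  rw [← perm_take_ascending le_rfl, List.take_of_length_le (length_ascending b).le]

/-- A block moves the position `a + 1` to `b` and shifts the positions `a + 2, …, b`. -/
lemma perm_blockWord {n a b i : ℕ} (h : a < b) (h0 : 1 ≤ i) (hn : i ≤ n) (hb : b ≤ n) :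
    perm (blockWord n a b) i = if i = a + 1 then b else if a + 1 < i ∧ i ≤ b then i - 1 else i := by
  rw [blockWord, perm_append, perm_cons, perm_descending, perm_ascending]
  simp only [Equiv.swap_apply_def, descPos, ascPos]
  split_ifs <;> omega

/-- The position that `i` has reached after `s` letters of the second half of a block. -/
def rightPos (a s i : ℕ) : ℕ :=
  if i = a + 1 then s + 1
  else if i ≤ a then (if i ≤ s then i else i + 1) else (if i ≤ s + 1 then i - 1 else i)

lemma ascPos_descPos {a s i : ℕ} (hi : 1 ≤ i) : ascPos s (descPos a a i) = rightPos a s i := by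
  unfold ascPos descPos rightPos
  split_ifs <;> omega

lemma strand_blockWord_left {n a b i : ℕ} {s : ℕ} (hs : s < a) {t : ℝ} (h0 : (s : ℝ) ≤ t)
    (h1 : t ≤ s + 1) : strand n (blockWord n a b) i t =
      letterStrand n (a - s, false) (descPos a s i) (t - s) := by
  have hs' : (s : ℝ) + 1 ≤ a := by exact_mod_cast hs
  have hs0 : (0 : ℝ) ≤ s := by positivity
  rw [blockWord, strand_append_of_le _ _ _ _ (by linarith) (by rw [length_descending]; linarith),
    strand_eq_letterStrand n _ i (by rwa [length_descending]) h0 h1, getElem_descending,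
    perm_take_descending hs.le]

/-- The idle letter exchanges the positions `n + 1` and `n + 2`, beyond all strands of the braid, so
the strands rest for this unit of time. -/
lemma strand_blockWord_turn {n a b i : ℕ} (hi0 : 1 ≤ i) (hi : i ≤ n) (ha : a < n) {t : ℝ} (h0 : (a : ℝ) ≤ t)
    (h1 : t ≤ a + 1) : strand n (blockWord n a b) i t = basePoint n (descPos a a i) := by
  have hp : descPos a a i ≤ n := by
    unfold descPos
    split_ifs <;> omega
  rw [blockWord, strand_append_of_ge _ _ _ _ (by rwa [length_descending]), length_descending,
    strand_cons_of_le _ _ _ _ (by linarith), perm_descending, letterStrand, if_neg]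
  dsimp only
  omega

lemma strand_blockWord_right {n a b i : ℕ} (hi0 : 1 ≤ i) (hi : i ≤ n) (ha : a < n) {s : ℕ}
    (hs : s + 1 < b) {t : ℝ} (h0 : (a : ℝ) + 1 + s ≤ t) (h1 : t ≤ a + 1 + s + 1) :
    strand n (blockWord n a b) i t =
      letterStrand n (s + 1, false) (rightPos a s i) (t - (a + 1 + s)) := by
  have hp : descPos a a i ≤ n := by
    unfold descPos
    split_ifs <;> omega
  have hs0 : (0 : ℝ) ≤ s := by positivity
  rw [blockWord, strand_append_of_ge _ _ _ _ (by rw [length_descending]; linarith),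
    length_descending, strand_cons_of_ge _ _ _ _ (by linarith), perm_descending,
    strand_eq_letterStrand n _ _ (s := s) (by rw [length_ascending]; omega) (by linarith)
      (by linarith), getElem_ascending, perm_take_ascending (by omega),
    Equiv.swap_apply_of_ne_of_ne (by dsimp only; omega) (by dsimp only; omega),
    ascPos_descPos hi0]
  congr 1
  ring

lemma descPos_ne {a s i j : ℕ} (hs : s ≤ a) (hij : i ≠ j) : descPos a s i ≠ descPos a s j := by
  rw [← perm_take_descending hs, ← perm_take_descending hs]
  exact (Equiv.injective _).ne hij

lemma rightPos_ne {a s i j : ℕ} (hi : 1 ≤ i) (hj : 1 ≤ j) (hij : i ≠ j) :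
    rightPos a s i ≠ rightPos a s j := by
  unfold rightPos
  split_ifs <;> omega

/-! ### Comparing a block with a motion along circles -/

/-- The properties of the comparison braid at time `t` of a block: the point `z i` starts at
position `i`. -/
structure IsBlockConfig (a b n : ℕ) (t : ℝ) (z : ℕ → ℂ) : Prop where
  inner : ∀ i, 1 ≤ i → i ≤ a → (z i).re = i ∧ (z i).im ≤ 0 ∧ (z i).im ^ 2 ≤ (a : ℝ) ^ 2 - (i : ℝ) ^ 2
  outer : ∀ i, b < i → i ≤ n → (z i).re = i
  mate : ∀ i, a + 1 < i → i ≤ b → (z i).re = i - clamp (t - (a + i - 1)) ∧ (z i).im ≤ 0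
  lead_left : t ≤ a → (z (a + 1)).re = a + 1 - t ∧ (z (a + 1)).im ≤ 0 ∧
    (z (a + 1)).im ^ 2 = (b : ℝ) ^ 2 - (a + 1 - t) ^ 2
  lead_turn : (a : ℝ) ≤ t → t ≤ a + 1 → (z (a + 1)).re ≤ 1
  lead_right : (a : ℝ) + 1 ≤ t → (z (a + 1)).re = t - a ∧ 0 ≤ (z (a + 1)).im ∧
    (z (a + 1)).im ^ 2 = (b : ℝ) ^ 2 - (t - a) ^ 2
  inj : ∀ i j, 1 ≤ i → i ≤ n → 1 ≤ j → j ≤ n → i ≠ j → z i ≠ z j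

lemma letterStrand_sub (n : ℕ) (g : ℕ × Bool) (i j : ℕ) (t : ℝ) :
    letterStrand n g i t - letterStrand n g j t =
      ((2 / (n + 1) : ℝ) : ℂ) * (letterPos g i t - letterPos g j t) := by
  rw [letterStrand_eq, letterStrand_eq]
  ring

lemma nonAntipodal_letter {n : ℕ} {g : ℕ × Bool} {i j : ℕ} {t : ℝ} {v : ℂ}
    (h : NonAntipodal (letterPos g i t - letterPos g j t) v) :
    NonAntipodal (letterStrand n g i t - letterStrand n g j t) v := by
  rw [letterStrand_sub]
  simpa using h.scale (scale_pos n) one_pos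

lemma nonAntipodal_letter_of_lt {n : ℕ} {g : ℕ × Bool} {i j : ℕ} (hij : i < j)
    (h : ¬(i = g.1 ∧ j = g.1 + 1)) {t : ℝ} {v : ℂ} (hv : v.re ≤ 0) (hv0 : v ≠ 0) :
    NonAntipodal (letterStrand n g i t - letterStrand n g j t) v := by
  apply nonAntipodal_letter
  apply NonAntipodal.of_re_neg _ hv hv0
  rw [Complex.sub_re]
  linarith [letterPos_re_lt hij h t]

/-- A clockwise exchange takes the left point above the right one, so the difference of left and
right point stays in the closed upper half plane. -/
lemma nonAntipodal_letter_crossing {n j : ℕ} {t : ℝ} (h0 : 0 ≤ t) (h1 : t ≤ 1) {v : ℂ}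
    (hv : 0 < v.im) :
    NonAntipodal (letterStrand n (j, false) j t - letterStrand n (j, false) (j + 1) t) v := by
  apply nonAntipodal_letter
  have h2 := letterPos_sub (j, false) t
  dsimp only at h2
  rw [h2]
  refine NonAntipodal.of_im_pos ?_ (neg_ne_zero.2 (letterPhase_ne_zero _ _)) hv
  rw [Complex.neg_im, letterPhase_im]
  have := Real.sin_nonneg_of_nonneg_of_le_pi (x := Real.pi * t) (by positivity)
    (mul_le_of_le_one_right Real.pi_pos.le h1)
  simpa using this

/-- Exchanging the two strands negates both differences, so it is enough to treat pairs in the order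
`P` of their current positions. -/
lemma nonAntipodal_symm {f z : ℕ → ℂ} {P : ℕ → ℕ} {n : ℕ}
    (h : ∀ i j, 1 ≤ i → i ≤ n → 1 ≤ j → j ≤ n → P i < P j → NonAntipodal (f i - f j) (z i - z j))
    {i j : ℕ} (hi : 1 ≤ i) (hi' : i ≤ n) (hj : 1 ≤ j) (hj' : j ≤ n) (hP : P i ≠ P j) :
    NonAntipodal (f i - f j) (z i - z j) := by
  rcases lt_or_gt_of_ne hP with h1 | h1
  · exact h i j hi hi' hj hj' h1
  · have := (h j i hj hj' hi hi' h1).neg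
    simpa using this

/-- The leader moves left along the outer circle, and each letter makes it pass below one inner
strand. All other pairs are ordered compatibly by real part in both braids. The inner strands of the
comparison braid stay put although the word pushes them one position to the right. -/
lemma IsBlockConfig.nonAntipodal_left {a b n : ℕ} {t : ℝ} {z : ℕ → ℂ} (hz : IsBlockConfig a b n t z)
    (hab : a < b) {s : ℕ} (hs : s < a) (h0 : (s : ℝ) ≤ t) (h1 : t ≤ s + 1)
    {i j : ℕ} (hi : 1 ≤ i) (hi' : i ≤ n) (hj : 1 ≤ j) (hj' : j ≤ n)
    (hP : descPos a s i < descPos a s j) :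
    NonAntipodal (strand n (blockWord n a b) i t - strand n (blockWord n a b) j t) (z i - z j) := by
  rw [strand_blockWord_left hs h0 h1, strand_blockWord_left hs h0 h1]
  have hs' : (s : ℝ) + 1 ≤ a := by exact_mod_cast hs
  have hij : i ≠ j := fun h => by rw [h] at hP; exact lt_irrefl _ hP
  have hne := sub_ne_zero.2 (hz.inj i j hi hi' hj hj' hij)
  have hlead := hz.lead_left (by linarith)
  have hre : ∀ k, 1 ≤ k → k ≤ n → k ≠ a + 1 → (z k).re = k := by
    intro k hk hk' hka
    rcases Nat.lt_or_ge b k with h | h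
    · exact hz.outer k h hk'
    rcases Nat.lt_or_ge (a + 1) k with h2 | h2
    · have h3 : (a : ℝ) + 1 + 1 ≤ k := by exact_mod_cast h2
      rw [(hz.mate k h2 h).1, clamp_of_nonpos (by linarith), sub_zero]
    · exact (hz.inner k hk (by omega)).1
  by_cases hc : i = a - s ∧ j = a + 1
  · obtain ⟨rfl, rfl⟩ := hc
    have e1 : descPos a s (a - s) = a - s := by
      unfold descPos
      split_ifs <;> omega
    have e2 : descPos a s (a + 1) = a - s + 1 := by
      unfold descPos
      split_ifs <;> omega
    rw [e1, e2]
    have hin := hz.inner (a - s) hi (by omega)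
    rw [Nat.cast_sub hs.le] at hin
    have hb : (a : ℝ) + 1 ≤ b := by exact_mod_cast hab
    have hs0 : (0 : ℝ) ≤ s := by positivity
    -- At the start of the letter both imaginary parts may be 0, so that moment is settled by real
    -- parts.
    rcases h0.eq_or_lt with h0 | h0
    · apply nonAntipodal_letter
      apply NonAntipodal.of_re_neg
      · have h2 := letterPos_sub (a - s, false) (t - s)
        dsimp only at h2
        rw [h2, Complex.neg_re, letterPhase_re, h0, sub_self, mul_zero, Real.cos_zero]
        norm_num
      · rw [Complex.sub_re, hin.1, hlead.1]
        linarith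
      · exact hne
    · apply nonAntipodal_letter_crossing (by linarith) (by linarith)
      rw [Complex.sub_im]
      -- Since `b ≥ a + 1`, this follows from `t (2a + 2 - t) > s (2a - s)` for `s < t ≤ s + 1`.
      have h3 : (z (a - s)).im ^ 2 < (z (a + 1)).im ^ 2 := by
        rw [hlead.2.2]
        refine hin.2.2.trans_lt ?_
        nlinarith
      nlinarith [hin.2.1, hlead.2.1]
  · have hlt : ¬(descPos a s i = a - s ∧ descPos a s j = a - s + 1) := by
      unfold descPos
      split_ifs <;> omega
    refine nonAntipodal_letter_of_lt hP hlt ?_ hne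
    rw [Complex.sub_re]
    by_cases hia : i = a + 1
    · rw [hia, hlead.1, hre j hj hj' (by omega)]
      have : a - s + 1 ≤ j := by
        unfold descPos at hP
        split_ifs at hP <;> omega
      have h2 : a + 1 ≤ j + s := by omega
      have h3 : (a : ℝ) + 1 ≤ j + s := by exact_mod_cast h2
      linarith
    by_cases hja : j = a + 1
    · rw [hja, hlead.1, hre i hi hi' hia]
      have : i + 1 ≤ a - s := by
        unfold descPos at hP
        split_ifs at hP <;> omega
      have h2 : i + s + 1 ≤ a := by omega
      have h3 : (i : ℝ) + s + 1 ≤ a := by exact_mod_cast h2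
      linarith
    · rw [hre i hi hi' hia, hre j hj hj' hja]
      have : i ≤ j := by
        unfold descPos at hP
        split_ifs at hP <;> omega
      have h3 : (i : ℝ) ≤ j := by exact_mod_cast this
      linarith

/-- The word rests with the leader at position 1, while in the comparison braid the leader turns
within real part at most 1. Hence it stays weakly to the left of every other point, in agreement
with the word. -/
lemma IsBlockConfig.nonAntipodal_turn {a b n : ℕ} {t : ℝ} {z : ℕ → ℂ} (hz : IsBlockConfig a b n t z)
    (hab : a < b) (hbn : b ≤ n) (h0 : (a : ℝ) ≤ t) (h1 : t ≤ a + 1)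
    {i j : ℕ} (hi : 1 ≤ i) (hi' : i ≤ n) (hj : 1 ≤ j) (hj' : j ≤ n)
    (hP : descPos a a i < descPos a a j) :
    NonAntipodal (strand n (blockWord n a b) i t - strand n (blockWord n a b) j t) (z i - z j) := by
  rw [strand_blockWord_turn hi hi' (by omega) h0 h1, strand_blockWord_turn hj hj' (by omega) h0 h1,
    ← letterStrand_zero n (0, true), ← letterStrand_zero n (0, true)]
  have hij : i ≠ j := fun h => by rw [h] at hP; exact lt_irrefl _ hP
  have hne := sub_ne_zero.2 (hz.inj i j hi hi' hj hj' hij)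
  have hlead := hz.lead_turn h0 h1
  have hre : ∀ k, 1 ≤ k → k ≤ n → k ≠ a + 1 → (z k).re = k := by
    intro k hk hk' hka
    rcases Nat.lt_or_ge b k with h | h
    · exact hz.outer k h hk'
    rcases Nat.lt_or_ge (a + 1) k with h2 | h2
    · have h3 : (a : ℝ) + 1 + 1 ≤ k := by exact_mod_cast h2
      rw [(hz.mate k h2 h).1, clamp_of_nonpos (by linarith), sub_zero]
    · exact (hz.inner k hk (by omega)).1
  refine nonAntipodal_letter_of_lt hP ?_ ?_ hne
  · rintro ⟨h, -⟩
    have h2 : 1 ≤ descPos a a i := by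
      unfold descPos
      split_ifs <;> omega
    dsimp only at h
    omega
  rw [Complex.sub_re]
  have hja : j ≠ a + 1 := by
    rintro rfl
    unfold descPos at hP
    split_ifs at hP <;> omega
  rw [hre j hj hj' hja]
  by_cases hia : i = a + 1
  · rw [hia]
    have h3 : (1 : ℝ) ≤ j := by exact_mod_cast hj
    linarith
  · rw [hre i hi hi' hia]
    have : i ≤ j := by
      unfold descPos at hP
      split_ifs at hP <;> omega
    have h3 : (i : ℝ) ≤ j := by exact_mod_cast this
    linarith

-- On the way back the leader is on the upper half circle, while the inner strands and the mates
-- have imaginary part at most 0, so every crossing is an overpass. Mates may be anywhere within one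
-- unit to the left of their starting position; the order by real part survives this.
set_option maxHeartbeats 800000 in
lemma IsBlockConfig.nonAntipodal_right {a b n : ℕ} {t : ℝ} {z : ℕ → ℂ} (hz : IsBlockConfig a b n t z)
    (hab : a < b) (hbn : b ≤ n) {s : ℕ} (hs : s + 1 < b) (h0 : (a : ℝ) + 1 + s ≤ t)
    (h1 : t ≤ a + 1 + s + 1) {i j : ℕ} (hi : 1 ≤ i) (hi' : i ≤ n) (hj : 1 ≤ j) (hj' : j ≤ n)
    (hP : rightPos a s i < rightPos a s j) :
    NonAntipodal (strand n (blockWord n a b) i t - strand n (blockWord n a b) j t) (z i - z j) := by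
  rw [strand_blockWord_right hi hi' (by omega) hs h0 h1, strand_blockWord_right hj hj' (by omega) hs h0 h1]
  have hs' : (s : ℝ) + 1 + 1 ≤ b := by exact_mod_cast hs
  have hs0 : (0 : ℝ) ≤ s := by positivity
  have hij : i ≠ j := fun h => by rw [h] at hP; exact lt_irrefl _ hP
  have hne := sub_ne_zero.2 (hz.inj i j hi hi' hj hj' hij)
  have hlead := hz.lead_right (by linarith)
  have hre : ∀ k, 1 ≤ k → k ≤ n → k ≠ a + 1 → (z k).re ≤ k ∧
      (k ≤ a ∨ b < k → (z k).re = k) ∧ (k : ℝ) - 1 ≤ (z k).re := by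
    intro k hk hk' hka
    rcases Nat.lt_or_ge b k with h | h
    · rw [hz.outer k h hk']
      exact ⟨le_rfl, fun _ => rfl, by linarith⟩
    rcases Nat.lt_or_ge (a + 1) k with h2 | h2
    · rw [(hz.mate k h2 h).1]
      have h3 := clamp_nonneg (t - (a + k - 1))
      have h4 := clamp_le_one (t - (a + k - 1))
      exact ⟨by linarith, fun h => by omega, by linarith⟩
    · rw [(hz.inner k hk (by omega)).1]
      exact ⟨le_rfl, fun _ => rfl, by linarith⟩
  by_cases hc : i = a + 1 ∧ rightPos a s j = s + 1 + 1
  · obtain ⟨rfl, hc⟩ := hc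
    have e1 : rightPos a s (a + 1) = s + 1 := by
      unfold rightPos
      split_ifs <;> omega
    rw [e1, hc]
    have hjb : j ≤ b := by
      unfold rightPos at hc
      split_ifs at hc <;> omega
    have hjim : (z j).im ≤ 0 := by
      rcases Nat.lt_or_ge (a + 1) j with h2 | h2
      · exact (hz.mate j h2 hjb).2
      · exact (hz.inner j hj (by omega)).2.1
    rcases (show t - a ≤ b by linarith).lt_or_eq with h2 | h2
    -- At the very end of the block the leader reaches the real axis and its height no longer
    -- decides; the exchange is then complete and the real parts do.
    · apply nonAntipodal_letter_crossing (by linarith) (by linarith)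
      rw [Complex.sub_im]
      have h3 : 0 < (z (a + 1)).im ^ 2 := by
        rw [hlead.2.2]
        nlinarith
      have h4 : 0 < (z (a + 1)).im := lt_of_le_of_ne hlead.2.1 fun h => by
        rw [← h] at h3
        norm_num at h3
      linarith
    · apply nonAntipodal_letter
      have ht : t - (a + 1 + s) = 1 := by linarith
      apply NonAntipodal.of_re_pos
      · have h3 := letterPos_sub (s + 1, false) (t - (a + 1 + s))
        dsimp only at h3
        rw [h3, Complex.neg_re, letterPhase_re, ht, mul_one, Real.cos_pi]
        norm_num
      · rw [Complex.sub_re, hlead.1]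
        have h3 : (j : ℝ) ≤ b := by exact_mod_cast hjb
        linarith [(hre j hj hj' hij.symm).1]
      · exact hne
  · have hlt : ¬(rightPos a s i = s + 1 ∧ rightPos a s j = s + 1 + 1) := by
      rintro ⟨h2, h3⟩
      refine hc ⟨?_, h3⟩
      unfold rightPos at h2
      split_ifs at h2 <;> omega
    refine nonAntipodal_letter_of_lt hP hlt ?_ hne
    rw [Complex.sub_re]
    by_cases hia : i = a + 1
    · subst hia
      rw [hlead.1]
      have h2 := hre j hj hj' hij.symm
      by_cases hjm : j ≤ a ∨ b < j
      · rw [h2.2.1 hjm]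
        have : s + 2 ≤ j := by
          unfold rightPos at hP hc
          split_ifs at hP hc <;> omega
        have h3 : (s : ℝ) + 2 ≤ j := by exact_mod_cast this
        linarith
      · have : s + 3 ≤ j := by
          unfold rightPos at hP hc
          split_ifs at hP hc <;> omega
        have h3 : (s : ℝ) + 3 ≤ j := by exact_mod_cast this
        linarith
    by_cases hja : j = a + 1
    · subst hja
      rw [hlead.1]
      have h2 := hre i hi hi' hij
      have : i ≤ s + 1 := by
        unfold rightPos at hP
        split_ifs at hP <;> omega
      have h3 : (i : ℝ) ≤ s + 1 := by exact_mod_cast this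
      linarith
    · have hlt : i < j := by
        unfold rightPos at hP
        split_ifs at hP <;> omega
      have hlt' : (i : ℝ) + 1 ≤ j := by exact_mod_cast hlt
      linarith [(hre i hi hi' hia).1, (hre j hj hj' hja).2.2]

/-- The comparison braid of a block is never antipodal to the braid of the word. -/
lemma IsBlockConfig.nonAntipodal {a b n : ℕ} {t : ℝ} {z : ℕ → ℂ} (hz : IsBlockConfig a b n t z)
    (hab : a < b) (hbn : b ≤ n) (h0 : 0 ≤ t) (h1 : t ≤ a + b)
    {i j : ℕ} (hi : 1 ≤ i) (hi' : i ≤ n) (hj : 1 ≤ j) (hj' : j ≤ n) (hij : i ≠ j) :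
    NonAntipodal (strand n (blockWord n a b) i t - strand n (blockWord n a b) j t) (z i - z j) := by
  have hab' : (a : ℝ) + 1 ≤ b := by exact_mod_cast hab
  rcases lt_or_ge t a with h | h
  · have hs : ⌊t⌋₊ < a := (Nat.floor_lt h0).2 h
    refine nonAntipodal_symm (f := fun i => strand n (blockWord n a b) i t) (P := descPos a ⌊t⌋₊)
      (fun i j hi hi' hj hj' hP => hz.nonAntipodal_left hab hs (Nat.floor_le h0)
        (Nat.lt_floor_add_one t).le hi hi' hj hj' hP) hi hi' hj hj' (descPos_ne hs.le hij)
  rcases le_or_gt t (a + 1) with h' | h'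
  · refine nonAntipodal_symm (f := fun i => strand n (blockWord n a b) i t) (P := descPos a a)
      (fun i j hi hi' hj hj' hP => hz.nonAntipodal_turn hab hbn h h' hi hi' hj hj' hP)
      hi hi' hj hj' (descPos_ne le_rfl hij)
  -- The ceiling minus one is used instead of the floor so that the final time `a + b` belongs to
  -- the last letter.
  · obtain ⟨s, hs, hs0, hs1⟩ : ∃ s : ℕ, s + 1 < b ∧ (a : ℝ) + 1 + s ≤ t ∧ t ≤ a + 1 + s + 1 := by
      have hp : 0 < ⌈t - (a + 1)⌉₊ := Nat.ceil_pos.2 (by linarith)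
      obtain ⟨s, hs⟩ : ∃ s, ⌈t - (a + 1)⌉₊ = s + 1 := ⟨_, (Nat.succ_pred_eq_of_pos hp).symm⟩
      have h2 := Nat.le_ceil (t - (a + 1))
      have h3 := Nat.ceil_lt_add_one (show 0 ≤ t - (a + 1) by linarith)
      rw [hs] at h2 h3
      push_cast at h2 h3
      refine ⟨s, ?_, by linarith, by linarith⟩
      have : ((s + 1 : ℕ) : ℝ) < b := by push_cast; linarith
      exact_mod_cast this
    refine nonAntipodal_symm (f := fun i => strand n (blockWord n a b) i t)
      (P := fun i => rightPos a s i)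
      (fun i j hi hi' hj hj' hP => hz.nonAntipodal_right hab hbn hs hs0 hs1 hi hi' hj hj' hP)
      hi hi' hj hj' (rightPos_ne hi hj hij)

end BraidWord

end

end Stst

namespace Stst

noncomputable section

open Filter Topology Set

open BraidWord

/-! ### Layered braids -/

/-- A decomposition of the positions `1, …, bound 0` into layers: the layer `l` consists of the
positions `bound (l + 1) + 1, …, bound l`. -/
structure Layering where
  /-- The last position of a layer. -/
  bound : ℕ → ℕ
  anti : Antitone bound
  /-- The number of layers. -/
  depth : ℕ
  bound_depth : bound depth = 0

namespace Layering

variable (Λ : Layering)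

/-- The number of strands in a layer. -/
def slots (l : ℕ) : ℕ := Λ.bound l - Λ.bound (l + 1)

lemma bound_eq (l : ℕ) : Λ.bound l = Λ.bound (l + 1) + Λ.slots l := by
  have := Λ.anti (Nat.le_succ l)
  simp only [slots, Nat.succ_eq_add_one] at *
  omega

/-- The position of the slot with number `m ∈ ℤ` of the layer `l`. -/
def pos (l : ℕ) (m : ℤ) : ℕ := Λ.bound (l + 1) + 1 + (m % Λ.slots l).toNat

variable {Λ}

lemma pos_slot {l r : ℕ} (hr : r < Λ.slots l) (e : ℤ) :
    Λ.pos l (e * Λ.slots l + r) = Λ.bound (l + 1) + 1 + r := by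
  rw [pos, emod_slot hr, Int.toNat_natCast]

lemma pos_add (l : ℕ) (m k : ℤ) : Λ.pos l (m + k * Λ.slots l) = Λ.pos l m := by
  rw [pos, pos, Int.add_mul_emod_self_right]

lemma pos_mem {l : ℕ} (h : 0 < Λ.slots l) (m : ℤ) :
    Λ.bound (l + 1) < Λ.pos l m ∧ Λ.pos l m ≤ Λ.bound l := by
  obtain ⟨e, r, hr, rfl⟩ := exists_slot h m
  rw [pos_slot hr, Λ.bound_eq l]
  omega

lemma pos_range {l : ℕ} (h : 0 < Λ.slots l) (m : ℤ) :
    1 ≤ Λ.pos l m ∧ Λ.pos l m ≤ Λ.bound 0 := by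
  have h1 := pos_mem h m
  have h2 := Λ.anti (Nat.zero_le l)
  omega

lemma layer_eq {l l' i : ℕ} (h1 : Λ.bound (l + 1) < i) (h2 : i ≤ Λ.bound l)
    (h1' : Λ.bound (l' + 1) < i) (h2' : i ≤ Λ.bound l') : l = l' := by
  rcases lt_trichotomy l l' with h | h | h
  · have := Λ.anti (show l + 1 ≤ l' from h)
    omega
  · exact h
  · have := Λ.anti (show l' + 1 ≤ l from h)
    omega

lemma exists_label {i : ℕ} (h1 : 1 ≤ i) (h2 : i ≤ Λ.bound 0) :
    ∃ l r : ℕ, r < Λ.slots l ∧ Λ.pos l r = i := by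
  have hex : ∃ l, Λ.bound (l + 1) < i := by
    refine ⟨Λ.depth, ?_⟩
    have := Λ.anti (Nat.le_succ Λ.depth)
    have := Λ.bound_depth
    simp only [Nat.succ_eq_add_one] at *
    omega
  have hl := Nat.find_spec hex
  have hle : i ≤ Λ.bound (Nat.find hex) := by
    rcases Nat.eq_zero_or_pos (Nat.find hex) with h0 | h0
    · rwa [h0]
    · have := Nat.find_min hex (m := Nat.find hex - 1) (by omega)
      rw [Nat.sub_add_cancel h0] at this
      omega
  set l := Nat.find hex
  have hb := Λ.bound_eq l
  have hr : i - Λ.bound (l + 1) - 1 < Λ.slots l := by omega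
  refine ⟨l, i - Λ.bound (l + 1) - 1, hr, ?_⟩
  have := pos_slot hr 0
  rw [zero_mul, zero_add] at this
  rw [this]
  omega

lemma label_unique {l l' : ℕ} (h : 0 < Λ.slots l) (h' : 0 < Λ.slots l') {m m' : ℤ}
    (hp : Λ.pos l m = Λ.pos l' m') : l = l' ∧ ∃ k : ℤ, m' = m + k * Λ.slots l := by
  have h1 := pos_mem h m
  have h2 := pos_mem h' m'
  rw [← hp] at h2
  obtain rfl := layer_eq h1.1 h1.2 h2.1 h2.2
  refine ⟨rfl, ?_⟩
  obtain ⟨e, r, hr, rfl⟩ := exists_slot h m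
  obtain ⟨e', r', hr', rfl⟩ := exists_slot h m'
  rw [pos_slot hr, pos_slot hr'] at hp
  obtain rfl : r = r' := by omega
  exact ⟨e' - e, by ring⟩

/-- Points on concentric circles that are given by increasing sequences of angles are distinct. -/
lemma pos_eq_of_circlePoint_eq {R : ℕ → ℝ} {V : ℕ → ℤ → ℝ} {l l' : ℕ}
    (hR : 0 ≤ R l) (hR' : 0 ≤ R l') (hne : l ≠ l' → R l ≠ R l') (h0 : R l = 0 → Λ.slots l = 1)
    (hmono : StrictMono (V l))
    (hper : ∀ m k : ℤ, V l (m + k * Λ.slots l) = V l m + 2 * Real.pi * k) {m m' : ℤ}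
    (h : circlePoint (R l) (V l m) = circlePoint (R l') (V l' m')) : Λ.pos l m = Λ.pos l' m' := by
  have hn := congrArg norm h
  rw [norm_circlePoint hR, norm_circlePoint hR'] at hn
  obtain rfl : l = l' := by
    by_contra hl
    exact hne hl hn
  rcases hR.eq_or_lt with hR | hR
  -- On a circle of radius 0 angles carry no information, but there the layer has one slot only.
  · rw [pos, pos, h0 hR.symm, Nat.cast_one, Int.emod_one, Int.emod_one]
  · rw [circlePoint, circlePoint, mul_right_inj' (Complex.ofReal_ne_zero.2 hR.ne'),
      Complex.exp_eq_exp_iff_exists_int] at h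
    obtain ⟨k, hk⟩ := h
    -- Equal points have angles that differ by full turns, and a full turn is a shift of the label
    -- by the number of slots.
    have h1 : V l m = V l (m' + k * Λ.slots l) := by
      rw [hper]
      have h2 := congrArg Complex.im hk
      simp at h2
      linarith
    rw [hmono.injective h1, pos_add]

/-! ### Signed blocks acting on a layering -/

variable (Λ)

/-- The word of a signed block. -/
def stepWord (x : ℕ × Bool) : BraidWord :=
  if x.2 then blockWord (Λ.bound 0) (Λ.bound (x.1 + 1)) (Λ.bound x.1)
  else (blockWord (Λ.bound 0) (Λ.bound (x.1 + 1)) (Λ.bound x.1)).inverse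

/-- The duration of a signed block. -/
def stepLen (x : ℕ × Bool) : ℝ := 2 * Λ.bound (x.1 + 1) + Λ.slots x.1

/-- The number of slots by which a signed block moves the layer `l` backwards. -/
def stepShift (x : ℕ × Bool) (l : ℕ) : ℤ := if x.1 = l then (if x.2 then 1 else -1) else 0

/-- The angle during a signed block of the strand that starts in slot `m` of the layer `l`. -/
def stepAngle (x : ℕ × Bool) (l : ℕ) (m : ℤ) (t : ℝ) : ℝ :=
  if x.1 = l then
    if x.2 then blockAngle (Λ.bound (l + 1)) (Λ.slots l) m t
    -- The forward block takes slot `m + 1` to slot `m`; read backwards, this is the strand that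
    -- starts in slot `m`.
    else blockAngle (Λ.bound (l + 1)) (Λ.slots l) (m + 1) (Λ.stepLen x - t)
  else slotAngle (Λ.bound (l + 1)) (Λ.slots l) m

/-- The point of the comparison braid on the concentric circles. -/
def point (l : ℕ) (v : ℝ) : ℂ := circlePoint (Λ.bound l) v

variable {Λ}

lemma stepLen_nonneg (x : ℕ × Bool) : 0 ≤ Λ.stepLen x := by
  unfold stepLen
  positivity

lemma stepWord_length {x : ℕ × Bool} (hx : 0 < Λ.slots x.1) :
    ((Λ.stepWord x).length : ℝ) = Λ.stepLen x := by
  have h : Λ.bound (x.1 + 1) < Λ.bound x.1 := by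
    rw [Λ.bound_eq x.1]
    omega
  have h2 : (Λ.stepWord x).length = Λ.bound (x.1 + 1) + Λ.bound x.1 := by
    unfold stepWord
    split_ifs
    · exact length_blockWord _ h
    · rw [length_inverse, length_blockWord _ h]
  rw [h2, stepLen, Λ.bound_eq x.1]
  push_cast
  ring

lemma stepAngle_zero {x : ℕ × Bool} {l : ℕ} (hl : 0 < Λ.slots l) (m : ℤ) :
    Λ.stepAngle x l m 0 = slotAngle (Λ.bound (l + 1)) (Λ.slots l) m := by
  unfold stepAngle
  split_ifs with h1 h2
  · exact blockAngle_zero hl m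
  · rw [sub_zero, stepLen, h1, blockAngle_end hl, add_sub_cancel_right]
  · rfl

lemma stepAngle_end {x : ℕ × Bool} {l : ℕ} (hl : 0 < Λ.slots l) (m : ℤ) :
    Λ.stepAngle x l m (Λ.stepLen x) =
      slotAngle (Λ.bound (l + 1)) (Λ.slots l) (m - stepShift x l) := by
  unfold stepAngle stepShift
  split_ifs with h1 h2
  · rw [stepLen, h1, blockAngle_end hl]
  · rw [sub_self, blockAngle_zero hl, sub_neg_eq_add]
  · rw [sub_zero]

lemma continuous_stepAngle (x : ℕ × Bool) (l : ℕ) (m : ℤ) : Continuous (Λ.stepAngle x l m) := by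
  unfold stepAngle
  have h := continuous_blockAngle (Λ.bound (l + 1)) (Λ.slots l)
  split_ifs
  · exact h m
  · exact (h (m + 1)).comp (by fun_prop)
  · exact continuous_const

lemma stepAngle_add {x : ℕ × Bool} {l : ℕ} (hl : 0 < Λ.slots l) (m k : ℤ) (t : ℝ) :
    Λ.stepAngle x l (m + k * Λ.slots l) t = Λ.stepAngle x l m t + 2 * Real.pi * k := by
  unfold stepAngle
  split_ifs
  · exact blockAngle_add hl m k
  · rw [show m + k * Λ.slots l + 1 = m + 1 + k * Λ.slots l by ring]
    exact blockAngle_add hl _ k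
  · exact slotAngle_add hl m k

lemma strictMono_stepAngle {x : ℕ × Bool} {l : ℕ} (hl : 0 < Λ.slots l) {t : ℝ} (h0 : 0 ≤ t)
    (h1 : t ≤ Λ.stepLen x) : StrictMono fun m => Λ.stepAngle x l m t := by
  unfold stepAngle
  split_ifs with h2 h3
  · refine strictMono_blockAngle hl h0 ?_
    rwa [stepLen, h2] at h1
  · have h4 := strictMono_blockAngle (a := Λ.bound (l + 1)) (t := Λ.stepLen x - t) hl
      (by linarith) (by rw [stepLen, h2]; linarith)
    exact h4.comp (add_left_strictMono (a := (1 : ℤ)))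
  · exact strictMono_slotAngle hl

/-- The last position of a nonempty layer belongs to that layer, and layers are disjoint. Thus
distinct nonempty layers lie on circles of different radii. -/
lemma slots_eq_of_bound {l l' : ℕ} (hl : 0 < Λ.slots l) (hl' : 0 < Λ.slots l') (h : l ≠ l') :
    (Λ.bound l : ℝ) ≠ Λ.bound l' := by
  intro h1
  have h1 : Λ.bound l = Λ.bound l' := by exact_mod_cast h1
  have h2 := Λ.bound_eq l
  have h3 := Λ.bound_eq l'
  exact h (layer_eq (i := Λ.bound l) (by omega) le_rfl (by omega) (by omega))

lemma point_ne {V : ℕ → ℤ → ℝ} {l l' : ℕ} (hl : 0 < Λ.slots l) (hl' : 0 < Λ.slots l')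
    (hmono : StrictMono (V l))
    (hper : ∀ m k : ℤ, V l (m + k * Λ.slots l) = V l m + 2 * Real.pi * k) {m m' : ℤ}
    (h : Λ.pos l m ≠ Λ.pos l' m') : Λ.point l (V l m) ≠ Λ.point l' (V l' m') := by
  intro h1
  refine h (pos_eq_of_circlePoint_eq (R := fun l => (Λ.bound l : ℝ)) (V := V) (by positivity)
    (by positivity) (slots_eq_of_bound hl hl') ?_ hmono hper h1)
  intro h2
  have h3 := Λ.bound_eq l
  have h4 : Λ.bound l = 0 := by exact_mod_cast h2
  omega

lemma perm_block_pos {x l : ℕ} (hx : 0 < Λ.slots x) (hl : 0 < Λ.slots l) (m : ℤ) :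
    perm (blockWord (Λ.bound 0) (Λ.bound (x + 1)) (Λ.bound x)) (Λ.pos l m) =
      Λ.pos l (m - if x = l then 1 else 0) := by
  have hb := Λ.bound_eq x
  have hrg := pos_range hl m
  have hm := pos_mem hl m
  rw [perm_blockWord (by omega) hrg.1 hrg.2 (Λ.anti (Nat.zero_le x))]
  by_cases h : x = l
  · subst h
    rw [if_pos rfl]
    obtain ⟨e, r, hr, rfl⟩ := exists_slot hl m
    rw [pos_slot hr]
    rcases Nat.eq_zero_or_pos r with rfl | h0
    · have h1 : (e * Λ.slots x + (0 : ℕ) - 1 : ℤ) = (e - 1) * Λ.slots x + (Λ.slots x - 1 : ℕ) := by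
        rw [Nat.cast_sub hl]
        push_cast
        ring
      rw [h1, pos_slot (by omega), if_pos rfl]
      omega
    · have h1 : (e * Λ.slots x + r - 1 : ℤ) = e * Λ.slots x + (r - 1 : ℕ) := by
        rw [Nat.cast_sub h0]
        push_cast
        ring
      rw [h1, pos_slot (by omega), if_neg (by omega), if_pos (by omega)]
      omega
  · rw [if_neg h, sub_zero]
    have h1 : ¬(Λ.bound (x + 1) < Λ.pos l m ∧ Λ.pos l m ≤ Λ.bound x) := fun h2 =>
      h (layer_eq h2.1 h2.2 hm.1 hm.2)
    rw [if_neg (by omega), if_neg (by omega)]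

lemma perm_stepWord_pos {x : ℕ × Bool} {l : ℕ} (hx : 0 < Λ.slots x.1) (hl : 0 < Λ.slots l)
    (m : ℤ) : perm (Λ.stepWord x) (Λ.pos l m) = Λ.pos l (m - stepShift x l) := by
  unfold stepWord stepShift
  cases hx2 : x.2
  -- The inverse block undoes the forward block applied to the slot one step ahead.
  · have h := perm_block_pos hx hl (m + if x.1 = l then 1 else 0)
    rw [add_sub_cancel_right] at h
    simp only [Bool.false_eq_true, if_false]
    rw [← h, perm_inverse_perm]
    split_ifs <;> simp
  · simp only [if_true]
    exact perm_block_pos hx hl m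

/-- A representative label of a position. -/
lemma exists_config (z : ℕ → ℤ → ℂ)
    (hz : ∀ l, 0 < Λ.slots l → ∀ m k : ℤ, z l (m + k * Λ.slots l) = z l m) :
    ∃ Z : ℕ → ℂ, ∀ l, 0 < Λ.slots l → ∀ m, Z (Λ.pos l m) = z l m := by
  classical
  refine ⟨fun i => if h : ∃ p : ℕ × ℤ, 0 < Λ.slots p.1 ∧ Λ.pos p.1 p.2 = i then
    z h.choose.1 h.choose.2 else 0, ?_⟩
  intro l hl m
  have h : ∃ p : ℕ × ℤ, 0 < Λ.slots p.1 ∧ Λ.pos p.1 p.2 = Λ.pos l m := ⟨(l, m), hl, rfl⟩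
  simp only
  rw [dif_pos h]
  obtain ⟨h1, h2⟩ := h.choose_spec
  set p := h.choose
  obtain ⟨h3, k, h4⟩ := label_unique h1 hl h2
  rw [h4, h3, hz l hl]

lemma point_lowerAngle {l r : ℕ} (hr : r < Λ.slots l) {x : ℝ} (h0 : 0 ≤ x)
    (h1 : x ≤ Λ.bound l) (e : ℤ) :
    (Λ.point l (2 * Real.pi * e + lowerAngle (Λ.bound l) x)).re = x ∧
    (Λ.point l (2 * Real.pi * e + lowerAngle (Λ.bound l) x)).im ≤ 0 ∧
    (Λ.point l (2 * Real.pi * e + lowerAngle (Λ.bound l) x)).im ^ 2 =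
      (Λ.bound l : ℝ) ^ 2 - x ^ 2 := by
  have hb : 0 < Λ.bound l := by
    rw [Λ.bound_eq l]
    omega
  rw [point, add_comm, circlePoint_add_two_pi]
  exact circlePoint_lowerAngle (by exact_mod_cast hb) h0 h1

end Layering

end

end Stst

/-! ### Words of blocks against motions of the layers -/

namespace Stst

noncomputable section

open Filter Topology Set

open BraidWord

namespace Layering

variable {Λ : Layering}

lemma point_slotAngle_re {l : ℕ} (hl : 0 < Λ.slots l) (m : ℤ) :
    (Λ.point l (slotAngle (Λ.bound (l + 1)) (Λ.slots l) m)).re = Λ.pos l m := by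
  obtain ⟨e, r, hr, rfl⟩ := exists_slot hl m
  have hb : (Λ.bound l : ℝ) = Λ.bound (l + 1) + Λ.slots l := by exact_mod_cast Λ.bound_eq l
  have hr' : (r : ℝ) + 1 ≤ Λ.slots l := by exact_mod_cast hr
  rw [slotAngle_slot hr, pos_slot hr, ← hb]
  rw [(point_lowerAngle hr (by positivity) (by linarith) e).1]
  push_cast
  ring

/-- The resting layers sit on their lower half circles above their positions' real parts. Those
inside the moving layer have radius at most `Λ.bound (x + 1)`, which gives the height bound in
`inner`; the moving layer follows `leadAngle` and `mateAngle`. -/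
lemma isBlockConfig {x : ℕ} (hx : 0 < Λ.slots x) {t : ℝ} (h0 : 0 ≤ t)
    (h1 : t ≤ Λ.stepLen (x, true)) {Z : ℕ → ℂ}
    (hZ : ∀ l, 0 < Λ.slots l → ∀ m, Z (Λ.pos l m) = Λ.point l (Λ.stepAngle (x, true) l m t)) :
    IsBlockConfig (Λ.bound (x + 1)) (Λ.bound x) (Λ.bound 0) t Z := by
  have hb := Λ.bound_eq x
  have hbR : (Λ.bound x : ℝ) = Λ.bound (x + 1) + Λ.slots x := by exact_mod_cast hb
  have hq : (1 : ℝ) ≤ Λ.slots x := by exact_mod_cast hx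
  have ha : (0 : ℝ) ≤ Λ.bound (x + 1) := by positivity
  rw [stepLen] at h1
  dsimp only at h1
  have still : ∀ i, 1 ≤ i → i ≤ Λ.bound 0 → (i ≤ Λ.bound (x + 1) ∨ Λ.bound x < i) →
      ∃ l, Λ.bound (l + 1) < i ∧ i ≤ Λ.bound l ∧ (Z i).re = i ∧ (Z i).im ≤ 0 ∧
        (Z i).im ^ 2 = (Λ.bound l : ℝ) ^ 2 - (i : ℝ) ^ 2 := by
    intro i hi hi' hix
    obtain ⟨l, r, hr, rfl⟩ := exists_label hi hi'
    have hl : 0 < Λ.slots l := by omega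
    have hm := pos_mem hl r
    refine ⟨l, hm.1, hm.2, ?_⟩
    have hxl : x ≠ l := by
      rintro rfl
      omega
    have hp := pos_slot hr 0
    rw [zero_mul, zero_add] at hp
    have hm2 : (Λ.pos l r : ℝ) ≤ Λ.bound l := by exact_mod_cast hm.2
    have h2 : Λ.stepAngle (x, true) l r t =
        2 * Real.pi * (0 : ℤ) + lowerAngle (Λ.bound l) (Λ.pos l r) := by
      rw [stepAngle, if_neg hxl]
      have := slotAngle_slot (a := Λ.bound (l + 1)) hr 0
      rw [zero_mul, zero_add] at this
      rw [this, hp, Λ.bound_eq l]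
      push_cast
      rfl
    rw [hZ l hl, h2]
    exact point_lowerAngle hr (by positivity) hm2 0
  have layer : ∀ r : ℕ, r < Λ.slots x → Z (Λ.bound (x + 1) + 1 + r) =
      Λ.point x (blockAngle (Λ.bound (x + 1)) (Λ.slots x) r t) := by
    intro r hr
    have hp := pos_slot hr 0
    rw [zero_mul, zero_add] at hp
    rw [← hp, hZ x hx, stepAngle, if_pos rfl, if_pos rfl]
  have lead : Z (Λ.bound (x + 1) + 1) =
      Λ.point x (2 * Real.pi * (0 : ℤ) + leadAngle (Λ.bound (x + 1)) (Λ.bound x) t) := by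
    have h2 := blockAngle_lead (a := Λ.bound (x + 1)) (t := t) hx 0
    rw [zero_mul, ← hb] at h2
    rw [← h2]
    exact layer 0 hx
  refine ⟨?_, ?_, ?_, ?_, ?_, ?_, ?_⟩
  · intro i hi hi'
    have h2 := Λ.anti (Nat.zero_le x)
    obtain ⟨l, hl1, hl2, hre, him, hsq⟩ := still i hi (by omega) (Or.inl hi')
    refine ⟨hre, him, ?_⟩
    rw [hsq]
    have h3 : Λ.bound l ≤ Λ.bound (x + 1) := by
      apply Λ.anti
      by_contra h4
      have := Λ.anti (show l + 1 ≤ x + 1 by omega)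
      omega
    have h4 : (Λ.bound l : ℝ) ≤ Λ.bound (x + 1) := by exact_mod_cast h3
    have h5 : (0 : ℝ) ≤ Λ.bound l := by positivity
    nlinarith
  · intro i hi hi'
    obtain ⟨l, -, -, hre, -⟩ := still i (by omega) hi' (Or.inr hi)
    exact hre
  · intro i hi hi'
    obtain ⟨r, rfl⟩ := Nat.exists_eq_add_of_lt hi
    have hr : r + 1 < Λ.slots x := by omega
    have h2 := blockAngle_mate (a := Λ.bound (x + 1)) (t := t) (Nat.succ_ne_zero r) hr 0
    rw [zero_mul, zero_add, ← hb] at h2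
    have h3 := layer (r + 1) hr
    rw [h2, mateAngle] at h3
    have h4 : ((r + 1 : ℕ) : ℝ) + 1 ≤ Λ.slots x := by exact_mod_cast hr
    have h5 := clamp_nonneg (t - (2 * Λ.bound (x + 1) + (r + 1 : ℕ)))
    have h6 := clamp_le_one (t - (2 * Λ.bound (x + 1) + (r + 1 : ℕ)))
    have h7 : (0 : ℝ) ≤ r := by positivity
    have h8 := point_lowerAngle hr
      (x := Λ.bound (x + 1) + 1 + (r + 1 : ℕ) - clamp (t - (2 * Λ.bound (x + 1) + (r + 1 : ℕ))))
      (by linarith) (by linarith) 0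
    rw [← h3] at h8
    rw [show Λ.bound (x + 1) + 1 + r + 1 = Λ.bound (x + 1) + 1 + (r + 1) by ring]
    refine ⟨?_, h8.2.1⟩
    rw [h8.1]
    push_cast
    congr 2
    ring
  · intro ht
    rw [leadAngle_of_le ht] at lead
    rw [lead]
    exact point_lowerAngle hx (by linarith) (by linarith) 0
  · intro ht0 ht1
    rw [lead, leadAngle_of_mem ht0 ht1, point, add_comm, circlePoint_add_two_pi, circlePoint_re]
    have hb1 : (1 : ℝ) ≤ Λ.bound x := by linarith
    have hb0 : (0 : ℝ) < Λ.bound x := by linarith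
    set β := lowerAngle (Λ.bound x) 1
    have hβ0 : β ≤ 0 := lowerAngle_nonpos _ _
    have hβ1 : -Real.pi ≤ β := neg_pi_le_lowerAngle _ _
    have hcos : (Λ.bound x : ℝ) * Real.cos β = 1 := by
      rw [← circlePoint_re]
      exact (circlePoint_lowerAngle hb0 zero_le_one hb1).1
    set τ := t - Λ.bound (x + 1)
    have hτ0 : 0 ≤ τ := by simp only [τ]; linarith
    have hτ1 : τ ≤ 1 := by simp only [τ]; linarith
    rw [← hcos]
    refine mul_le_mul_of_nonneg_left ?_ hb0.le
    have e1 : 0 ≤ (2 * Real.pi + 2 * β) * τ := mul_nonneg (by linarith) hτ0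
    have e2 : (2 * Real.pi + 2 * β) * τ ≤ 2 * Real.pi + 2 * β :=
      mul_le_of_le_one_right (by linarith) hτ1
    set y := (2 * Real.pi + 2 * β) * τ
    -- The turning arc runs between the two points of the circle with real part 1 through its left
    -- end, so its angles are at least as far from the multiples of `2π` as `β` is.
    rcases le_total (y - β) Real.pi with h | h
    · rw [← Real.cos_neg, ← Real.cos_neg β]
      exact Real.cos_le_cos_of_nonneg_of_le_pi (by linarith) (by linarith) (by linarith)
    · rw [← Real.cos_add_two_pi, ← Real.cos_neg β]
      exact Real.cos_le_cos_of_nonneg_of_le_pi (by linarith) (by linarith) (by linarith)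
  · intro ht
    rw [leadAngle_of_ge ht, point, show 2 * Real.pi * ((0 : ℤ) : ℝ) +
      (-lowerAngle (Λ.bound x) (t - Λ.bound (x + 1)) - 2 * Real.pi) =
      -lowerAngle (Λ.bound x) (t - Λ.bound (x + 1)) + 2 * Real.pi * (-1 : ℤ) by push_cast; ring,
      circlePoint_add_two_pi] at lead
    have h2 := circlePoint_neg (Λ.bound x) (lowerAngle (Λ.bound x) (t - Λ.bound (x + 1)))
    have h3 := circlePoint_lowerAngle (b := Λ.bound x) (x := t - Λ.bound (x + 1)) (by linarith)
      (by linarith) (by linarith)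
    rw [lead, h2.1, h2.2, neg_sq]
    exact ⟨h3.1, by linarith [h3.2.1], h3.2.2⟩
  · intro i j hi hi' hj hj' hij
    obtain ⟨l, r, hr, rfl⟩ := exists_label hi hi'
    obtain ⟨l', r', hr', rfl⟩ := exists_label hj hj'
    rw [hZ l (by omega), hZ l' (by omega)]
    refine point_ne (V := fun l m => Λ.stepAngle (x, true) l m t) (by omega) (by omega)
      (strictMono_stepAngle (by omega) h0 h1) (fun m k => stepAngle_add (by omega) m k t) hij

lemma nonAntipodal_block {x : ℕ} (hx : 0 < Λ.slots x) {t : ℝ} (h0 : 0 ≤ t)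
    (h1 : t ≤ Λ.stepLen (x, true)) {l l' : ℕ} (hl : 0 < Λ.slots l) (hl' : 0 < Λ.slots l')
    {m m' : ℤ} (hne : Λ.pos l m ≠ Λ.pos l' m') :
    NonAntipodal
      (strand (Λ.bound 0) (Λ.stepWord (x, true)) (Λ.pos l m) t -
        strand (Λ.bound 0) (Λ.stepWord (x, true)) (Λ.pos l' m') t)
      (Λ.point l (Λ.stepAngle (x, true) l m t) - Λ.point l' (Λ.stepAngle (x, true) l' m' t)) := by
  obtain ⟨Z, hZ⟩ := exists_config (fun l m => Λ.point l (Λ.stepAngle (x, true) l m t))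
    (fun l hl m k => by
      rw [stepAngle_add hl, point, circlePoint_add_two_pi, point])
  have h := isBlockConfig hx h0 h1 hZ
  have hr := pos_range hl m
  have hr' := pos_range hl' m'
  rw [← hZ l hl, ← hZ l' hl']
  have hb := Λ.bound_eq x
  rw [stepWord, if_pos rfl]
  refine h.nonAntipodal (by omega) (Λ.anti (Nat.zero_le x)) h0 ?_ hr.1 hr.2 hr'.1 hr'.2 hne
  rw [stepLen] at h1
  rw [hb]
  push_cast
  dsimp only at h1
  linarith

/-- A negative block is a positive one run backwards, in the word as well as on the circles, so the
comparison at time `t` is that of the positive block at the complementary time. -/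
lemma nonAntipodal_step {x : ℕ × Bool} (hx : 0 < Λ.slots x.1) {t : ℝ} (h0 : 0 ≤ t)
    (h1 : t ≤ Λ.stepLen x) {l l' : ℕ} (hl : 0 < Λ.slots l) (hl' : 0 < Λ.slots l')
    {m m' : ℤ} (hne : Λ.pos l m ≠ Λ.pos l' m') :
    NonAntipodal
      (strand (Λ.bound 0) (Λ.stepWord x) (Λ.pos l m) t -
        strand (Λ.bound 0) (Λ.stepWord x) (Λ.pos l' m') t)
      (Λ.point l (Λ.stepAngle x l m t) - Λ.point l' (Λ.stepAngle x l' m' t)) := by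
  obtain ⟨x, b⟩ := x
  cases b
  · have key : ∀ {l : ℕ} (_ : 0 < Λ.slots l) (m : ℤ),
        perm (Λ.stepWord (x, true)) (Λ.pos l (m + if x = l then 1 else 0)) = Λ.pos l m ∧
        strand (Λ.bound 0) (Λ.stepWord (x, false)) (Λ.pos l m) t =
          strand (Λ.bound 0) (Λ.stepWord (x, true)) (Λ.pos l (m + if x = l then 1 else 0))
            (Λ.stepLen (x, true) - t) ∧
        Λ.stepAngle (x, false) l m t =
          Λ.stepAngle (x, true) l (m + if x = l then 1 else 0) (Λ.stepLen (x, true) - t) := by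
      intro l hl m
      have hp : perm (Λ.stepWord (x, true)) (Λ.pos l (m + if x = l then 1 else 0)) =
          Λ.pos l m := by
        rw [perm_stepWord_pos (x := (x, true)) hx hl]
        congr 1
        simp only [stepShift, if_true, add_sub_cancel_right]
      refine ⟨hp, ?_, ?_⟩
      · have e : Λ.stepWord (x, false) = (Λ.stepWord (x, true)).inverse := rfl
        rw [← hp, e, strand_inverse _ _ _ h0 (by rw [stepWord_length (x := (x, true)) hx]; exact h1),
          stepWord_length (x := (x, true)) hx]
      · simp only [stepAngle]
        split_ifs <;> simp_all [stepLen]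
    obtain ⟨p1, s1, a1⟩ := key hl m
    obtain ⟨p2, s2, a2⟩ := key hl' m'
    rw [s1, s2, a1, a2]
    have e : Λ.stepLen (x, true) = Λ.stepLen (x, false) := rfl
    refine nonAntipodal_block hx (by linarith) (by linarith) hl hl' ?_
    intro h
    exact hne (by rw [← p1, ← p2, h])
  · exact nonAntipodal_block hx h0 h1 hl hl' hne

/-! ### Sequences of blocks -/

variable (Λ)

/-- The word of a list of signed blocks. -/
def word (L : List (ℕ × Bool)) : BraidWord := L.flatMap Λ.stepWord

/-- The number of slots by which a list of blocks moves the layer `l` backwards. -/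
def shift : List (ℕ × Bool) → ℕ → ℤ
  | [], _ => 0
  | x :: L, l => stepShift x l + shift L l

/-- The duration of a list of blocks. -/
def len : List (ℕ × Bool) → ℝ
  | [] => 0
  | x :: L => Λ.stepLen x + len L

/-- The angle during a list of blocks of the strand that starts in slot `m` of the layer `l`. -/
def angle : List (ℕ × Bool) → ℕ → ℤ → ℝ → ℝ
  | [], l, m, _ => slotAngle (Λ.bound (l + 1)) (Λ.slots l) m
  | x :: L, l, m, t =>
      if t ≤ Λ.stepLen x then Λ.stepAngle x l m t
      else angle L l (m - stepShift x l) (t - Λ.stepLen x)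

variable {Λ} {L : List (ℕ × Bool)}

lemma len_nonneg (L : List (ℕ × Bool)) : 0 ≤ Λ.len L := by
  induction L with
  | nil => exact le_rfl
  | cons x L ih => exact add_nonneg (stepLen_nonneg x) ih

lemma angle_zero {l : ℕ} (hl : 0 < Λ.slots l) (m : ℤ) :
    Λ.angle L l m 0 = slotAngle (Λ.bound (l + 1)) (Λ.slots l) m := by
  cases L with
  | nil => rfl
  | cons x L => rw [angle, if_pos (stepLen_nonneg x), stepAngle_zero hl]

lemma angle_cons_of_ge {x : ℕ × Bool} {l : ℕ} (hl : 0 < Λ.slots l) (m : ℤ) {t : ℝ}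
    (h : Λ.stepLen x ≤ t) :
    Λ.angle (x :: L) l m t = Λ.angle L l (m - stepShift x l) (t - Λ.stepLen x) := by
  rcases h.eq_or_lt with rfl | h
  · rw [angle, if_pos le_rfl, stepAngle_end hl, sub_self, angle_zero hl]
  · rw [angle, if_neg (by linarith)]

lemma continuous_angle {l : ℕ} (hl : 0 < Λ.slots l) (m : ℤ) : Continuous (Λ.angle L l m) := by
  induction L generalizing m with
  | nil => exact continuous_const
  | cons x L ih =>
    refine Continuous.if_le (continuous_stepAngle x l m) ((ih _).comp (by fun_prop))
      continuous_id continuous_const ?_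
    rintro t ht
    rw [show t = _ from ht, stepAngle_end hl, sub_self, angle_zero hl]

lemma angle_len {l : ℕ} (hl : 0 < Λ.slots l) (m : ℤ) : Λ.angle L l m (Λ.len L) =
    slotAngle (Λ.bound (l + 1)) (Λ.slots l) (m - shift L l) := by
  induction L generalizing m with
  | nil => rw [angle, shift, sub_zero]
  | cons x L ih =>
    have := len_nonneg (Λ := Λ) L
    rw [len, angle_cons_of_ge hl _ (by linarith), add_sub_cancel_left, ih, shift]
    congr 1
    ring

lemma angle_add {l : ℕ} (hl : 0 < Λ.slots l) (m k : ℤ) (t : ℝ) :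
    Λ.angle L l (m + k * Λ.slots l) t = Λ.angle L l m t + 2 * Real.pi * k := by
  induction L generalizing m t with
  | nil => exact slotAngle_add hl m k
  | cons x L ih =>
    rw [angle, angle]
    split_ifs
    · exact stepAngle_add hl m k t
    · rw [show m + k * Λ.slots l - stepShift x l = m - stepShift x l + k * Λ.slots l by ring, ih]

lemma strictMono_angle {l : ℕ} (hl : 0 < Λ.slots l) {t : ℝ} (h0 : 0 ≤ t) :
    StrictMono fun m => Λ.angle L l m t := by
  induction L generalizing t with
  | nil => exact strictMono_slotAngle hl
  | cons x L ih =>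
    simp only [angle]
    split_ifs with h
    · exact strictMono_stepAngle hl h0 h
    · have h2 := ih (t := t - Λ.stepLen x) (by linarith)
      intro m m' hm
      exact h2 (by linarith : m - stepShift x l < m' - stepShift x l)

lemma word_length (hL : ∀ x ∈ L, 0 < Λ.slots x.1) : ((Λ.word L).length : ℝ) = Λ.len L := by
  induction L with
  | nil => simp [word, len]
  | cons x L ih =>
    have h1 := stepWord_length (hL x List.mem_cons_self)
    have h2 := ih fun y hy => hL y (List.mem_cons_of_mem _ hy)
    rw [len, ← h1, ← h2, word, List.flatMap_cons, List.length_append, Nat.cast_add]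
    rfl

lemma perm_word_pos (hL : ∀ x ∈ L, 0 < Λ.slots x.1) {l : ℕ} (hl : 0 < Λ.slots l) (m : ℤ) :
    perm (Λ.word L) (Λ.pos l m) = Λ.pos l (m - shift L l) := by
  induction L generalizing m with
  | nil => simp [word, perm, shift]
  | cons x L ih =>
    rw [word, List.flatMap_cons, perm_append, perm_stepWord_pos (hL x List.mem_cons_self) hl, ← word,
      ih fun y hy => hL y (List.mem_cons_of_mem _ hy), shift]
    congr 1
    ring

/-- The comparison braid is never antipodal to the braid of the word. -/
lemma nonAntipodal_word (hL : ∀ x ∈ L, 0 < Λ.slots x.1) {t : ℝ} (h0 : 0 ≤ t) {l l' : ℕ}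
    (hl : 0 < Λ.slots l) (hl' : 0 < Λ.slots l') {m m' : ℤ} (hne : Λ.pos l m ≠ Λ.pos l' m')
    (h1 : t ≤ Λ.len L) :
    NonAntipodal
      (strand (Λ.bound 0) (Λ.word L) (Λ.pos l m) t - strand (Λ.bound 0) (Λ.word L) (Λ.pos l' m') t)
      (Λ.point l (Λ.angle L l m t) - Λ.point l' (Λ.angle L l' m' t)) := by
  induction L generalizing m m' t with
  | nil =>
    rw [angle, angle, word, List.flatMap_nil, strand_nil, strand_nil]
    -- When nothing moves, both configurations are ordered along the real axis by the positions.
    have hz : Λ.point l (slotAngle (Λ.bound (l + 1)) (Λ.slots l) m) -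
        Λ.point l' (slotAngle (Λ.bound (l' + 1)) (Λ.slots l') m') ≠ 0 :=
      sub_ne_zero.2 (point_ne (V := fun l m => slotAngle (Λ.bound (l + 1)) (Λ.slots l) m) hl hl'
        (strictMono_slotAngle hl) (fun m k => slotAngle_add hl m k) hne)
    have hb : ∀ i j : ℕ, (basePoint (Λ.bound 0) i - basePoint (Λ.bound 0) j).re =
        2 / (Λ.bound 0 + 1) * ((i : ℝ) - j) := by
      intro i j
      rw [basePoint_eq, basePoint_eq, add_sub_add_left_eq_sub, ← mul_sub, Complex.re_ofReal_mul]
      simp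
    have hc := scale_pos (Λ.bound 0)
    rcases lt_or_gt_of_ne hne with h | h
    · have h : (Λ.pos l m : ℝ) < Λ.pos l' m' := by exact_mod_cast h
      refine NonAntipodal.of_re_neg ?_ ?_ hz
      · rw [hb]
        exact mul_neg_of_pos_of_neg hc (by linarith)
      · rw [Complex.sub_re, point_slotAngle_re hl, point_slotAngle_re hl']
        linarith
    · have h : (Λ.pos l' m' : ℝ) < Λ.pos l m := by exact_mod_cast h
      refine NonAntipodal.of_re_pos ?_ ?_ hz
      · rw [hb]
        exact mul_pos hc (by linarith)
      · rw [Complex.sub_re, point_slotAngle_re hl, point_slotAngle_re hl']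
        linarith
  | cons x L ih =>
    have hx := hL x List.mem_cons_self
    rw [word, List.flatMap_cons, ← word]
    rcases le_total t (Λ.stepLen x) with h | h
    · rw [strand_append_of_le _ _ _ _ h0 (by rwa [stepWord_length hx]),
        strand_append_of_le _ _ _ _ h0 (by rwa [stepWord_length hx]),
        angle, angle, if_pos h, if_pos h]
      exact nonAntipodal_step hx h0 h hl hl' hne
    · rw [strand_append_of_ge _ _ _ _ (by rwa [stepWord_length hx]),
        strand_append_of_ge _ _ _ _ (by rwa [stepWord_length hx]), angle_cons_of_ge hl _ h,
        angle_cons_of_ge hl' _ h, perm_stepWord_pos hx hl, perm_stepWord_pos hx hl',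
        stepWord_length hx]
      rw [len] at h1
      refine ih (fun y hy => hL y (List.mem_cons_of_mem _ hy)) (by linarith) ?_ (by linarith)
      rw [← perm_stepWord_pos hx hl, ← perm_stepWord_pos hx hl']
      exact (Equiv.injective _).ne hne

end Layering

end

end Stst

/-! ### Closures of words and rotations at constant speed -/

namespace Stst

noncomputable section

open Filter Topology Set

open BraidWord

lemma zpow_semiconj {α β : Type*} {e : α → β} {σ : Equiv.Perm α} {τ : Equiv.Perm β}
    (h : ∀ a, e (σ a) = τ (e a)) (k : ℤ) (a : α) : e ((σ ^ k) a) = (τ ^ k) (e a) := by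
  induction k generalizing a with
  | zero => rfl
  | succ k ih => rw [zpow_add_one, zpow_add_one, Equiv.Perm.mul_apply, Equiv.Perm.mul_apply, ih, h]
  | pred k ih =>
    rw [zpow_sub_one, zpow_sub_one, Equiv.Perm.mul_apply, Equiv.Perm.mul_apply, ih]
    congr 1
    rw [Equiv.Perm.eq_inv_iff_eq, ← h, ← Equiv.Perm.mul_apply, mul_inv_cancel, Equiv.Perm.one_apply]

namespace BraidWord

/-- The closure of a braid as a link that follows the strands. -/
lemma closureSolid_eq_closeUp {n : ℕ} {w : BraidWord} {π : Equiv.Perm (Fin n)}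
    (hπ : ∀ i, ((π i : ℕ) + 1) = perm w (i + 1)) :
    closureSolid n w = closeUp π fun i x => strand n w (i + 1) ((w.length + 1) * x) := by
  refine congrArg Set.range (funext fun i => funext fun t => ?_)
  rw [← zpow_semiconj (e := fun i : Fin n => (i : ℕ) + 1) hπ]

lemma Admissible.exists_perm {n : ℕ} {w : BraidWord} (hw : w.Admissible n) :
    ∃ π : Equiv.Perm (Fin n), ∀ i, ((π i : ℕ) + 1) = perm w (i + 1) := by
  have h : ∀ i : Fin n, ∃ j : Fin n, (j : ℕ) + 1 = perm w (i + 1) := by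
    intro i
    have := hw.perm_mem (i := i + 1) (by omega) (by omega)
    exact ⟨⟨perm w (i + 1) - 1, by omega⟩, by dsimp only; omega⟩
  choose f hf using h
  have hinj : Function.Injective f := by
    intro i j hij
    have h1 := hf i
    rw [hij, hf j] at h1
    have h2 := (perm w).injective h1
    exact Fin.ext (by omega)
  exact ⟨Equiv.ofBijective f (Finite.injective_iff_bijective.1 hinj), hf⟩

/-- Idle letters do not change the closure of a braid. -/
lemma Admissible.closure_active {n : ℕ} {w : BraidWord} (hw : w.Admissible n)
    {π : Equiv.Perm (Fin n)} (hπ : ∀ i, ((π i : ℕ) + 1) = perm w (i + 1)) :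
    AmbientIsotopic (closeUp π fun i x => strand n w (i + 1) (w.length * x)).toLink
      (closure n (w.active n)) := by
  obtain ⟨θ, hc, h0, hp, hl, hs⟩ := hw.exists_reparam
  have hπ' : ∀ i, ((π i : ℕ) + 1) = perm (w.active n) (i + 1) := by
    intro i
    rw [hπ i]
    -- Both words bring the strand to the same final point, and base points are distinct, so the
    -- permutations agree on these positions.
    have h1 := hs (i + 1) (by omega) (by omega) w.length
    rw [strand_of_length_le _ _ _ le_rfl, strand_of_length_le _ _ _ (hl _ le_rfl).ge] at h1
    by_contra h
    exact basePoint_ne n h h1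
  have hw' : (w.active n).Admissible n := fun g hg => hw g (List.mem_of_mem_filter hg)
  rw [closure, closureSolid_eq_closeUp hπ']
  -- Strands are disjoint at every common time, so the two clocks can be interpolated linearly. At
  -- the end of a turn both clocks have reached the end of the word, which keeps the strands closed
  -- up.
  have h := closeUp_ambientIsotopic π (fun i p => strand n (w.active n) (i + 1)
    ((1 - p.1) * θ (w.length * p.2) + p.1 * (((w.active n).length + 1) * p.2))) ?_ ?_ ?_ ?_
  · convert h using 5 with i x i x
    · rw [hs _ (by omega) (by omega)]
      congr 1
      ring
    · congr 1
      ring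
  · intro i
    refine ((continuous_strand n (w.active n) (i + 1)).comp ?_).continuousOn
    exact ((continuous_const.sub continuous_fst).mul (hc.comp (by fun_prop))).add (by fun_prop)
  · intro s _ x _ i j hij
    refine strand_ne n _ ?_ _
    have := Fin.val_ne_of_ne hij
    omega
  · intro s _ x _ i
    exact hw'.norm_strand_lt (by omega) (by omega) _
  · intro s hs i
    dsimp only
    rw [mul_one, mul_zero, mul_zero, mul_zero, h0, mul_zero, add_zero, strand_zero,
      strand_of_length_le, hπ']
    rw [hl _ le_rfl]
    have : (0 : ℝ) ≤ s := hs.1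
    linarith

end BraidWord

namespace Layering

variable {Λ : Layering} {L : List (ℕ × Bool)}

lemma ascending_mem {b : ℕ} {g : ℕ × Bool} (h : g ∈ ascending b) : 1 ≤ g.1 ∧ g.1 ≤ b := by
  simp only [ascending, List.mem_map, List.mem_range] at h
  obtain ⟨i, hi, rfl⟩ := h
  dsimp only
  omega

lemma descending_mem {b : ℕ} {g : ℕ × Bool} (h : g ∈ descending b) : 1 ≤ g.1 ∧ g.1 ≤ b :=
  ascending_mem (List.mem_reverse.1 h)

lemma inverse_mem {w : BraidWord} {g : ℕ × Bool} (h : g ∈ w.inverse) : ∃ g' ∈ w, g'.1 = g.1 := by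
  simp only [inverse, List.mem_map, List.mem_reverse] at h
  obtain ⟨g', h, rfl⟩ := h
  exact ⟨g', h, rfl⟩

lemma admissible_word (hL : ∀ x ∈ L, 0 < Λ.slots x.1) : (Λ.word L).Admissible (Λ.bound 0) := by
  intro g hg
  obtain ⟨x, hx, hg⟩ := List.mem_flatMap.1 hg
  obtain ⟨g', hg, h'⟩ : ∃ g' ∈ blockWord (Λ.bound 0) (Λ.bound (x.1 + 1)) (Λ.bound x.1),
      g'.1 = g.1 := by
    rw [stepWord] at hg
    split_ifs at hg
    · exact ⟨g, hg, rfl⟩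
    · exact inverse_mem hg
  rw [← h']
  have h1 := Λ.bound_eq x.1
  have h2 := Λ.anti (Nat.zero_le x.1)
  have h3 := hL x hx
  rw [blockWord, List.mem_append, List.mem_cons] at hg
  rcases hg with hg | rfl | hg
  · have := descending_mem hg
    omega
  · exact Or.inr rfl
  · have := ascending_mem hg
    omega

lemma perm_word_zpow_pos (hL : ∀ x ∈ L, 0 < Λ.slots x.1) {l : ℕ} (hl : 0 < Λ.slots l) (m k : ℤ) :
    ((Λ.word L).perm ^ k) (Λ.pos l m) = Λ.pos l (m - shift L l * k) := by
  induction k generalizing m with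
  | zero => simp
  | succ k ih =>
    rw [zpow_add_one, Equiv.Perm.mul_apply, perm_word_pos hL hl, ih]
    congr 1
    ring
  | pred k ih =>
    have h : (Λ.word L).perm⁻¹ (Λ.pos l m) = Λ.pos l (m + shift L l) := by
      rw [Equiv.Perm.inv_eq_iff_eq, perm_word_pos hL hl, add_sub_cancel_right]
    rw [zpow_sub_one, Equiv.Perm.mul_apply, h, ih]
    congr 1
    ring

/-- The link of torus links on concentric tori of radii `R l`. -/
def rotationLink (Λ : Layering) (L : List (ℕ × Bool)) (R : ℕ → ℝ) : SolidTorusLink :=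
  {γ | ∃ l m : ℕ, m < Λ.slots l ∧ γ = fun t =>
    (circlePoint (R l) (2 * Real.pi * (m - shift L l * t) / Λ.slots l), t)}

/-- The rotation of the layers by constant speed is isotopic to the closure of the word. -/
theorem rotationLink_ambientIsotopic (hL : ∀ x ∈ L, 0 < Λ.slots x.1) {R : ℕ → ℝ}
    (hR0 : ∀ l, 0 ≤ R l) (hR1 : ∀ l, R l < 2)
    (hR : ∀ l l', l < l' → 0 < Λ.slots l → 0 < Λ.slots l' → R l' < R l)
    (hRs : ∀ l, 0 < Λ.slots l → R l = 0 → Λ.slots l = 1) :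
    AmbientIsotopic (rotationLink Λ L R).toLink
      (closure (Λ.bound 0) ((Λ.word L).active (Λ.bound 0))) := by
  have hW := admissible_word hL
  obtain ⟨π, hπ⟩ := hW.exists_perm
  refine AmbientIsotopic.trans ?_ (hW.closure_active hπ)
  have hlab : ∀ i : Fin (Λ.bound 0), ∃ l r : ℕ, r < Λ.slots l ∧ Λ.pos l r = (i : ℕ) + 1 := by
    intro i
    exact exists_label (by omega) (by omega)
  choose lay slot hslot hpos using hlab
  have hsl : ∀ i, 0 < Λ.slots (lay i) := fun i => (Nat.zero_le _).trans_lt (hslot i)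
  have hn : (0 : ℝ) < Λ.bound 0 + 1 := by positivity
  -- After `k` turns a strand is in the same layer, and its slot has moved by `k` shifts, up to full
  -- rounds of the layer.
  have hzpow : ∀ i (k : ℤ), lay ((π ^ k) i) = lay i ∧ ∃ j : ℤ, (slot ((π ^ k) i) : ℤ) =
      slot i - shift L (lay i) * k + j * Λ.slots (lay i) := by
    intro i k
    have h1 : Λ.pos (lay i) (slot i - shift L (lay i) * k) =
        Λ.pos (lay ((π ^ k) i)) (slot ((π ^ k) i)) := by
      rw [← perm_word_zpow_pos hL (hsl i), hpos, hpos]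
      exact (zpow_semiconj (e := fun i : Fin (Λ.bound 0) => (i : ℕ) + 1) hπ k i).symm
    obtain ⟨h2, j, h3⟩ := label_unique (hsl i) (hsl _) h1
    exact ⟨h2.symm, j, h3⟩
  have hone : ∀ i, lay (π i) = lay i ∧ ∃ j : ℤ, (slot (π i) : ℤ) =
      slot i - shift L (lay i) + j * Λ.slots (lay i) := by
    intro i
    have := hzpow i 1
    rwa [zpow_one, mul_one] at this
  have hbound : ∀ i, 0 < Λ.bound (lay i) ∧ Λ.bound (lay i) ≤ Λ.bound 0 := by
    intro i
    have h1 := Λ.bound_eq (lay i)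
    have h2 := hsl i
    exact ⟨by omega, Λ.anti (Nat.zero_le _)⟩
  have hposne : ∀ i j, i ≠ j → Λ.pos (lay i) (slot i) ≠ Λ.pos (lay j) (slot j) := by
    intro i j hij h
    rw [hpos, hpos] at h
    exact hij (Fin.ext (by omega))
  have hρ0 : ∀ i, 0 < (Λ.bound (lay i) : ℝ) / (Λ.bound 0 + 1) := fun i =>
    div_pos (by exact_mod_cast (hbound i).1) hn
  have hρ1 : ∀ i, (Λ.bound (lay i) : ℝ) / (Λ.bound 0 + 1) < 1 := fun i => by
    rw [div_lt_one hn]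
    have : (Λ.bound (lay i) : ℝ) ≤ Λ.bound 0 := by exact_mod_cast (hbound i).2
    linarith
  -- the homotopy of the angles and the radii
  let V : ℝ → ℝ → ℕ → ℤ → ℝ := fun s x l m =>
    (1 - s) * (2 * Real.pi * (m - shift L l * x) / Λ.slots l) + s * Λ.angle L l m (Λ.len L * x)
  let ρ : ℝ → ℕ → ℝ := fun s l => (1 - s) * R l + s * (Λ.bound l / (Λ.bound 0 + 1))
  -- Convex combinations of strictly increasing angle sequences are strictly increasing, so points
  -- of one layer stay distinct during the homotopy.
  have hVmono : ∀ s ∈ Icc (0 : ℝ) 1, ∀ x ∈ Icc (0 : ℝ) 1, ∀ l, 0 < Λ.slots l →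
      StrictMono (V s x l) := by
    intro s hs x hx l hl m m' hm
    have h1 := strictMono_angle (L := L) hl (mul_nonneg (len_nonneg (Λ := Λ) L) hx.1) hm
    have hl' : (0 : ℝ) < Λ.slots l := by exact_mod_cast hl
    have hm' : (m : ℝ) < m' := by exact_mod_cast hm
    have h2 : 2 * Real.pi * (m - shift L l * x) / Λ.slots l <
        2 * Real.pi * (m' - shift L l * x) / Λ.slots l := by
      have := Real.pi_pos
      gcongr
    dsimp only at h1
    simp only [V]
    rcases hs.1.eq_or_lt with h | h
    · rw [← h]
      linarith
    · have h3 := mul_le_mul_of_nonneg_left h2.le (sub_nonneg.2 hs.2)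
      have h4 := mul_lt_mul_of_pos_left h1 h
      linarith
  have hVper : ∀ s x l, 0 < Λ.slots l → ∀ m k : ℤ,
      V s x l (m + k * Λ.slots l) = V s x l m + 2 * Real.pi * k := by
    intro s x l hl m k
    have hl' : (0 : ℝ) < Λ.slots l := by exact_mod_cast hl
    simp only [V, angle_add hl]
    push_cast
    field_simp
    ring
  -- The constant speed motion and the motion by blocks advance each layer by the same number of
  -- slots per turn, so every intermediate motion closes up with the same permutation.
  have hVend : ∀ s l, 0 < Λ.slots l → ∀ m : ℤ, V s 1 l m = V s 0 l (m - shift L l) := by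
    intro s l hl m
    simp only [V, mul_one, mul_zero, sub_zero, angle_len hl, angle_zero hl]
    push_cast
    ring
  have hclose : ∀ (r : ℕ → ℝ) s i, circlePoint (r (lay i)) (V s 1 (lay i) (slot i)) =
      circlePoint (r (lay (π i))) (V s 0 (lay (π i)) (slot (π i))) := by
    intro r s i
    obtain ⟨h1, j, h2⟩ := hone i
    rw [h1, h2, hVper _ _ _ (hsl i), circlePoint_add_two_pi, hVend _ _ (hsl i)]
  have H1 := closeUp_ambientIsotopic π
    (fun i p => circlePoint (ρ p.1 (lay i)) (V p.1 p.2 (lay i) (slot i))) ?_ ?_ ?_ ?_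
  rotate_left
  · intro i
    have h1 := continuous_angle (L := L) (hsl i) (slot i)
    have h2 : Continuous fun p : ℝ × ℝ => ρ p.1 (lay i) := by
      simp only [ρ]
      fun_prop
    have h3 : Continuous fun p : ℝ × ℝ => V p.1 p.2 (lay i) (slot i) := by
      simp only [V]
      exact Continuous.add (by fun_prop) (continuous_fst.mul (h1.comp (by fun_prop)))
    exact (continuous_circlePoint.comp (h2.prodMk h3)).continuousOn
  · intro s hs x hx i j hij h
    have hρnn : ∀ l, 0 ≤ ρ s l := fun l =>
      add_nonneg (mul_nonneg (sub_nonneg.2 hs.2) (hR0 l)) (mul_nonneg hs.1 (by positivity))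
    have hρlt : ∀ l l', l < l' → 0 < Λ.slots l → 0 < Λ.slots l' → ρ s l' < ρ s l := by
      intro l l' hll hl hl'
      have h1 := hR l l' hll hl hl'
      have h2 : (Λ.bound l' : ℝ) / (Λ.bound 0 + 1) < Λ.bound l / (Λ.bound 0 + 1) := by
        have h3 := Λ.anti (show l + 1 ≤ l' from hll)
        have h4 := Λ.bound_eq l
        have h5 : Λ.bound l' < Λ.bound l := by omega
        have h6 : (Λ.bound l' : ℝ) < Λ.bound l := by exact_mod_cast h5
        gcongr
      simp only [ρ]
      rcases hs.1.eq_or_lt with h | h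
      · rw [← h]
        linarith
      · have h3 := mul_le_mul_of_nonneg_left h1.le (sub_nonneg.2 hs.2)
        have h4 := mul_lt_mul_of_pos_left h2 h
        linarith
    refine hposne i j hij (pos_eq_of_circlePoint_eq (R := ρ s) (V := V s x) (hρnn _) (hρnn _) ?_ ?_
      (hVmono s hs x hx _ (hsl i)) (hVper s x _ (hsl i)) h)
    · intro hne
      rcases lt_or_gt_of_ne hne with h | h
      · exact (hρlt _ _ h (hsl i) (hsl j)).ne'
      · exact (hρlt _ _ h (hsl j) (hsl i)).ne
    -- The final radius is positive, so an intermediate radius can vanish only at the start, where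
    -- the assumption on `R` applies.
    · intro h0
      have h1 : 0 ≤ (1 - s) * R (lay i) := mul_nonneg (sub_nonneg.2 hs.2) (hR0 _)
      have h2 : 0 ≤ s * (Λ.bound (lay i) / (Λ.bound 0 + 1) : ℝ) := mul_nonneg hs.1 (hρ0 i).le
      have h3 : s * (Λ.bound (lay i) / (Λ.bound 0 + 1) : ℝ) = 0 := by
        simp only [ρ] at h0
        linarith
      have h4 : s = 0 := (mul_eq_zero.1 h3).resolve_right (hρ0 i).ne'
      refine hRs _ (hsl i) ?_
      simpa [ρ, h4] using h0
  · intro s hs x hx i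
    have h1 : 0 ≤ ρ s (lay i) :=
      add_nonneg (mul_nonneg (sub_nonneg.2 hs.2) (hR0 _)) (mul_nonneg hs.1 (by positivity))
    dsimp only
    rw [norm_circlePoint h1]
    simp only [ρ]
    have h2 := mul_le_mul_of_nonneg_left (hR1 (lay i)).le (sub_nonneg.2 hs.2)
    have h3 := mul_le_mul_of_nonneg_left (hρ1 i).le hs.1
    rcases hs.1.eq_or_lt with h | h
    · rw [← h]
      linarith [hR1 (lay i)]
    · linarith
  · intro s hs i
    exact hclose (ρ s) s i
  -- the straight homotopy to the braid of the word
  have H2 := closeUp_ambientIsotopic π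
    (fun i p => (1 - p.1 : ℝ) * circlePoint (ρ 1 (lay i)) (V 1 p.2 (lay i) (slot i)) +
      (p.1 : ℝ) * strand (Λ.bound 0) (Λ.word L) (i + 1) ((Λ.word L).length * p.2)) ?_ ?_ ?_ ?_
  rotate_left
  · intro i
    have h1 := continuous_angle (L := L) (hsl i) (slot i)
    have h2 := continuous_strand (Λ.bound 0) (Λ.word L) (i + 1)
    have h3 : Continuous fun p : ℝ × ℝ => circlePoint (ρ 1 (lay i)) (V 1 p.2 (lay i) (slot i)) := by
      have h4 : Continuous fun p : ℝ × ℝ => V 1 p.2 (lay i) (slot i) := by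
        simp only [V]
        exact Continuous.add (by fun_prop) (continuous_const.mul (h1.comp (by fun_prop)))
      exact continuous_circlePoint.comp (continuous_const.prodMk h4)
    refine Continuous.continuousOn (Continuous.add (Continuous.mul ?_ h3) (Continuous.mul ?_
      (h2.comp (by fun_prop)))) <;> fun_prop
  · intro s hs x hx i j hij h
    have hx' : Λ.len L * x ≤ Λ.len L := mul_le_of_le_one_right (len_nonneg L) hx.2
    have h1 := nonAntipodal_word hL (mul_nonneg (len_nonneg (Λ := Λ) L) hx.1) (hsl i) (hsl j)
      (hposne i j hij) hx'
    have h2 := h1.scale one_pos (inv_pos.2 hn)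
    -- A collision in the straight homotopy would make this nonnegative combination of the two
    -- difference vectors vanish. The translation by -1 in the base points cancels in differences,
    -- and positive rescaling is harmless.
    refine h2 s (1 - s) hs.1 (sub_nonneg.2 hs.2) (by linarith) ?_
    have e : ∀ i, circlePoint (ρ 1 (lay i)) (V 1 x (lay i) (slot i)) =
        (((Λ.bound 0 : ℝ) + 1)⁻¹ : ℝ) * Λ.point (lay i) (Λ.angle L (lay i) (slot i) (Λ.len L * x)) := by
      intro i
      simp only [ρ, V, point, circlePoint, sub_self, zero_mul, zero_add, one_mul]
      push_cast
      ring
    dsimp only at h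
    rw [e, e, word_length hL, ← hpos, ← hpos] at h
    rw [mul_sub]
    push_cast at h ⊢
    linear_combination h
  · intro s hs x hx i
    dsimp only
    have h1 : ‖circlePoint (ρ 1 (lay i)) (V 1 x (lay i) (slot i))‖ < 2 := by
      have e : ρ 1 (lay i) = Λ.bound (lay i) / (Λ.bound 0 + 1) := by simp [ρ]
      rw [e, norm_circlePoint (hρ0 i).le]
      linarith [hρ1 i]
    have h2 := hW.norm_strand_lt (i := i + 1) (by omega) (by omega) ((Λ.word L).length * x)
    refine (norm_add_le _ _).trans_lt ?_
    rw [norm_mul, norm_mul, Complex.norm_real, Complex.norm_real, Real.norm_of_nonneg hs.1,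
      Real.norm_of_nonneg (sub_nonneg.2 hs.2)]
    have h3 := mul_le_mul_of_nonneg_left h1.le (sub_nonneg.2 hs.2)
    have h4 := mul_le_mul_of_nonneg_left h2.le hs.1
    rcases hs.1.eq_or_lt with h | h
    · rw [← h]
      linarith
    · have h4 := mul_lt_mul_of_pos_left h2 h
      linarith
  · intro s hs i
    dsimp only
    rw [hclose, mul_one, mul_zero, strand_of_length_le _ _ _ le_rfl, strand_zero, hπ]
  -- The integer and fractional parts of `t` recombine: the label after `⌊t⌋` turns accounts for the
  -- whole turns, the fractional part for the rest, and full rounds of the layer do not change the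
  -- point.
  have e0 : (closeUp π fun i x => circlePoint (ρ 0 (lay i)) (V 0 x (lay i) (slot i))) =
      rotationLink Λ L R := by
    have hcurve : ∀ i t, circlePoint (ρ 0 (lay ((π ^ ⌊t⌋) i)))
        (V 0 (Int.fract t) (lay ((π ^ ⌊t⌋) i)) (slot ((π ^ ⌊t⌋) i))) =
        circlePoint (R (lay i))
          (2 * Real.pi * (slot i - shift L (lay i) * t) / Λ.slots (lay i)) := by
      intro i t
      obtain ⟨h1, j, h2⟩ := hzpow i ⌊t⌋
      rw [h1, h2, hVper _ _ _ (hsl i), circlePoint_add_two_pi]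
      simp only [ρ, V]
      congr 1
      · ring
      · push_cast
        rw [Int.fract]
        ring
    ext γ
    constructor
    · rintro ⟨i, rfl⟩
      refine ⟨lay i, slot i, hslot i, funext fun t => ?_⟩
      exact Prod.ext (hcurve i t) rfl
    · rintro ⟨l, m, hm, rfl⟩
      have hr := pos_range (Λ := Λ) (l := l) (by omega) m
      let i : Fin (Λ.bound 0) := ⟨Λ.pos l m - 1, by omega⟩
      refine ⟨i, funext fun t => ?_⟩
      have h1 : Λ.pos l m = Λ.pos (lay i) (slot i) := by
        rw [hpos]
        simp only [i]
        omega
      obtain ⟨h2, k, h3⟩ := label_unique (by omega) (hsl i) h1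
      refine Prod.ext ((hcurve i t).trans ?_) rfl
      have hl' : (0 : ℝ) < Λ.slots (lay i) := by exact_mod_cast hsl i
      rw [h2]
      have h4 : (slot i : ℝ) = m + k * Λ.slots (lay i) := by
        rw [← h2]
        exact_mod_cast h3
      rw [h4, show 2 * Real.pi * (m + k * Λ.slots (lay i) - shift L (lay i) * t) / Λ.slots (lay i) =
        2 * Real.pi * (m - shift L (lay i) * t) / Λ.slots (lay i) + 2 * Real.pi * k by
          field_simp; ring, circlePoint_add_two_pi]
  have e1 : (fun (i : Fin (Λ.bound 0)) (x : ℝ) => ((1 - 0 : ℝ) : ℂ) *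
      circlePoint (ρ 1 (lay i)) (V 1 x (lay i) (slot i)) +
      ((0 : ℝ) : ℂ) * strand (Λ.bound 0) (Λ.word L) (i + 1) ((Λ.word L).length * x)) =
      fun i x => circlePoint (ρ 1 (lay i)) (V 1 x (lay i) (slot i)) := by
    funext i x
    simp
  have e2 : (fun (i : Fin (Λ.bound 0)) (x : ℝ) => ((1 - 1 : ℝ) : ℂ) *
      circlePoint (ρ 1 (lay i)) (V 1 x (lay i) (slot i)) +
      ((1 : ℝ) : ℂ) * strand (Λ.bound 0) (Λ.word L) (i + 1) ((Λ.word L).length * x)) =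
      fun (i : Fin (Λ.bound 0)) (x : ℝ) =>
        strand (Λ.bound 0) (Λ.word L) (i + 1) ((Λ.word L).length * x) := by
    funext i x
    simp
  rw [← e0, ← e2]
  refine H1.trans ?_
  rw [← e1]
  exact H2

end Layering

end

end Stst

/-! ### Removing idle letters, and the word of a full turn of a layer -/

namespace Stst

noncomputable section

open BraidWord

namespace BraidWord

variable {n : ℕ}

lemma active_append (u v : BraidWord) : (u ++ v).active n = u.active n ++ v.active n := by
  simp [active]

lemma active_inverse (w : BraidWord) : w.inverse.active n = (w.active n).inverse := by
  simp [active, inverse, List.filter_map, Function.comp_def]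

lemma active_flatten (l : List BraidWord) :
    active n l.flatten = (l.map (active n)).flatten := by
  induction l with
  | nil => rfl
  | cons w l ih => rw [List.flatten_cons, active_append, ih, List.map_cons, List.flatten_cons]

/-- All genuine letters have index at most `n`, so filtering out the index `n + 1` deletes only the
idle letter. -/
lemma active_blockWord {a b : ℕ} (ha : a ≤ n) (hb : b ≤ n + 1) :
    (blockWord n a b).active n = descending a ++ ascending (b - 1) := by
  have h1 : (descending a).active n = descending a :=
    List.filter_eq_self.2 fun g hg => by
      have := Layering.descending_mem hg
      simp only [ne_eq, decide_eq_true_eq]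
      omega
  have h2 : (ascending (b - 1)).active n = ascending (b - 1) :=
    List.filter_eq_self.2 fun g hg => by
      have := Layering.ascending_mem hg
      simp only [ne_eq, decide_eq_true_eq]
      omega
  have h3 : active n ((n + 1, false) :: ascending (b - 1)) = (ascending (b - 1)).active n := by
    simp [active]
  rw [blockWord, active_append, h3, h1, h2]

lemma Admissible.inBraidGroup_active {w : BraidWord} (hw : w.Admissible n) :
    (w.active n).InBraidGroup n := by
  intro g hg
  have h1 := hw g (List.mem_of_mem_filter hg)
  have h2 := List.of_mem_filter hg
  simp only [ne_eq, decide_eq_true_eq] at h2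
  omega

end BraidWord

namespace Layering

variable {Λ : Layering}

/-- The signed blocks that turn the layer `l` by `p` slots. -/
def turn (l : ℕ) : ℤ → List (ℕ × Bool)
  | Int.ofNat m => List.replicate m (l, true)
  | Int.negSucc m => List.replicate (m + 1) (l, false)

lemma word_append (L L' : List (ℕ × Bool)) : Λ.word (L ++ L') = Λ.word L ++ Λ.word L' := by
  simp [word]

lemma word_replicate (x : ℕ × Bool) (m : ℕ) :
    Λ.word (List.replicate m x) = (List.replicate m (Λ.stepWord x)).flatten := by
  simp [word, List.flatMap_replicate]

/-- Deleting idle letters commutes with concatenation and inversion, so repeated signed blocks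
become an integer power of the block. -/
lemma active_word_turn (l : ℕ) (p : ℤ) : (Λ.word (turn l p)).active (Λ.bound 0) =
    power (descending (Λ.bound (l + 1)) ++ ascending (Λ.bound l - 1)) p := by
  have h := active_blockWord (Λ.anti (Nat.zero_le (l + 1))) (Nat.le_succ_of_le (Λ.anti (Nat.zero_le l)))
  cases p with
  | ofNat m =>
    rw [turn, word_replicate, active_flatten, List.map_replicate, stepWord, if_pos rfl, h, power]
  | negSucc m =>
    rw [turn, word_replicate, active_flatten, List.map_replicate, stepWord,
      if_neg Bool.false_ne_true, active_inverse, h, power]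

lemma active_word_flatten (L : List (List (ℕ × Bool))) :
    (Λ.word L.flatten).active (Λ.bound 0) =
      (L.map fun M => (Λ.word M).active (Λ.bound 0)).flatten := by
  induction L with
  | nil => rfl
  | cons M L ih => rw [List.flatten_cons, word_append, active_append, ih, List.map_cons,
      List.flatten_cons]

lemma shift_append (L L' : List (ℕ × Bool)) (l : ℕ) :
    shift (L ++ L') l = shift L l + shift L' l := by
  induction L with
  | nil => simp [shift]
  | cons x L ih => rw [List.cons_append, shift, shift, ih, add_assoc]

lemma shift_replicate (m : ℕ) (x : ℕ × Bool) (l : ℕ) :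
    shift (List.replicate m x) l = m * stepShift x l := by
  induction m with
  | zero => simp [shift]
  | succ m ih =>
    rw [List.replicate_succ, shift, ih]
    push_cast
    ring

lemma shift_turn (x : ℕ) (p : ℤ) (l : ℕ) : shift (turn x p) l = if x = l then p else 0 := by
  cases p with
  | ofNat m =>
    rw [turn, shift_replicate, stepShift]
    split_ifs <;> simp_all
  | negSucc m =>
    rw [turn, shift_replicate, stepShift]
    split_ifs
    · simp_all
    · rw [Int.negSucc_eq]
      push_cast
      ring
    · simp_all

lemma shift_flatten (L : List (List (ℕ × Bool))) (l : ℕ) :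
    shift L.flatten l = (L.map fun M => shift M l).sum := by
  induction L with
  | nil => rfl
  | cons M L ih => rw [List.flatten_cons, shift_append, ih, List.map_cons, List.sum_cons]

lemma mem_turn {l : ℕ} {p : ℤ} {x : ℕ × Bool} (h : x ∈ turn l p) : x.1 = l ∧ p ≠ 0 := by
  cases p with
  | ofNat m =>
    obtain ⟨h1, h2⟩ := List.mem_replicate.1 h
    rw [h2]
    exact ⟨rfl, by simpa using h1⟩
  | negSucc m =>
    obtain ⟨-, h2⟩ := List.mem_replicate.1 h
    rw [h2]
    exact ⟨rfl, by simp⟩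

end Layering

/-! ### The layers of a surgerized tst link -/

variable {k : ℕ} (c : Fin (k + 1) → Cut)

/-- The number of strands of the `l`-th torus link. -/
def layerSize (l : ℕ) : ℕ := if h : l < k + 1 then (c ⟨l, h⟩).S * (c ⟨l, h⟩).D else 0

lemma layerSize_fin (l : Fin (k + 1)) : layerSize c l = (c l).S * (c l).D := by
  rw [layerSize, dif_pos l.2]

/-- The layers of a surgerized tst link: its torus links, and innermost `o` copies of the core. -/
def ststLayering (o : ℕ) : Layering where
  -- All bounds up to index `k + 1` are raised by `o`, which makes room for the core as layer `k +
  -- 1` at the innermost positions.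
  bound l := ∑ j ∈ Finset.Ico l (k + 1), layerSize c j + if l ≤ k + 1 then o else 0
  anti l l' h := by
    apply add_le_add
    · exact Finset.sum_le_sum_of_subset (Finset.Ico_subset_Ico_left h)
    · split_ifs <;> omega
  depth := k + 2
  bound_depth := by simp

lemma ststLayering_bound_lt {o l : ℕ} (h : l ≤ k + 1) :
    (ststLayering c o).bound l = ∑ j ∈ Finset.Ico l (k + 1), layerSize c j + o := by
  simp [ststLayering, h]

lemma sum_Ico_layerSize (l : ℕ) : ∑ j ∈ Finset.Ico l (k + 1), layerSize c j =
    ∑ j ∈ Finset.univ.filter (fun j : Fin (k + 1) => l ≤ j), (c j).S * (c j).D := by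
  have h : Finset.Ico l (k + 1) = (Finset.range (k + 1)).filter fun j => l ≤ j := by
    ext j
    simp only [Finset.mem_Ico, Finset.mem_filter, Finset.mem_range]
    omega
  rw [h, Finset.sum_filter, Finset.sum_filter,
    ← Fin.sum_univ_eq_sum_range (fun j => if l ≤ j then layerSize c j else 0)]
  refine Finset.sum_congr rfl fun j _ => ?_
  rw [layerSize_fin]

lemma ststLayering_bound_fin (o : ℕ) (l : Fin (k + 1)) :
    (ststLayering c o).bound l = strandsFrom c l + o := by
  rw [ststLayering_bound_lt c (by omega), sum_Ico_layerSize]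
  rfl

lemma ststLayering_bound_succ (o : ℕ) (l : Fin (k + 1)) :
    (ststLayering c o).bound (l + 1) = strandsAfter c l + o := by
  rw [ststLayering_bound_lt c (by omega), sum_Ico_layerSize]
  rfl

lemma ststLayering_bound_zero (o : ℕ) : (ststLayering c o).bound 0 = totalStrands c + o := by
  rw [ststLayering_bound_lt c (by omega), sum_Ico_layerSize]
  simp [totalStrands]

lemma ststLayering_slots_fin (o : ℕ) (l : Fin (k + 1)) :
    (ststLayering c o).slots l = (c l).S * (c l).D := by
  rw [Layering.slots, ststLayering_bound_lt c (by omega), ststLayering_bound_lt c (by omega),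
    Finset.sum_eq_sum_Ico_succ_bot l.2, layerSize_fin]
  omega

lemma ststLayering_slots_core (o : ℕ) : (ststLayering c o).slots (k + 1) = o := by
  simp [Layering.slots, ststLayering]

lemma ststLayering_slots_gt {o l : ℕ} (h : k + 1 < l) : (ststLayering c o).slots l = 0 := by
  rw [Layering.slots, ststLayering]
  dsimp only
  rw [Finset.Ico_eq_empty_of_le (by omega), if_neg (by omega)]
  simp

/-- The signed blocks of a surgerized tst link. -/
def ststTurns : List (ℕ × Bool) :=
  (List.ofFn fun l : Fin (k + 1) => Layering.turn l ((c l).S * (c l).N)).flatten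

/-- Blocks are used only for nonzero exponents, and then the layer has points to rotate because the
denominator `D` is positive. -/
lemma Cut.slots_pos {c : Cut} (h : (c.S * c.N : ℤ) ≠ 0) : 0 < c.S * c.D := by
  have h1 : (c.S : ℤ) ≠ 0 := left_ne_zero_of_mul h
  have h2 : 0 < c.S := Nat.pos_of_ne_zero (by exact_mod_cast h1)
  exact Nat.mul_pos h2 c.τ.den_pos

lemma ststTurns_valid (o : ℕ) : ∀ x ∈ ststTurns c, 0 < (ststLayering c o).slots x.1 := by
  intro x hx
  obtain ⟨M, hM, hx⟩ := List.mem_flatten.1 hx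
  obtain ⟨l, rfl⟩ := List.mem_ofFn.1 hM
  obtain ⟨h1, h2⟩ := Layering.mem_turn hx
  rw [h1, ststLayering_slots_fin]
  exact Cut.slots_pos h2

lemma shift_ststTurns (l : ℕ) : Layering.shift (ststTurns c) l =
    ∑ j : Fin (k + 1), if (j : ℕ) = l then ((c j).S * (c j).N : ℤ) else 0 := by
  rw [ststTurns, Layering.shift_flatten, List.map_ofFn, List.sum_ofFn]
  exact Finset.sum_congr rfl fun j _ => Layering.shift_turn _ _ _

lemma shift_ststTurns_fin (l : Fin (k + 1)) :
    Layering.shift (ststTurns c) l = (c l).S * (c l).N := by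
  rw [shift_ststTurns, Finset.sum_eq_single l]
  · rw [if_pos rfl]
  · intro j _ hj
    rw [if_neg (Fin.val_ne_of_ne hj)]
  · simp

lemma active_word_ststTurns (o : ℕ) :
    ((ststLayering c o).word (ststTurns c)).active ((ststLayering c o).bound 0) =
      (List.ofFn fun l : Fin (k + 1) =>
        power (descending (strandsAfter c l + o) ++ ascending (strandsFrom c l + o - 1))
          ((c l).S * (c l).N)).flatten := by
  rw [ststTurns, Layering.active_word_flatten, List.map_ofFn]
  congr 2
  funext l
  simp only [Function.comp_apply]
  rw [Layering.active_word_turn, ststLayering_bound_succ, ststLayering_bound_fin]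

/-- The curve of a torus link on the torus of radius `r`. -/
lemma torusCurve_eq (r : ℝ) (p : ℤ) (q m : ℕ) (t : ℝ) :
    (r : ℂ) * Complex.exp (2 * Real.pi * Complex.I * (((-p : ℤ) * t + m) / q)) =
      circlePoint r (2 * Real.pi * (m - p * t) / q) := by
  rw [circlePoint]
  congr 2
  push_cast
  ring

/-- The components of a surgerized tst link. -/
lemma mem_ststSolid_iff (k : ℕ) (c : Fin (k + 1) → Cut) (γ : ℝ → TorusCoord) :
    γ ∈ ststSolid k c ↔
      (∃ (l : Fin (k + 1)) (m : ℕ), m < (c l).S * (c l).D ∧ γ = fun t =>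
        (circlePoint ((1 / 2) ^ (l : ℕ)) (2 * Real.pi * (m - ((c l).S * (c l).N : ℤ) * t) /
          ((c l).S * (c l).D : ℕ)), t)) ∨
      (Odd (c (Fin.last k)).M ∧ γ = coreCurve) := by
  have torus : ∀ (c : Cut) (γ : ℝ → TorusCoord), γ ∈ torusLink (-(c.S * c.N)) (c.S * c.D) ↔
      ∃ m : ℕ, m < c.S * c.D ∧ γ = fun t =>
        (circlePoint 1 (2 * Real.pi * (m - (c.S * c.N : ℤ) * t) / (c.S * c.D : ℕ)), t) := by
    intro c γ
    have e : ∀ m : ℕ, (fun t : ℝ => (Complex.exp (2 * Real.pi * Complex.I *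
        (((-(c.S * c.N) : ℤ) * t + m) / (c.S * c.D : ℕ))), t)) = fun t : ℝ =>
        (circlePoint 1 (2 * Real.pi * (m - (c.S * c.N : ℤ) * t) / (c.S * c.D : ℕ)), t) := by
      intro m
      funext t
      rw [← torusCurve_eq, Complex.ofReal_one, one_mul]
    constructor
    · rintro ⟨m, rfl⟩
      exact ⟨m, m.2, e m⟩
    · rintro ⟨m, hm, rfl⟩
      exact ⟨⟨m, hm⟩, e m⟩
  induction k generalizing γ with
  | zero =>
    rw [ststSolid, Cut.tstLink, Set.mem_union, torus]
    constructor
    · rintro (⟨m, hm, rfl⟩ | h)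
      · exact Or.inl ⟨0, m, hm, by simp⟩
      · exact Or.inr h
    · rintro (⟨l, m, hm, rfl⟩ | h)
      · obtain rfl : l = 0 := Fin.ext (by omega)
        exact Or.inl ⟨m, hm, by simp⟩
      · exact Or.inr h
  | succ k ih =>
    have hshrink : ∀ (r v t : ℝ), shrink (circlePoint r v, t) = (circlePoint (r / 2) v, t) := by
      intro r v t
      simp only [shrink, circlePoint]
      push_cast
      congr 1
      ring
    -- Shrinking fixes the core, so the core of the innermost tst link remains the core of the whole
    -- solid torus.
    have hcore : (fun t => shrink (coreCurve t)) = coreCurve := by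
      funext t
      simp [shrink, coreCurve]
    rw [ststSolid, surger, Set.mem_union, Set.mem_sdiff, Cut.tstLink, Set.mem_union, torus,
      Set.mem_image]
    constructor
    · rintro (⟨⟨m, hm, rfl⟩ | h, hne⟩ | ⟨δ, hδ, rfl⟩)
      · exact Or.inl ⟨0, m, hm, by simp⟩
      · exact absurd h.2 hne
      · rcases (ih _ _).1 hδ with ⟨l, m, hm, rfl⟩ | ⟨ho, rfl⟩
        · refine Or.inl ⟨l.succ, m, hm, funext fun t => ?_⟩
          rw [hshrink, Fin.val_succ, pow_succ]
          congr 2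
          ring
        · exact Or.inr ⟨ho, hcore⟩
    · rintro (⟨l, m, hm, rfl⟩ | ⟨ho, rfl⟩)
      · rcases Fin.eq_zero_or_eq_succ l with rfl | ⟨l, rfl⟩
        · refine Or.inl ⟨Or.inl ⟨m, hm, by simp⟩, ?_⟩
          -- Torus components have norm 1 in the disk and thus are not removed with the core.
          intro h
          have h1 := congrArg (fun γ : ℝ → TorusCoord => ‖(γ 0).1‖) h
          simp only [coreCurve] at h1
          rw [norm_circlePoint (by positivity), norm_zero] at h1
          simp at h1
        · refine Or.inr ⟨_, (ih _ _).2 (Or.inl ⟨l, m, hm, rfl⟩), funext fun t => ?_⟩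
          rw [hshrink, Fin.val_succ, pow_succ]
          congr 2
          ring
      · exact Or.inr ⟨_, (ih _ _).2 (Or.inr ⟨ho, rfl⟩), hcore⟩

/-- The radius of the torus of a layer; the core has radius `0`. -/
def ststRadius (k l : ℕ) : ℝ := if l ≤ k then (1 / 2) ^ l else 0

/-- Each torus link is a layer turning at constant speed, and the core fits the same pattern: at
radius 0 the angle is irrelevant, so its curve is constant in the disk. -/
lemma ststSolid_eq_rotationLink {o : ℕ} (ho : o = 0 ∧ ¬Odd (c (Fin.last k)).M ∨
    o = 1 ∧ Odd (c (Fin.last k)).M) :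
    ststSolid k c = Layering.rotationLink (ststLayering c o) (ststTurns c) (ststRadius k) := by
  have hcore : ∀ v : ℝ → ℝ, (fun t : ℝ => (circlePoint 0 (v t), t)) = coreCurve := by
    intro v
    funext t
    simp [circlePoint, coreCurve]
  ext γ
  rw [mem_ststSolid_iff]
  constructor
  · rintro (⟨l, m, hm, rfl⟩ | ⟨hM, rfl⟩)
    · refine ⟨l, m, by rwa [ststLayering_slots_fin], ?_⟩
      rw [shift_ststTurns_fin, ststLayering_slots_fin, ststRadius, if_pos (by omega)]
    · refine ⟨k + 1, 0, ?_, ?_⟩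
      · rw [ststLayering_slots_core]
        rcases ho with ho | ho
        · exact absurd hM ho.2
        · omega
      · rw [ststRadius, if_neg (by omega), hcore]
  · rintro ⟨l, m, hm, rfl⟩
    rcases lt_trichotomy l (k + 1) with h | rfl | h
    · obtain ⟨l, rfl⟩ : ∃ l' : Fin (k + 1), (l' : ℕ) = l := ⟨⟨l, h⟩, rfl⟩
      refine Or.inl ⟨l, m, by rwa [ststLayering_slots_fin] at hm, ?_⟩
      rw [shift_ststTurns_fin, ststLayering_slots_fin, ststRadius, if_pos (by omega)]
    · rw [ststLayering_slots_core] at hm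
      refine Or.inr ⟨?_, ?_⟩
      · rcases ho with ho | ho
        · omega
        · exact ho.2
      · rw [ststRadius, if_neg (by omega), hcore]
    · rw [ststLayering_slots_gt c h] at hm
      omega

/-- A surgerized tst link is the closure of the braid of its layers. -/
theorem ststLink_ambientIsotopic {o : ℕ} (ho : o = 0 ∧ ¬Odd (c (Fin.last k)).M ∨
    o = 1 ∧ Odd (c (Fin.last k)).M) {w : BraidWord} (hw : w = (List.ofFn fun l : Fin (k + 1) =>
      power (descending (strandsAfter c l + o) ++ ascending (strandsFrom c l + o - 1))
        ((c l).S * (c l).N)).flatten) :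
    w.InBraidGroup (totalStrands c + o) ∧
      AmbientIsotopic (ststLink k c) (closure (totalStrands c + o) w) := by
  have hL := ststTurns_valid c o
  have ho1 : o ≤ 1 := by omega
  rw [← active_word_ststTurns] at hw
  rw [hw, ← ststLayering_bound_zero]
  refine ⟨(Layering.admissible_word hL).inBraidGroup_active, ?_⟩
  rw [ststLink, ststSolid_eq_rotationLink c ho]
  have hpow : ∀ l : ℕ, ((1 : ℝ) / 2) ^ l ≤ 1 := fun l => pow_le_one₀ (by norm_num) (by norm_num)
  have hle : ∀ l, 0 < (ststLayering c o).slots l → l ≤ k + 1 := by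
    intro l hl
    by_contra h
    rw [ststLayering_slots_gt c (by omega)] at hl
    omega
  apply Layering.rotationLink_ambientIsotopic hL
  · intro l
    unfold ststRadius
    split_ifs <;> positivity
  · intro l
    unfold ststRadius
    split_ifs
    · linarith [hpow l]
    · norm_num
  · intro l l' hll hl hl'
    have h1 := hle l' hl'
    rw [ststRadius, ststRadius, if_pos (show l ≤ k by omega)]
    split_ifs
    · exact pow_lt_pow_right_of_lt_one₀ (by norm_num) (by norm_num) hll
    · positivity
  · intro l hl h0
    have h1 := hle l hl
    have h2 : l = k + 1 := by
      by_contra h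
      rw [ststRadius, if_pos (by omega)] at h0
      exact (pow_pos (by norm_num : (0 : ℝ) < 1 / 2) l).ne' h0
    subst h2
    rw [ststLayering_slots_core] at hl ⊢
    omega

end

end Stst

/-- The two cases differ only in the number `o` of core strands. With `o = 1` the core takes
position 1 and raises all other positions by one, which accounts for the longer words and the
additional strand. -/
theorem mainTheorem5 (k : ℕ) (c : Fin (k + 1) → Stst.Cut)
    (hodd : ∀ j : Fin (k + 1), j ≠ Fin.last k → Odd (c j).M) :
    (Even (c (Fin.last k)).M →
      (Stst.ststWordEven c).InBraidGroup (Stst.totalStrands c) ∧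
      Stst.AmbientIsotopic (Stst.ststLink k c)
        (Stst.BraidWord.closure (Stst.totalStrands c) (Stst.ststWordEven c))) ∧
    (Odd (c (Fin.last k)).M →
      (Stst.ststWordOdd c).InBraidGroup (Stst.totalStrands c + 1) ∧
      Stst.AmbientIsotopic (Stst.ststLink k c)
        (Stst.BraidWord.closure (Stst.totalStrands c + 1) (Stst.ststWordOdd c))) :=
  ⟨fun h => Stst.ststLink_ambientIsotopic c (o := 0)
      (Or.inl ⟨rfl, Nat.not_odd_iff_even.2 h⟩) rfl,
    fun h => Stst.ststLink_ambientIsotopic c (o := 1) (Or.inr ⟨rfl, h⟩) rfl⟩
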